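/- **Setting.** Let $A$ be a binary parity-check matrix with $N\ge 1$ columns (variable nodes $i$) and $M$ rows (check nodes $\alpha$). Its factor graph joins $i$ and $\alpha$ iff $A_{\alpha i}=1$; $N(v)$ is the set of neighbours of a node $v$. The code is $\{x\in\mathbb F_2^N: Ax=0\}$, with rate $R=k/N$, $k$ its dimension. Let $X$ be a uniformly distributed codeword, let $x_i$ be sent over a binary memoryless symmetric channel $W_i$ (independently for different $i$; the $W_i$ may differ), let $Y$ be the vector of outputs, and let $H(X|Y)$ be the conditional entropy in bits. Let $c_i$ be the $L$-density of $W_i$: the law on $[-\infty,+\infty]$ of $L(y_i)=\ln\frac{p(x_i=0|y_i)}{p(x_i=1|y_i)}$ given $x_i=0$ (posterior for a uniform input bit). For independent LLRs $L_1\sim a$, $L_2\sim b$, let $a\circledast b$ be the law of $L_1+L_2$ and $a\boxast b$ the law of $2\tanh^{-1}(\tanh\frac{L_1}{2}\tanh\frac{L_2}{2})$. Let $\Delta_0,\Delta_\infty$ be the point masses at $0$ and $+\infty$; an empty $\circledast$ is $\Delta_0$ and an empty $\boxast$ is $\Delta_\infty$. Put $H(c)=\int\log_2(1+e^{-y})\,c(dy)$.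 **Density evolution message by message.** A scheduling policy is a finite sequence $S=(s_1,\dots,s_p)$ of directed edges of the factor graph. Initially $c^{(0)}_{(i,\alpha)}=c^{(0)}_{(\alpha,i)}=\Delta_0$ for all edges. At step $t$ only the density on $s_t$ changes: if $s_t=(i,\alpha)$ then $c^{(t)}_{(i,\alpha)}=c_i\circledast\big(\circledast_{h\in N(i)\setminus\alpha}c^{(t-1)}_{(h,i)}\big)$, and if $s_t=(\alpha,i)$ then $c^{(t)}_{(\alpha,i)}=\boxast_{j\in N(\alpha)\setminus i}\,c^{(t-1)}_{(j,\alpha)}$. (For $t>p$ nothing changes.) The GAP potential functional after $t$ messages is $$U(\boldsymbol c,t)=-\frac1N\Big\{\sum_i H\Big(c_i\circledast\big(\circledast_{\alpha\in N(i)}c^{(t)}_{(\alpha,i)}\big)\Big)+\sum_\alpha\sum_{i\in N(\alpha)}H\big(c^{(t)}_{(i,\alpha)}\big)-\sum_\alpha H\big(\boxast_{i\in N(\alpha)}c^{(t)}_{(i,\alpha)}\big)-\sum_{(i,\alpha)}H\big(c^{(t)}_{(i,\alpha)}\circledast c^{(t)}_{(\alpha,i)}\big)\Big\}.$$ **Theorem.**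 Assume that the factor graph is cycle-free. Then for every scheduling policy $S$: 1. $U(\boldsymbol c,t)$ is non-increasing in $t\ge 0$. 2. If the parity checks (rows of $A$) are linearly independent, then the initial, hence largest, value is $U(\boldsymbol c,0)=1-R-\frac1N\sum_{i=1}^N H(c_i)$. More generally, if every check involves at least one variable, this formula holds with the design rate $1-M/N$ in place of $R$. 3. $U(\boldsymbol c,t)\ge-\frac1N H(X|Y)$ for all $t$, and this bound is sharp: $S$ can be continued by finitely many further messages so that, after all of them, $U$ equals $-\frac1N H(X|Y)$. -/

import Mathlib

open MeasureTheory ProbabilityTheory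

noncomputable section

/-! ### Log-likelihood ratios and `L`-densities -/

/-- `tanh (x / 2)` on the extended reals, with `tanh (± ∞) = ± 1`. -/
def tanhHalf (x : EReal) : ℝ :=
  if x = ⊤ then 1 else if x = ⊥ then -1 else Real.tanh (x.toReal / 2)

/-- `2 tanh⁻¹ r = ln ((1 + r) / (1 - r))` for `r ∈ [-1, 1]`, with values in the extended reals. -/
def twoArtanh (r : ℝ) : EReal :=
  ENNReal.log (ENNReal.ofReal (1 + r) / ENNReal.ofReal (1 - r))

/-- The check-node combination `2 tanh⁻¹ (tanh (x / 2) tanh (y / 2))` of two LLRs. -/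
def boxPlus (x y : EReal) : EReal := twoArtanh (tanhHalf x * tanhHalf y)

theorem tanhHalf_mem (x : EReal) : tanhHalf x ∈ Set.Icc (-1 : ℝ) 1 := by
  unfold tanhHalf
  split_ifs
  · norm_num
  · norm_num
  · exact ⟨(Real.neg_one_lt_tanh _).le, (Real.tanh_lt_one _).le⟩

theorem tanhHalf_twoArtanh {r : ℝ} (hr : r ∈ Set.Icc (-1 : ℝ) 1) :
    tanhHalf (twoArtanh r) = r := by
  obtain ⟨h1, h2⟩ := hr
  rcases eq_or_lt_of_le h1 with rfl | h1
  · simp [tanhHalf, twoArtanh]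
  rcases eq_or_lt_of_le h2 with rfl | h2
  · have h : twoArtanh 1 = ⊤ := by
      unfold twoArtanh
      rw [sub_self, ENNReal.ofReal_zero, ENNReal.div_zero (by norm_num), ENNReal.log_top]
    simp [tanhHalf, h]
  have ha : 0 < 1 + r := by linarith
  have hb : 0 < 1 - r := by linarith
  have hq : 0 < (1 + r) / (1 - r) := div_pos ha hb
  have hlog : twoArtanh r = ((Real.log ((1 + r) / (1 - r)) : ℝ) : EReal) := by
    unfold twoArtanh
    rw [← ENNReal.ofReal_div_of_pos hb, ENNReal.log_ofReal_of_pos hq]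
  have hart : Real.log ((1 + r) / (1 - r)) / 2 = Real.artanh r := by
    rw [Real.artanh_eq_half_log ⟨h1.le, h2.le⟩]; ring
  rw [hlog]
  simp only [tanhHalf, EReal.coe_ne_top, EReal.coe_ne_bot, if_false, EReal.toReal_coe, hart]
  exact Real.tanh_artanh ⟨h1, h2⟩

theorem boxPlus_comm (x y : EReal) : boxPlus x y = boxPlus y x := by
  simp only [boxPlus, mul_comm]

theorem tanhHalf_boxPlus (x y : EReal) :
    tanhHalf (boxPlus x y) = tanhHalf x * tanhHalf y := by
  refine tanhHalf_twoArtanh ?_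
  have hx := tanhHalf_mem x
  have hy := tanhHalf_mem y
  have h : |tanhHalf x * tanhHalf y| ≤ 1 := by
    rw [abs_mul]
    exact mul_le_one₀ (abs_le.2 hx) (abs_nonneg _) (abs_le.2 hy)
  exact abs_le.1 h

theorem boxPlus_assoc (x y z : EReal) :
    boxPlus (boxPlus x y) z = boxPlus x (boxPlus y z) := by
  rw [boxPlus, tanhHalf_boxPlus, boxPlus, tanhHalf_boxPlus, mul_assoc]

theorem measurable_tanhHalf : Measurable tanhHalf := by
  refine Measurable.ite (measurableSet_singleton _) measurable_const ?_
  refine Measurable.ite (measurableSet_singleton _) measurable_const ?_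
  have : Continuous Real.tanh := by
    have h : Real.tanh = fun x => Real.sinh x / Real.cosh x :=
      funext Real.tanh_eq_sinh_div_cosh
    rw [h]
    exact Real.continuous_sinh.div Real.continuous_cosh fun x => (Real.cosh_pos x).ne'
  exact this.measurable.comp (measurable_ereal_toReal.div_const 2)

theorem measurable_twoArtanh : Measurable twoArtanh := by
  unfold twoArtanh
  exact ENNReal.measurable_log.comp (by fun_prop)

theorem measurable_boxPlus_right (x : EReal) : Measurable (boxPlus x) :=
  measurable_twoArtanh.comp (measurable_tanhHalf.const_mul (tanhHalf x))

theorem measurable_boxPlus : Measurable fun p : EReal × EReal => boxPlus p.1 p.2 := by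
  have h := measurable_tanhHalf
  exact measurable_twoArtanh.comp
    ((h.comp measurable_fst).mul (h.comp measurable_snd))

/-- `L`-densities: probability measures on the extended reals. (Those that occur in density
evolution over symmetric channels are symmetric.) -/
abbrev LDensity := ProbabilityMeasure EReal

namespace LDensity

/-- The variable-node convolution `c₁ ⊛ c₂`: the law of the sum of independent LLRs. -/
def varConv (c₁ c₂ : LDensity) : LDensity :=
  ⟨(c₁ : Measure EReal).conv (c₂ : Measure EReal), inferInstance⟩

/-- The check-node convolution `c₁ ⊞ c₂`: the law of
`2 tanh⁻¹ (tanh (L₁ / 2) tanh (L₂ / 2))` for independent LLRs. -/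
def checkConv (c₁ c₂ : LDensity) : LDensity :=
  ⟨Measure.map (fun p : EReal × EReal => boxPlus p.1 p.2)
      ((c₁ : Measure EReal).prod (c₂ : Measure EReal)),
    Measure.isProbabilityMeasure_map measurable_boxPlus.aemeasurable⟩

instance : Std.Commutative varConv :=
  ⟨fun _ _ => Subtype.ext (Measure.conv_comm _ _)⟩

instance : Std.Associative varConv :=
  ⟨fun _ _ _ => Subtype.ext (Measure.conv_assoc _ _ _)⟩

instance : Std.Commutative checkConv := by
  refine ⟨fun a b => Subtype.ext ?_⟩
  change Measure.map _ _ = Measure.map _ _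
  rw [← Measure.prod_swap, Measure.map_map measurable_boxPlus measurable_swap]
  congr 1
  funext p
  exact boxPlus_comm _ _

theorem lintegral_checkConv (a b : LDensity) {f : EReal → ENNReal} (hf : Measurable f) :
    ∫⁻ z, f z ∂(checkConv a b : Measure EReal) =
      ∫⁻ x, ∫⁻ y, f (boxPlus x y) ∂(b : Measure EReal) ∂(a : Measure EReal) := by
  change ∫⁻ z, f z ∂(Measure.map _ _) = _
  rw [lintegral_map hf measurable_boxPlus]
  exact lintegral_prod (fun p : EReal × EReal => f (boxPlus p.1 p.2))
    (hf.comp measurable_boxPlus).aemeasurable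

theorem checkConv_assoc (a b c : LDensity) :
    checkConv (checkConv a b) c = checkConv a (checkConv b c) := by
  apply Subtype.ext
  apply Measure.ext_of_lintegral
  intro f hf
  have h1 : Measurable fun x => ∫⁻ y, f (boxPlus x y) ∂(c : Measure EReal) :=
    Measurable.lintegral_prod_right' (f := fun p : EReal × EReal => f (boxPlus p.1 p.2))
      (hf.comp measurable_boxPlus)
  have e1 := lintegral_checkConv (checkConv a b) c hf
  have e2 := lintegral_checkConv a (checkConv b c) hf
  have e3 := lintegral_checkConv a b h1
  have e4 : ∀ x, ∫⁻ y, f (boxPlus x y) ∂(checkConv b c : Measure EReal) =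
      ∫⁻ y, ∫⁻ z, f (boxPlus (boxPlus x y) z) ∂(c : Measure EReal) ∂(b : Measure EReal) := by
    intro x
    have h2 : Measurable fun y => f (boxPlus x y) :=
      hf.comp (measurable_boxPlus_right x)
    refine (lintegral_checkConv b c h2).trans ?_
    exact lintegral_congr fun y => lintegral_congr fun z =>
      congrArg f (boxPlus_assoc x y z).symm
  simp only [e4] at e2
  exact e1.trans (e3.trans e2.symm)

instance : Std.Associative checkConv := ⟨checkConv_assoc⟩

/-- `Δ₀`, the unit mass at LLR `0`; it is the unit of `⊛`. -/
def deltaZero : LDensity := ⟨Measure.dirac 0, inferInstance⟩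

/-- `Δ_∞`, the unit mass at LLR `+∞`; it is the unit of `⊞`. -/
def deltaTop : LDensity := ⟨Measure.dirac ⊤, inferInstance⟩

/-- The `⊛`-convolution of the family `(c h)`, `h ∈ s` (`Δ₀` if `s` is empty). -/
def bigVarConv {ι : Type*} (s : Finset ι) (c : ι → LDensity) : LDensity :=
  s.fold varConv deltaZero c

/-- The `⊞`-convolution of the family `(c h)`, `h ∈ s` (`Δ_∞` if `s` is empty). -/
def bigCheckConv {ι : Type*} (s : Finset ι) (c : ι → LDensity) : LDensity :=
  s.fold checkConv deltaTop c

/-- The entropy `H(c) = ∫ log₂ (1 + e^{-y}) c(dy)` of an `L`-density; the integrand is `0` at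
`y = +∞` (its value at `y = -∞`, a null set for symmetric densities, is irrelevant). -/
def entropy (c : LDensity) : ℝ :=
  ∫ y, Real.logb 2 (1 + (EReal.exp (-y)).toReal) ∂(c : Measure EReal)

end LDensity

/-! ### Binary memoryless symmetric channels -/

/-- A binary-input symmetric channel with output alphabet `Y`: the two output laws are exchanged by
a measurable involution of the alphabet (for instance `y ↦ -y` on `ℝ`). -/
structure BMSChannel (Y : Type*) [MeasurableSpace Y] where
  law : ZMod 2 → Measure Y
  isProbabilityMeasure_law : ∀ b, IsProbabilityMeasure (law b)
  symmetric : ∃ π : Y → Y, Measurable π ∧ Function.Involutive π ∧ law 1 = (law 0).map π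

namespace BMSChannel

variable {Y : Type*} [MeasurableSpace Y]

instance (W : BMSChannel Y) (b : ZMod 2) : IsProbabilityMeasure (W.law b) :=
  W.isProbabilityMeasure_law b

/-- The posterior probability `p(x = b | y)` for a uniformly distributed input bit. -/
def bitPosterior (W : BMSChannel Y) (b : ZMod 2) (y : Y) : ENNReal :=
  (W.law b).rnDeriv (W.law 0 + W.law 1) y

/-- The log-likelihood ratio `L(y) = ln (p(x = 0 | y) / p(x = 1 | y))`. -/
def llr (W : BMSChannel Y) (y : Y) : EReal :=
  ENNReal.log (W.bitPosterior 0 y / W.bitPosterior 1 y)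

theorem measurable_llr (W : BMSChannel Y) : Measurable W.llr :=
  ENNReal.measurable_log.comp
    ((Measure.measurable_rnDeriv _ _).div (Measure.measurable_rnDeriv _ _))

/-- The `L`-density of the channel: the law of `L(y)` conditioned on the input `0`. -/
def lDensity (W : BMSChannel Y) : LDensity :=
  ⟨(W.law 0).map W.llr, Measure.isProbabilityMeasure_map W.measurable_llr.aemeasurable⟩

end BMSChannel

/-! ### Binary linear codes, factor graphs and the conditional entropy

`A` is the parity-check matrix; its columns are the variable nodes and its rows the check nodes. -/

variable {V C : Type*}

/-- The factor graph of `A`: variable node `i` and check node `a` are adjacent iff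
`A a i ≠ 0`. -/
def factorGraph (A : Matrix C V (ZMod 2)) : SimpleGraph (V ⊕ C) where
  Adj
    | Sum.inl i, Sum.inr a => A a i ≠ 0
    | Sum.inr a, Sum.inl i => A a i ≠ 0
    | _, _ => False
  symm := ⟨by rintro (i | a) (j | b) h <;> exact h⟩
  loopless := ⟨by rintro (i | a) h <;> exact h⟩

/-- The code `{x | A x = 0}`. -/
def binaryCode [Fintype V] (A : Matrix C V (ZMod 2)) : Submodule (ZMod 2) (V → ZMod 2) :=
  LinearMap.ker A.mulVecLin

/-- The code rate `R = k / N`, where `k` is the dimension of the code. -/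
def codeRate [Fintype V] (A : Matrix C V (ZMod 2)) : ℝ :=
  (Module.finrank (ZMod 2) (binaryCode A) : ℝ) / (Fintype.card V : ℝ)

/-- The law of the output `Y` given the input word: independent uses of the channels `W i`. -/
def channelKernel [Fintype V] {Y : Type*} [MeasurableSpace Y] (W : V → BMSChannel Y) :
    Kernel (V → ZMod 2) (V → Y) :=
  Kernel.ofFunOfCountable fun x => Measure.pi fun i => (W i).law (x i)

instance [Fintype V] {Y : Type*} [MeasurableSpace Y] (W : V → BMSChannel Y) :
    IsMarkovKernel (channelKernel W) :=
  ⟨fun x => inferInstanceAs (IsProbabilityMeasure (Measure.pi fun i => (W i).law (x i)))⟩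

/-- The law of the input `X`: a uniformly distributed codeword. -/
def codewordLaw [Fintype V] (A : Matrix C V (ZMod 2)) : Measure (V → ZMod 2) :=
  uniformOn (binaryCode A : Set (V → ZMod 2))

instance [Fintype V] (A : Matrix C V (ZMod 2)) : IsProbabilityMeasure (codewordLaw A) :=
  isProbabilityMeasure_uniformOn (Set.toFinite _) ⟨0, (binaryCode A).zero_mem⟩

/-- The conditional entropy `H(X | Y)` in bits,
`E_Y [- ∑ₓ P(X = x | Y) log₂ P(X = x | Y)]`, of a uniformly distributed codeword `X` given the
output `Y` of the channels. -/
def condEntropy [Fintype V] [DecidableEq V] {Y : Type*} [MeasurableSpace Y]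
    (A : Matrix C V (ZMod 2)) (W : V → BMSChannel Y) : ℝ :=
  (∫ y, ∑ x : V → ZMod 2,
      Real.negMulLog (((posterior (channelKernel W) (codewordLaw A)) y).real {x})
    ∂((codewordLaw A).bind (channelKernel W))) / Real.log 2

/-! ### Density evolution message by message -/

/-- `N(i)`, the check nodes adjacent to the variable node `i`. -/
def varNbrs [Fintype C] (A : Matrix C V (ZMod 2)) (i : V) : Finset C :=
  Finset.univ.filter fun a => A a i ≠ 0

/-- `N(a)`, the variable nodes adjacent to the check node `a`. -/
def checkNbrs [Fintype V] (A : Matrix C V (ZMod 2)) (a : C) : Finset V :=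
  Finset.univ.filter fun i => A a i ≠ 0

/-- The directed edges of the factor graph. -/
inductive DirectedEdge (A : Matrix C V (ZMod 2)) where
  | varToCheck (i : V) (a : C) (h : A a i ≠ 0) : DirectedEdge A
  | checkToVar (a : C) (i : V) (h : A a i ≠ 0) : DirectedEdge A

/-- The current densities `c_(i,a)` and `c_(a,i)`; only the values on edges matter. -/
structure Messages (V C : Type*) where
  varToCheck : V → C → LDensity
  checkToVar : C → V → LDensity

/-- Initially every message density is `Δ₀`. -/
def initMessages (V C : Type*) : Messages V C :=
  ⟨fun _ _ => LDensity.deltaZero, fun _ _ => LDensity.deltaZero⟩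

section DensityEvolution

variable [Fintype V] [Fintype C] [DecidableEq V] [DecidableEq C]

/-- Pass one message: the density on the given directed edge is recomputed from the current ones,
all others are kept. -/
def passMessage (A : Matrix C V (ZMod 2)) (c : V → LDensity) (m : Messages V C) :
    DirectedEdge A → Messages V C
  | .varToCheck i a _ =>
    { m with
      varToCheck := Function.update m.varToCheck i (Function.update (m.varToCheck i) a
        (LDensity.varConv (c i)
          (LDensity.bigVarConv ((varNbrs A i).erase a) fun h => m.checkToVar h i))) }
  | .checkToVar a i _ =>
    { m with
      checkToVar := Function.update m.checkToVar a (Function.update (m.checkToVar a) i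
        (LDensity.bigCheckConv ((checkNbrs A a).erase i) fun j => m.varToCheck j a)) }

/-- The densities after the first `t` messages of the scheduling policy `S` have been passed
(after all of them, if `t` exceeds the length of `S`). -/
def messagesAt (A : Matrix C V (ZMod 2)) (c : V → LDensity) (S : List (DirectedEdge A)) (t : ℕ) :
    Messages V C :=
  (S.take t).foldl (passMessage A c) (initMessages V C)

/-- The GAP potential functional at given message densities `m`. -/
def gapPotential (A : Matrix C V (ZMod 2)) (c : V → LDensity) (m : Messages V C) : ℝ :=
  -(1 / (Fintype.card V : ℝ)) *
    (∑ i, (LDensity.varConv (c i)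
        (LDensity.bigVarConv (varNbrs A i) fun a => m.checkToVar a i)).entropy
      + ∑ a, ∑ i ∈ checkNbrs A a, (m.varToCheck i a).entropy
      - ∑ a, (LDensity.bigCheckConv (checkNbrs A a) fun i => m.varToCheck i a).entropy
      - ∑ i, ∑ a ∈ varNbrs A i, (LDensity.varConv (m.varToCheck i a) (m.checkToVar a i)).entropy)

/-- `U(c, t)`, for the factor graph of `A` and the scheduling policy `S`. -/
def gapU (A : Matrix C V (ZMod 2)) (S : List (DirectedEdge A)) (c : V → LDensity) (t : ℕ) : ℝ :=
  gapPotential A c (messagesAt A c S t)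

end DensityEvolution

end

noncomputable section

set_option linter.unusedSectionVars false

/-! ### Algebra of log-likelihood ratios -/

/-! The bracket in U is the Bethe entropy `betheEntropy`, so U is non-increasing once this never
decreases when a message is recomputed. All densities that occur are symmetric: those of the
channels are, by `BMSChannel.isSymm_lDensity`, and both convolutions preserve symmetry. Two facts
about symmetric densities carry the argument. The identity (1+e^{-(x+y)})(1+e^{-(x⊞y)}) =
(1+e^{-x})(1+e^{-y}) integrates to the duality rule H(a⊛b) + H(a⊞b) = H(a) + H(b)
(`IsSymm.entropy_varConv_add_checkConv`). Moreover 1 - H(c) is a series with nonnegative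
coefficients in the even moments of tanh(L/2) (`IsSymm.hasSum_entropy`), and these moments are
multiplicative under ⊞ (`evenMoment_checkConv`).

Monotonicity: Δ₀ is least in the degradation order and both convolutions are monotone, so along any
schedule every message stays degraded with respect to its own update (`Messages.Improving`). The
change of the Bethe entropy caused by one message is, by duality, a mixed second difference of
H(a⊛b) over two comparable pairs. Again by duality it is a series of nonnegative coefficients times
products of two nonnegative moment differences (`Degraded.entropy_varConv_add_le`,
`betheEntropy_le_passMessage`). Cycles play no role here.

Sharpness: on a cycle-free graph the dependence between messages is well-founded, so finitely many
further messages reach a fixed point (`exists_settled`). There the Bethe entropy equals H(X|Y).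
Indeed channel symmetry gives H(X|Y) = E log₂ Z, where Z sums ∏_{x_v=1} e^{-L_v} over the codewords
and the L_v are independent with laws c_v (`condEntropy_eq_codeEntropy`). A check with at most one
non-leaf neighbour can be deleted, its message to the remaining neighbour being absorbed into the
channel density there; E log₂ Z and the Bethe entropy both grow by the entropy of that message
(`codeEntropy_eliminate`, `betheEntropy_eliminate`). Without checks both are ∑ H(c_i). The lower
bound at time t follows by continuing the first t messages to a fixed point and using monotonicity.
-/

/-- The likelihood ratio `e^{-x}` as a real number. -/
def expNeg (x : EReal) : ℝ := (EReal.exp (-x)).toReal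

theorem expNeg_nonneg (x : EReal) : 0 ≤ expNeg x := ENNReal.toReal_nonneg

@[simp] theorem expNeg_top : expNeg ⊤ = 0 := by simp [expNeg]

@[simp] theorem expNeg_bot : expNeg ⊥ = 0 := by simp [expNeg]

theorem expNeg_coe (x : ℝ) : expNeg x = Real.exp (-x) := by
  rw [expNeg, ← EReal.coe_neg, EReal.exp_coe, ENNReal.toReal_ofReal (Real.exp_pos _).le]

@[simp] theorem expNeg_zero : expNeg 0 = 1 := by simp [expNeg]

/-- No exceptional case arises: `⊥` absorbs in sums, and `expNeg ⊥ = 0` because `ENNReal.toReal ⊤ =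
0`. -/
theorem expNeg_add (x y : EReal) : expNeg (x + y) = expNeg x * expNeg y := by
  induction x <;> induction y <;> try simp
  rw [← EReal.coe_add, expNeg_coe, expNeg_coe, expNeg_coe, ← Real.exp_add]
  ring_nf

theorem measurable_expNeg : Measurable expNeg :=
  (measurable_neg.ereal_exp).ennreal_toReal

@[simp] theorem tanhHalf_top : tanhHalf ⊤ = 1 := by simp [tanhHalf]

@[simp] theorem tanhHalf_bot : tanhHalf ⊥ = -1 := by simp [tanhHalf]

@[simp] theorem tanhHalf_zero : tanhHalf 0 = 0 := by simp [tanhHalf]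

theorem tanhHalf_coe (x : ℝ) : tanhHalf x = (1 - Real.exp (-x)) / (1 + Real.exp (-x)) := by
  have h : Real.exp (-(x / 2)) = Real.exp (x / 2) * Real.exp (-x) := by
    rw [← Real.exp_add]; ring_nf
  simp only [tanhHalf, EReal.coe_ne_top, EReal.coe_ne_bot, if_false, EReal.toReal_coe]
  rw [Real.tanh_eq, h]
  have := Real.exp_pos (x / 2)
  have := Real.exp_pos (-x)
  field_simp

theorem tanhHalf_eq {x : EReal} (hx : x ≠ ⊥) :
    tanhHalf x = (1 - expNeg x) / (1 + expNeg x) := by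
  induction x with
  | bot => exact absurd rfl hx
  | top => simp
  | coe x => rw [expNeg_coe, tanhHalf_coe]

theorem one_add_tanhHalf {x : EReal} (hx : x ≠ ⊥) : 1 + tanhHalf x = 2 / (1 + expNeg x) := by
  have := expNeg_nonneg x
  rw [tanhHalf_eq hx]
  field_simp
  ring

theorem expNeg_eq (x : EReal) : expNeg x = (1 - tanhHalf x) / (1 + tanhHalf x) := by
  by_cases hx : x = ⊥
  · simp [hx]
  have := expNeg_nonneg x
  rw [one_add_tanhHalf hx, tanhHalf_eq hx]
  field_simp
  ring

theorem tanhHalf_eq_neg_one_iff {x : EReal} : tanhHalf x = -1 ↔ x = ⊥ := by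
  refine ⟨fun h => ?_, fun h => by simp [h]⟩
  by_contra hx
  have h1 := one_add_tanhHalf hx
  have : 0 < 2 / (1 + expNeg x) := by have := expNeg_nonneg x; positivity
  linarith

theorem add_ne_bot {x y : EReal} (hx : x ≠ ⊥) (hy : y ≠ ⊥) : x + y ≠ ⊥ := by
  simp [EReal.add_eq_bot_iff, hx, hy]

/-- The addition formula for `tanh`. -/
def tanhAdd (s t : ℝ) : ℝ := (s + t) / (1 + s * t)

theorem tanhHalf_add {x y : EReal} (hx : x ≠ ⊥) (hy : y ≠ ⊥) :
    tanhHalf (x + y) = tanhAdd (tanhHalf x) (tanhHalf y) := by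
  have h1 := expNeg_nonneg x
  have h2 := expNeg_nonneg y
  rw [tanhAdd, tanhHalf_eq (add_ne_bot hx hy), tanhHalf_eq hx, tanhHalf_eq hy, expNeg_add]
  have h3 : 0 < 1 + expNeg x * expNeg y := by positivity
  have e1 : (1 - expNeg x) / (1 + expNeg x) + (1 - expNeg y) / (1 + expNeg y)
      = 2 * (1 - expNeg x * expNeg y) / ((1 + expNeg x) * (1 + expNeg y)) := by
    field_simp; ring
  have e2 : 1 + (1 - expNeg x) / (1 + expNeg x) * ((1 - expNeg y) / (1 + expNeg y))
      = 2 * (1 + expNeg x * expNeg y) / ((1 + expNeg x) * (1 + expNeg y)) := by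
    field_simp; ring
  rw [e1, e2]
  field_simp

/-- The pointwise form of the duality rule for entropy. It fails at `⊥`, where `expNeg` takes a
default value. -/
theorem one_add_expNeg_mul {x y : EReal} (hx : x ≠ ⊥) (hy : y ≠ ⊥) :
    (1 + expNeg (x + y)) * (1 + expNeg (boxPlus x y)) = (1 + expNeg x) * (1 + expNeg y) := by
  have h1 := expNeg_nonneg x
  have h2 := expNeg_nonneg y
  have h3 : 0 < 1 + expNeg x * expNeg y := by positivity
  rw [expNeg_eq (boxPlus x y), tanhHalf_boxPlus, expNeg_add, tanhHalf_eq hx, tanhHalf_eq hy]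
  have e2 : 1 + (1 - expNeg x) / (1 + expNeg x) * ((1 - expNeg y) / (1 + expNeg y))
      = 2 * (1 + expNeg x * expNeg y) / ((1 + expNeg x) * (1 + expNeg y)) := by
    field_simp; ring
  have e3 : 1 - (1 - expNeg x) / (1 + expNeg x) * ((1 - expNeg y) / (1 + expNeg y))
      = 2 * (expNeg x + expNeg y) / ((1 + expNeg x) * (1 + expNeg y)) := by
    field_simp; ring
  rw [e2, e3]
  field_simp
  ring

theorem measurable_tanhAdd : Measurable fun q : ℝ × ℝ => tanhAdd q.1 q.2 := by
  unfold tanhAdd; fun_prop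

theorem tanhAdd_neg_neg (s t : ℝ) : tanhAdd (-s) (-t) = -tanhAdd s t := by
  simp only [tanhAdd]; rw [neg_mul_neg, ← neg_div]; ring_nf

theorem tanhAdd_neg_left (s t : ℝ) : tanhAdd (-s) t = -tanhAdd s (-t) := by
  rw [← tanhAdd_neg_neg, neg_neg]

theorem mul_mem_Icc {s t : ℝ} (hs : s ∈ Set.Icc (-1 : ℝ) 1) (ht : t ∈ Set.Icc (-1 : ℝ) 1) :
    s * t ∈ Set.Icc (-1 : ℝ) 1 := by
  obtain ⟨a, b⟩ := hs
  obtain ⟨c, d⟩ := ht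
  constructor <;> nlinarith

theorem neg_mem_Icc {s : ℝ} (hs : s ∈ Set.Icc (-1 : ℝ) 1) : -s ∈ Set.Icc (-1 : ℝ) 1 :=
  ⟨by linarith [hs.2], by linarith [hs.1]⟩

theorem eq_zero_of_one_add_mul_eq_zero {s t : ℝ} (hs : s ∈ Set.Icc (-1 : ℝ) 1)
    (ht : t ∈ Set.Icc (-1 : ℝ) 1) (h : 1 + s * t = 0) :
    (1 + s) * (1 + t) = 0 ∧ (1 - s) * (1 - t) = 0 := by
  obtain ⟨a, b⟩ := hs
  obtain ⟨c, d⟩ := ht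
  have h1 : 0 ≤ (1 + s) * (1 + t) := mul_nonneg (by linarith) (by linarith)
  have h2 : 0 ≤ (1 - s) * (1 - t) := mul_nonneg (by linarith) (by linarith)
  constructor <;> nlinarith

/-- In multiplied-out form the addition law survives the exceptional points `1 + s * t = 0`, where
`tanhAdd` has the default value `0` and both sides vanish. -/
theorem one_add_tanhAdd_mul {s t : ℝ} (hs : s ∈ Set.Icc (-1 : ℝ) 1)
    (ht : t ∈ Set.Icc (-1 : ℝ) 1) :
    (1 + tanhAdd s t) * (1 + s * t) = (1 + s) * (1 + t) := by
  by_cases h : 1 + s * t = 0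
  · rw [h, (eq_zero_of_one_add_mul_eq_zero hs ht h).1, mul_zero]
  · rw [tanhAdd]; field_simp; ring

theorem one_sub_tanhAdd_mul {s t : ℝ} (hs : s ∈ Set.Icc (-1 : ℝ) 1)
    (ht : t ∈ Set.Icc (-1 : ℝ) 1) :
    (1 - tanhAdd s t) * (1 + s * t) = (1 - s) * (1 - t) := by
  have := one_add_tanhAdd_mul hs ht
  linear_combination (-1) * this

theorem tanhAdd_mem {s t : ℝ} (hs : s ∈ Set.Icc (-1 : ℝ) 1) (ht : t ∈ Set.Icc (-1 : ℝ) 1) :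
    tanhAdd s t ∈ Set.Icc (-1 : ℝ) 1 := by
  by_cases h : 1 + s * t = 0
  · simp [tanhAdd, h]
  have h0 : 0 < 1 + s * t := lt_of_le_of_ne (by linarith [(mul_mem_Icc hs ht).1]) (Ne.symm h)
  have h1 := one_add_tanhAdd_mul hs ht
  have h2 := one_sub_tanhAdd_mul hs ht
  obtain ⟨a, b⟩ := hs
  obtain ⟨c, d⟩ := ht
  have h3 : 0 ≤ (1 + s) * (1 + t) := mul_nonneg (by linarith) (by linarith)
  have h4 : 0 ≤ (1 - s) * (1 - t) := mul_nonneg (by linarith) (by linarith)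
  rw [← h1] at h3
  rw [← h2] at h4
  have := nonneg_of_mul_nonneg_left h3 h0
  have := nonneg_of_mul_nonneg_left h4 h0
  constructor <;> linarith

/-! ### Symmetric `L`-densities -/

/-- The probability `(1 + s) / 2` of a bit of mean `s`. -/
def bitProb (s : ℝ) : ENNReal := ENNReal.ofReal ((1 + s) / 2)

theorem measurable_bitProb : Measurable bitProb := by unfold bitProb; fun_prop

theorem bitProb_add_neg {s : ℝ} (hs : s ∈ Set.Icc (-1 : ℝ) 1) :
    bitProb s + bitProb (-s) = 1 := by
  obtain ⟨a, b⟩ := hs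
  rw [bitProb, bitProb, ← ENNReal.ofReal_add (by linarith) (by linarith),
    show (1 + s) / 2 + (1 + -s) / 2 = 1 by ring, ENNReal.ofReal_one]

theorem bitProb_mul_add {s t : ℝ} (hs : s ∈ Set.Icc (-1 : ℝ) 1) (ht : t ∈ Set.Icc (-1 : ℝ) 1) :
    bitProb s * bitProb t + bitProb (-s) * bitProb (-t) = bitProb (s * t) := by
  obtain ⟨a, b⟩ := hs
  obtain ⟨c, d⟩ := ht
  simp only [bitProb]
  rw [← ENNReal.ofReal_mul (by linarith), ← ENNReal.ofReal_mul (by linarith),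
    ← ENNReal.ofReal_add (mul_nonneg (by linarith) (by linarith))
      (mul_nonneg (by linarith) (by linarith))]
  congr 1
  ring

/-- Bayes' rule: two independent bits of means `s` and `t` agree with probability `bitProb (s * t)`,
and given agreement their common value has mean `tanhAdd s t`. -/
theorem bitProb_tanhAdd {s t : ℝ} (hs : s ∈ Set.Icc (-1 : ℝ) 1) (ht : t ∈ Set.Icc (-1 : ℝ) 1) :
    bitProb (s * t) * bitProb (tanhAdd s t) = bitProb s * bitProb t := by
  have h := one_add_tanhAdd_mul hs ht
  have h1 := (mul_mem_Icc hs ht).1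
  simp only [bitProb]
  rw [← ENNReal.ofReal_mul (by linarith), ← ENNReal.ofReal_mul (by linarith [hs.1])]
  congr 1
  linear_combination h / 4

theorem bitProb_neg_tanhAdd {s t : ℝ} (hs : s ∈ Set.Icc (-1 : ℝ) 1)
    (ht : t ∈ Set.Icc (-1 : ℝ) 1) :
    bitProb (s * t) * bitProb (-tanhAdd s t) = bitProb (-s) * bitProb (-t) := by
  rw [← tanhAdd_neg_neg, ← bitProb_tanhAdd (neg_mem_Icc hs) (neg_mem_Icc ht), neg_mul_neg]

namespace LDensity

/-- An `L`-density is symmetric if the bit with mean `tanh (L / 2)` is distributed like the one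
observed: flipping the sign of `L` with the posterior probability of an error changes nothing. -/
def IsSymm (c : LDensity) : Prop :=
  ∀ g : ℝ → ENNReal, Measurable g →
    ∫⁻ x, g (tanhHalf x) ∂(c : Measure EReal) =
      ∫⁻ x, (bitProb (tanhHalf x) * g (tanhHalf x) + bitProb (-tanhHalf x) * g (-tanhHalf x))
        ∂(c : Measure EReal)

/-- Symmetry is tested on the indicator of `-1`: the value `-1` has posterior weight `bitProb (-1) =
0`, so the symmetrised integrand is zero. -/
theorem IsSymm.ae_ne_bot {c : LDensity} (hc : c.IsSymm) : ∀ᵐ x ∂(c : Measure EReal), x ≠ ⊥ := by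
  have h := hc (Set.indicator {-1} 1) (measurable_one.indicator (measurableSet_singleton _))
  have h0 : ∀ s : ℝ, bitProb s * Set.indicator {-1} 1 s = 0 := by
    intro s
    by_cases hs : s = -1
    · simp [hs, bitProb]
    · simp [hs]
  simp only [h0, add_zero, lintegral_zero] at h
  have hm : Measurable fun x => Set.indicator {(-1 : ℝ)} (1 : ℝ → ENNReal) (tanhHalf x) :=
    (measurable_one.indicator (measurableSet_singleton _)).comp measurable_tanhHalf
  rw [lintegral_eq_zero_iff hm] at h
  filter_upwards [h] with x hx hbot
  simp [hbot] at hx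

theorem isSymm_deltaZero : deltaZero.IsSymm := by
  intro g hg
  have h := measurable_tanhHalf
  have h1 := measurable_bitProb
  change ∫⁻ x, _ ∂(Measure.dirac 0) = ∫⁻ x, _ ∂(Measure.dirac 0)
  rw [lintegral_dirac' _ (by fun_prop), lintegral_dirac' _ (by fun_prop)]
  have := bitProb_add_neg (s := 0) (by norm_num)
  simp only [tanhHalf_zero, neg_zero, ← add_mul] at this ⊢
  rw [this, one_mul]

theorem isSymm_deltaTop : deltaTop.IsSymm := by
  intro g hg
  have h := measurable_tanhHalf
  have h1 := measurable_bitProb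
  change ∫⁻ x, _ ∂(Measure.dirac ⊤) = ∫⁻ x, _ ∂(Measure.dirac ⊤)
  rw [lintegral_dirac' _ (by fun_prop), lintegral_dirac' _ (by fun_prop)]
  simp [bitProb]

theorem lintegral_varConv (a b : LDensity) {f : EReal → ENNReal} (hf : Measurable f) :
    ∫⁻ z, f z ∂(varConv a b : Measure EReal) =
      ∫⁻ x, ∫⁻ y, f (x + y) ∂(b : Measure EReal) ∂(a : Measure EReal) :=
  Measure.lintegral_conv hf

/-- The average of `G` over the four sign patterns, weighted with the posterior probabilities. -/
def signAverage (G : ℝ → ℝ → ENNReal) (s t : ℝ) : ENNReal :=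
  bitProb s * (bitProb t * G s t + bitProb (-t) * G s (-t)) +
    bitProb (-s) * (bitProb t * G (-s) t + bitProb (-t) * G (-s) (-t))

theorem IsSymm.lintegral_lintegral {a b : LDensity} (ha : a.IsSymm) (hb : b.IsSymm)
    {G : ℝ → ℝ → ENNReal} (hG : Measurable (Function.uncurry G)) :
    ∫⁻ x, ∫⁻ y, G (tanhHalf x) (tanhHalf y) ∂(b : Measure EReal) ∂(a : Measure EReal) =
      ∫⁻ x, ∫⁻ y, signAverage G (tanhHalf x) (tanhHalf y)
        ∂(b : Measure EReal) ∂(a : Measure EReal) := by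
  have h1 := measurable_tanhHalf
  have h2 := measurable_bitProb
  have hG' : ∀ {f g : ℝ × EReal → ℝ}, Measurable f → Measurable g →
      Measurable fun q => G (f q) (g q) := fun hf hg => hG.comp (hf.prodMk hg)
  have hG'' : ∀ {s : ℝ} {g : EReal → ℝ}, Measurable g →
      Measurable fun q => G s (g q) := fun hg => hG.comp (measurable_const.prodMk hg)
  have hin : ∀ s : ℝ, ∫⁻ y, G s (tanhHalf y) ∂(b : Measure EReal) =
      ∫⁻ y, (bitProb (tanhHalf y) * G s (tanhHalf y) + bitProb (-tanhHalf y) * G s (-tanhHalf y))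
        ∂(b : Measure EReal) :=
    fun s => hb (G s) (hG.comp (measurable_const.prodMk measurable_id))
  simp_rw [hin]
  set K : ℝ → ENNReal := fun s => ∫⁻ y, (bitProb (tanhHalf y) * G s (tanhHalf y) +
    bitProb (-tanhHalf y) * G s (-tanhHalf y)) ∂(b : Measure EReal) with hK
  have hmeas : ∀ s : ℝ, Measurable fun y => (bitProb (tanhHalf y) * G s (tanhHalf y) +
      bitProb (-tanhHalf y) * G s (-tanhHalf y)) := fun s =>
    ((h2.comp h1).mul (hG'' h1)).add ((h2.comp h1.neg).mul (hG'' h1.neg))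
  have hKm : Measurable K := by
    refine Measurable.lintegral_prod_right' (f := fun q : ℝ × EReal =>
      bitProb (tanhHalf q.2) * G q.1 (tanhHalf q.2) +
      bitProb (-tanhHalf q.2) * G q.1 (-tanhHalf q.2)) ?_
    exact ((h2.comp (h1.comp measurable_snd)).mul (hG' measurable_fst (h1.comp measurable_snd))).add
      ((h2.comp (h1.comp measurable_snd).neg).mul
        (hG' measurable_fst (h1.comp measurable_snd).neg))
  refine (ha K hKm).trans (lintegral_congr fun x => ?_)
  simp only [hK, signAverage]
  rw [lintegral_add_left ((hmeas _).const_mul _), lintegral_const_mul _ (hmeas _),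
    lintegral_const_mul _ (hmeas _)]

/-- Equal signs give the product `s * t`, opposite signs give `-(s * t)`; the weights of the two
groups add up to `bitProb (± (s * t))`. -/
theorem signAverage_mul (g : ℝ → ENNReal) {s t : ℝ} (hs : s ∈ Set.Icc (-1 : ℝ) 1)
    (ht : t ∈ Set.Icc (-1 : ℝ) 1) :
    signAverage (fun s t => g (s * t)) s t =
      bitProb (s * t) * g (s * t) + bitProb (-(s * t)) * g (-(s * t)) := by
  have h2 := bitProb_mul_add hs (neg_mem_Icc ht)
  rw [neg_neg, mul_neg] at h2
  rw [← bitProb_mul_add hs ht, ← h2]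
  simp only [signAverage, mul_neg, neg_mul, neg_neg]
  ring

theorem IsSymm.checkConv {a b : LDensity} (ha : a.IsSymm) (hb : b.IsSymm) :
    (checkConv a b).IsSymm := by
  intro g hg
  have h1 := measurable_tanhHalf
  have h2 := measurable_bitProb
  rw [lintegral_checkConv _ _ (f := fun x => g (tanhHalf x)) (hg.comp h1),
    lintegral_checkConv _ _ (by fun_prop)]
  simp only [tanhHalf_boxPlus]
  refine (ha.lintegral_lintegral hb (G := fun s t => g (s * t)) (by
    exact hg.comp (measurable_fst.mul measurable_snd))).trans
    (lintegral_congr fun x => lintegral_congr fun y => ?_)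
  exact signAverage_mul g (tanhHalf_mem x) (tanhHalf_mem y)

theorem signAverage_tanhAdd (g : ℝ → ENNReal) {s t : ℝ} :
    signAverage (fun s t => g (tanhAdd s t)) s t =
      bitProb s * bitProb t * g (tanhAdd s t) + bitProb (-s) * bitProb (-t) * g (-tanhAdd s t) +
      (bitProb s * bitProb (-t) * g (tanhAdd s (-t)) +
        bitProb (-s) * bitProb t * g (-tanhAdd s (-t))) := by
  simp only [signAverage, tanhAdd_neg_left, neg_neg]
  ring

theorem IsSymm.lintegral_varConv {a b : LDensity} (ha : a.IsSymm) (hb : b.IsSymm)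
    {g : ℝ → ENNReal} (hg : Measurable g) :
    ∫⁻ z, g (tanhHalf z) ∂(varConv a b : Measure EReal) =
      ∫⁻ x, ∫⁻ y, signAverage (fun s t => g (tanhAdd s t)) (tanhHalf x) (tanhHalf y)
        ∂(b : Measure EReal) ∂(a : Measure EReal) := by
  rw [LDensity.lintegral_varConv _ _ (f := fun x => g (tanhHalf x)) (hg.comp measurable_tanhHalf),
    ← ha.lintegral_lintegral hb (G := fun s t => g (tanhAdd s t)) (hg.comp measurable_tanhAdd)]
  refine lintegral_congr_ae ?_
  filter_upwards [ha.ae_ne_bot] with x hx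
  refine lintegral_congr_ae ?_
  filter_upwards [hb.ae_ne_bot] with y hy
  rw [tanhHalf_add hx hy]

/-- The four sign patterns split into two groups, equal signs and opposite signs. By Bayes' rule
each group carries the values `± tanhAdd s (± t)` with exactly the conditional weights of a
symmetric pair, so symmetrising once more changes nothing. -/
theorem IsSymm.varConv {a b : LDensity} (ha : a.IsSymm) (hb : b.IsSymm) :
    (varConv a b).IsSymm := by
  intro g hg
  have h2 := measurable_bitProb
  rw [ha.lintegral_varConv hb hg, ha.lintegral_varConv hb
    (g := fun s => bitProb s * g s + bitProb (-s) * g (-s)) (by fun_prop)]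
  refine lintegral_congr fun x => lintegral_congr fun y => ?_
  have hs := tanhHalf_mem x
  have ht := tanhHalf_mem y
  rw [signAverage_tanhAdd,
    signAverage_tanhAdd fun s => bitProb s * g s + bitProb (-s) * g (-s)]
  set s := tanhHalf x
  set t := tanhHalf y
  simp only [neg_neg]
  have e1 := bitProb_mul_add hs ht
  have e2 := bitProb_mul_add hs (neg_mem_Icc ht)
  rw [neg_neg] at e2
  have e3 := bitProb_tanhAdd hs ht
  have e4 := bitProb_tanhAdd hs (neg_mem_Icc ht)
  have e5 := bitProb_neg_tanhAdd hs ht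
  have e6 := bitProb_neg_tanhAdd hs (neg_mem_Icc ht)
  rw [neg_neg] at e6
  calc _ = bitProb (s * t) * bitProb (tanhAdd s t) * g (tanhAdd s t)
        + bitProb (s * t) * bitProb (-tanhAdd s t) * g (-tanhAdd s t)
        + (bitProb (s * -t) * bitProb (tanhAdd s (-t)) * g (tanhAdd s (-t))
        + bitProb (s * -t) * bitProb (-tanhAdd s (-t)) * g (-tanhAdd s (-t))) := by
          rw [e3, e4, e5, e6]
    _ = (bitProb s * bitProb t + bitProb (-s) * bitProb (-t)) *
          (bitProb (tanhAdd s t) * g (tanhAdd s t) + bitProb (-tanhAdd s t) * g (-tanhAdd s t))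
        + (bitProb s * bitProb (-t) + bitProb (-s) * bitProb t) *
          (bitProb (tanhAdd s (-t)) * g (tanhAdd s (-t)) +
            bitProb (-tanhAdd s (-t)) * g (-tanhAdd s (-t))) := by
          rw [e1, e2]; ring
    _ = _ := by ring

theorem IsSymm.bigVarConv {ι : Type*} (s : Finset ι) {c : ι → LDensity}
    (h : ∀ i ∈ s, (c i).IsSymm) : (bigVarConv s c).IsSymm := by
  classical
  induction s using Finset.induction_on with
  | empty => exact isSymm_deltaZero
  | insert i s hi ih =>
    rw [LDensity.bigVarConv, Finset.fold_insert hi]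
    exact (h i (by simp)).varConv (ih fun j hj => h j (by simp [hj]))

theorem IsSymm.bigCheckConv {ι : Type*} (s : Finset ι) {c : ι → LDensity}
    (h : ∀ i ∈ s, (c i).IsSymm) : (bigCheckConv s c).IsSymm := by
  classical
  induction s using Finset.induction_on with
  | empty => exact isSymm_deltaTop
  | insert i s hi ih =>
    rw [LDensity.bigCheckConv, Finset.fold_insert hi]
    exact (h i (by simp)).checkConv (ih fun j hj => h j (by simp [hj]))

end LDensity

/-! ### The entropy functional -/

/-- The surprisal `-log₂ ((1 + s) / 2)`. -/
def surprisal (s : ℝ) : ℝ := Real.logb 2 (2 / (1 + s))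

/-- The entropy in bits of a bit of mean `s`. -/
def bitEntropy (s : ℝ) : ℝ := Real.binEntropy ((1 + s) / 2) / Real.log 2

theorem measurable_surprisal : Measurable surprisal := by
  unfold surprisal Real.logb; fun_prop

theorem continuous_bitEntropy : Continuous bitEntropy := by
  unfold bitEntropy; fun_prop

theorem surprisal_nonneg {s : ℝ} (hs : s ∈ Set.Icc (-1 : ℝ) 1) : 0 ≤ surprisal s := by
  obtain ⟨a, b⟩ := hs
  rcases a.eq_or_lt with rfl | a
  · simp [surprisal]
  · refine Real.logb_nonneg (by norm_num) ?_
    rw [le_div_iff₀ (by linarith)]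
    linarith

theorem bitEntropy_nonneg {s : ℝ} (hs : s ∈ Set.Icc (-1 : ℝ) 1) : 0 ≤ bitEntropy s :=
  div_nonneg (Real.binEntropy_nonneg (by linarith [hs.1]) (by linarith [hs.2]))
    (Real.log_nonneg (by norm_num))

theorem bitEntropy_le_one (s : ℝ) : bitEntropy s ≤ 1 :=
  div_le_one_of_le₀ Real.binEntropy_le_log_two (Real.log_nonneg (by norm_num))

theorem bitEntropy_eq (s : ℝ) :
    bitEntropy s = (1 + s) / 2 * surprisal s + (1 + -s) / 2 * surprisal (-s) := by
  have h : (1 - (1 + s) / 2) = (1 + -s) / 2 := by ring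
  simp only [bitEntropy, surprisal, Real.binEntropy, Real.logb, h, inv_div]
  ring

theorem bitProb_mul_surprisal {s : ℝ} (hs : s ∈ Set.Icc (-1 : ℝ) 1) :
    bitProb s * ENNReal.ofReal (surprisal s) + bitProb (-s) * ENNReal.ofReal (surprisal (-s)) =
      ENNReal.ofReal (bitEntropy s) := by
  have h1 : 0 ≤ (1 + s) / 2 := by linarith [hs.1]
  have h2 : 0 ≤ (1 + -s) / 2 := by linarith [hs.2]
  have h3 := surprisal_nonneg hs
  have h4 := surprisal_nonneg (neg_mem_Icc hs)
  rw [bitEntropy_eq, ENNReal.ofReal_add (by positivity) (by positivity), ENNReal.ofReal_mul h1,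
    ENNReal.ofReal_mul h2, bitProb, bitProb]

theorem logb_one_add_expNeg (x : EReal) :
    Real.logb 2 (1 + expNeg x) = surprisal (tanhHalf x) := by
  by_cases hx : x = ⊥
  · simp [hx, surprisal]
  · rw [surprisal, one_add_tanhHalf hx]
    congr 1
    field_simp

theorem logb_one_add_expNeg_nonneg (x : EReal) : 0 ≤ Real.logb 2 (1 + expNeg x) := by
  rw [logb_one_add_expNeg]
  exact surprisal_nonneg (tanhHalf_mem x)

theorem measurable_logb_one_add_expNeg :
    Measurable fun x : EReal => Real.logb 2 (1 + expNeg x) := by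
  simp only [logb_one_add_expNeg]
  exact measurable_surprisal.comp measurable_tanhHalf

/-- The coefficients of the power series of `1 - bitEntropy`. -/
def entropyCoeff (k : ℕ) : ℝ := 1 / ((2 * k + 1) * (2 * k + 2) * Real.log 2)

theorem entropyCoeff_nonneg (k : ℕ) : 0 ≤ entropyCoeff k := by
  have := Real.log_pos (show (1 : ℝ) < 2 by norm_num)
  unfold entropyCoeff; positivity

theorem summable_entropyCoeff : Summable entropyCoeff := by
  have h2 := Real.log_pos (show (1 : ℝ) < 2 by norm_num)
  have h := ((summable_nat_add_iff 1).2
    (Real.summable_one_div_nat_pow (p := 2).2 (by norm_num))).mul_left (1 / Real.log 2)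
  refine Summable.of_nonneg_of_le entropyCoeff_nonneg (fun k => ?_) h
  rw [entropyCoeff, one_div_mul_one_div]
  apply one_div_le_one_div_of_le
  · positivity
  · have : (0 : ℝ) ≤ k := by positivity
    push_cast
    nlinarith [mul_nonneg h2.le this, mul_nonneg (mul_nonneg h2.le this) this]

theorem abs_entropyCoeff_mul_pow_le {s : ℝ} (hs : s ∈ Set.Icc (-1 : ℝ) 1) (k : ℕ) :
    ‖entropyCoeff k * s ^ (2 * k + 2)‖ ≤ entropyCoeff k := by
  rw [norm_mul, Real.norm_of_nonneg (entropyCoeff_nonneg k), norm_pow]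
  exact mul_le_of_le_one_right (entropyCoeff_nonneg k)
    (pow_le_one₀ (norm_nonneg _) (abs_le.2 hs))

/-- The expansion comes from (1+s) ln(1+s) + (1-s) ln(1-s) = s (ln(1+s) - ln(1-s)) + ln(1-s²); the
coefficients combine as 1/(2k+1) - 1/(2k+2). -/
theorem hasSum_bitEntropy_of_lt {s : ℝ} (hs : |s| < 1) :
    HasSum (fun k => entropyCoeff k * s ^ (2 * k + 2)) (1 - bitEntropy s) := by
  have hl := Real.log_pos (show (1 : ℝ) < 2 by norm_num)
  obtain ⟨h1, h2⟩ := abs_lt.1 hs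
  have e1 := (Real.hasSum_log_sub_log_of_abs_lt_one hs).mul_left s
  have hs2 : |s ^ 2| < 1 := by
    rw [abs_pow]; exact pow_lt_one₀ (abs_nonneg _) hs (by norm_num)
  have e2 := Real.hasSum_pow_div_log_of_abs_lt_one hs2
  have e3 := (e1.sub e2).mul_left (1 / (2 * Real.log 2))
  have hlog : Real.log (1 - s ^ 2) = Real.log (1 + s) + Real.log (1 - s) := by
    rw [← Real.log_mul (by linarith) (by linarith)]; ring_nf
  convert! e3 using 1
  · funext k
    simp only [entropyCoeff]
    have : (0 : ℝ) ≤ k := by positivity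
    field_simp
    ring
  · rw [bitEntropy_eq, hlog, surprisal, surprisal, Real.logb, Real.logb,
      Real.log_div (by norm_num) (by linarith), Real.log_div (by norm_num) (by linarith)]
    rw [← sub_eq_add_neg]
    field_simp
    ring

/-- The endpoints matter, since an LLR may be infinite with positive probability. They are reached
by continuity: the series converges uniformly on the closed interval and agrees with the entropy
inside. -/
theorem hasSum_bitEntropy {s : ℝ} (hs : s ∈ Set.Icc (-1 : ℝ) 1) :
    HasSum (fun k => entropyCoeff k * s ^ (2 * k + 2)) (1 - bitEntropy s) := by
  have hsum : ∀ t ∈ Set.Icc (-1 : ℝ) 1, Summable fun k => entropyCoeff k * t ^ (2 * k + 2) :=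
    fun t ht => Summable.of_norm_bounded summable_entropyCoeff (abs_entropyCoeff_mul_pow_le ht)
  rw [(hsum s hs).hasSum_iff]
  have hc : ContinuousOn (fun t : ℝ => ∑' k, entropyCoeff k * t ^ (2 * k + 2))
      (Set.Icc (-1) 1) :=
    continuousOn_tsum (fun k => by fun_prop) summable_entropyCoeff
      fun k t ht => abs_entropyCoeff_mul_pow_le ht k
  have hd : ContinuousOn (fun t : ℝ => 1 - bitEntropy t) (Set.Icc (-1) 1) :=
    (continuous_const.sub continuous_bitEntropy).continuousOn
  have heq : Set.EqOn (fun t : ℝ => ∑' k, entropyCoeff k * t ^ (2 * k + 2))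
      (fun t => 1 - bitEntropy t) (Set.Ioo (-1) 1) := fun t ht =>
    (hasSum_bitEntropy_of_lt (abs_lt.2 ht)).tsum_eq
  refine heq.of_subset_closure hc hd Set.Ioo_subset_Icc_self ?_ hs
  rw [closure_Ioo (by norm_num)]

namespace LDensity

theorem entropy_eq (c : LDensity) :
    c.entropy = ∫ x, Real.logb 2 (1 + expNeg x) ∂(c : Measure EReal) := rfl

theorem entropy_deltaZero : deltaZero.entropy = 1 := by
  rw [entropy_eq]
  change ∫ x, _ ∂(Measure.dirac 0) = _
  rw [integral_dirac' _ _ measurable_logb_one_add_expNeg.stronglyMeasurable, expNeg_zero]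
  norm_num

theorem entropy_deltaTop : deltaTop.entropy = 0 := by
  rw [entropy_eq]
  change ∫ x, _ ∂(Measure.dirac ⊤) = _
  rw [integral_dirac' _ _ measurable_logb_one_add_expNeg.stronglyMeasurable, expNeg_top]
  norm_num

/-- Averaging the surprisal over the two signs with their posterior weights produces the binary
entropy. -/
theorem IsSymm.lintegral_surprisal {c : LDensity} (hc : c.IsSymm) :
    ∫⁻ x, ENNReal.ofReal (Real.logb 2 (1 + expNeg x)) ∂(c : Measure EReal) =
      ∫⁻ x, ENNReal.ofReal (bitEntropy (tanhHalf x)) ∂(c : Measure EReal) := by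
  simp only [logb_one_add_expNeg]
  refine (hc (fun s => ENNReal.ofReal (surprisal s)) (measurable_surprisal.ennreal_ofReal)).trans
    (lintegral_congr fun x => bitProb_mul_surprisal (tanhHalf_mem x))

/-- The integrand is unbounded towards `⊥`, but its symmetrised form is a binary entropy, hence at
most `1`. -/
theorem IsSymm.integrable_surprisal {c : LDensity} (hc : c.IsSymm) :
    Integrable (fun x => Real.logb 2 (1 + expNeg x)) (c : Measure EReal) := by
  refine ⟨measurable_logb_one_add_expNeg.aestronglyMeasurable, ?_⟩
  rw [hasFiniteIntegral_iff_ofReal (Filter.Eventually.of_forall logb_one_add_expNeg_nonneg),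
    hc.lintegral_surprisal]
  refine lt_of_le_of_lt (lintegral_mono (g := fun _ => 1) fun x => ?_) (by simp)
  exact ENNReal.ofReal_le_one.2 (bitEntropy_le_one _)

theorem IsSymm.entropy_eq_integral_bitEntropy {c : LDensity} (hc : c.IsSymm) :
    c.entropy = ∫ x, bitEntropy (tanhHalf x) ∂(c : Measure EReal) := by
  rw [entropy_eq, integral_eq_lintegral_of_nonneg_ae
    (Filter.Eventually.of_forall logb_one_add_expNeg_nonneg)
    measurable_logb_one_add_expNeg.aestronglyMeasurable, hc.lintegral_surprisal,
    integral_eq_lintegral_of_nonneg_ae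
      (Filter.Eventually.of_forall fun x => bitEntropy_nonneg (tanhHalf_mem x))
      (continuous_bitEntropy.measurable.comp measurable_tanhHalf).aestronglyMeasurable]

/-- The even moments of `tanh (L / 2)`. -/
def evenMoment (c : LDensity) (k : ℕ) : ℝ := ∫ x, tanhHalf x ^ (2 * k + 2) ∂(c : Measure EReal)

theorem integrable_tanhHalf_pow (c : LDensity) (n : ℕ) :
    Integrable (fun x => tanhHalf x ^ n) (c : Measure EReal) := by
  refine Integrable.of_bound (measurable_tanhHalf.pow_const n).aestronglyMeasurable 1
    (Filter.Eventually.of_forall fun x => ?_)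
  rw [norm_pow]
  exact pow_le_one₀ (norm_nonneg _) (abs_le.2 (tanhHalf_mem x))

theorem IsSymm.hasSum_entropy {c : LDensity} (hc : c.IsSymm) :
    HasSum (fun k => entropyCoeff k * c.evenMoment k) (1 - c.entropy) := by
  have h := hasSum_integral_of_summable_integral_norm (μ := (c : Measure EReal))
    (F := fun k x => entropyCoeff k * tanhHalf x ^ (2 * k + 2))
    (fun k => (c.integrable_tanhHalf_pow _).const_mul _) ?_
  · simp only [integral_const_mul] at h
    convert! h using 1
    rw [hc.entropy_eq_integral_bitEntropy]
    have hi : Integrable (fun x => bitEntropy (tanhHalf x)) (c : Measure EReal) := by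
      refine Integrable.of_bound
        (continuous_bitEntropy.measurable.comp measurable_tanhHalf).aestronglyMeasurable 1
        (Filter.Eventually.of_forall fun x => ?_)
      rw [Real.norm_of_nonneg (bitEntropy_nonneg (tanhHalf_mem x))]
      exact bitEntropy_le_one _
    have : ∀ x, ∑' k, entropyCoeff k * tanhHalf x ^ (2 * k + 2) = 1 - bitEntropy (tanhHalf x) :=
      fun x => (hasSum_bitEntropy (tanhHalf_mem x)).tsum_eq
    simp only [this]
    rw [integral_sub (integrable_const _) hi]
    simp
  · refine Summable.of_nonneg_of_le (fun k => integral_nonneg fun x => norm_nonneg _)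
      (fun k => ?_) summable_entropyCoeff
    have := integral_mono_of_nonneg (μ := (c : Measure EReal))
      (Filter.Eventually.of_forall fun x => norm_nonneg (entropyCoeff k * tanhHalf x ^ (2 * k + 2)))
      (integrable_const (entropyCoeff k))
      (Filter.Eventually.of_forall fun x => abs_entropyCoeff_mul_pow_le (tanhHalf_mem x) k)
    simpa using this

theorem evenMoment_checkConv (a b : LDensity) (k : ℕ) :
    (checkConv a b).evenMoment k = a.evenMoment k * b.evenMoment k := by
  change ∫ z, _ ∂(Measure.map _ _) = _
  rw [integral_map measurable_boxPlus.aemeasurable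
    (measurable_tanhHalf.pow_const _).aestronglyMeasurable]
  simp only [tanhHalf_boxPlus, mul_pow]
  exact integral_prod_mul (μ := (a : Measure EReal)) (ν := (b : Measure EReal))
    (fun x => tanhHalf x ^ (2 * k + 2)) (fun x => tanhHalf x ^ (2 * k + 2))

/-- The duality rule for entropy. -/
theorem IsSymm.entropy_varConv_add_checkConv {a b : LDensity} (ha : a.IsSymm) (hb : b.IsSymm) :
    (LDensity.varConv a b).entropy + (LDensity.checkConv a b).entropy = a.entropy + b.entropy := by
  have hm := measurable_logb_one_add_expNeg
  have hva := (ha.varConv hb).integrable_surprisal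
  have hch := (ha.checkConv hb).integrable_surprisal
  have e1 : (LDensity.varConv a b).entropy = ∫ q : EReal × EReal,
      Real.logb 2 (1 + expNeg (q.1 + q.2)) ∂((a : Measure EReal).prod (b : Measure EReal)) := by
    rw [entropy_eq]
    exact integral_map measurable_add.aemeasurable hm.aestronglyMeasurable
  have e2 : (LDensity.checkConv a b).entropy = ∫ q : EReal × EReal,
      Real.logb 2 (1 + expNeg (boxPlus q.1 q.2))
        ∂((a : Measure EReal).prod (b : Measure EReal)) := by
    rw [entropy_eq]
    exact integral_map measurable_boxPlus.aemeasurable hm.aestronglyMeasurable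
  have i1 : Integrable (fun q : EReal × EReal => Real.logb 2 (1 + expNeg (q.1 + q.2)))
      ((a : Measure EReal).prod (b : Measure EReal)) :=
    (integrable_map_measure hm.aestronglyMeasurable measurable_add.aemeasurable).1 hva
  have i2 : Integrable (fun q : EReal × EReal => Real.logb 2 (1 + expNeg (boxPlus q.1 q.2)))
      ((a : Measure EReal).prod (b : Measure EReal)) :=
    (integrable_map_measure hm.aestronglyMeasurable measurable_boxPlus.aemeasurable).1 hch
  have i3 : Integrable (fun q : EReal × EReal => Real.logb 2 (1 + expNeg q.1))
      ((a : Measure EReal).prod (b : Measure EReal)) := ha.integrable_surprisal.comp_fst _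
  have i4 : Integrable (fun q : EReal × EReal => Real.logb 2 (1 + expNeg q.2))
      ((a : Measure EReal).prod (b : Measure EReal)) := hb.integrable_surprisal.comp_snd _
  have e3 : a.entropy = ∫ q : EReal × EReal, Real.logb 2 (1 + expNeg q.1)
      ∂((a : Measure EReal).prod (b : Measure EReal)) := by
    rw [integral_fun_fst (μ := (a : Measure EReal)) (ν := (b : Measure EReal))
      (fun x => Real.logb 2 (1 + expNeg x))]
    simp [entropy_eq]
  have e4 : b.entropy = ∫ q : EReal × EReal, Real.logb 2 (1 + expNeg q.2)
      ∂((a : Measure EReal).prod (b : Measure EReal)) := by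
    rw [integral_fun_snd (μ := (a : Measure EReal)) (ν := (b : Measure EReal))
      (fun x => Real.logb 2 (1 + expNeg x))]
    simp [entropy_eq]
  rw [e1, e2, e3, e4, ← integral_add i1 i2, ← integral_add i3 i4]
  -- The pointwise identity excludes `⊥`, a value that symmetric densities do not charge.
  refine integral_congr_ae ?_
  have n1 : ∀ᵐ q ∂((a : Measure EReal).prod (b : Measure EReal)), q.1 ≠ ⊥ :=
    Measure.quasiMeasurePreserving_fst.ae ha.ae_ne_bot
  have n2 : ∀ᵐ q ∂((a : Measure EReal).prod (b : Measure EReal)), q.2 ≠ ⊥ :=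
    Measure.quasiMeasurePreserving_snd.ae hb.ae_ne_bot
  have hp : ∀ x, 1 + expNeg x ≠ 0 := fun x => by have := expNeg_nonneg x; positivity
  filter_upwards [n1, n2] with q h1 h2
  rw [← Real.logb_mul (hp _) (hp _), ← Real.logb_mul (hp _) (hp _), one_add_expNeg_mul h1 h2]

end LDensity

/-! ### The degradation order -/

/-- Test functions for the degradation order: even, nonnegative, bounded and convex on
`[-1, 1]`. -/
structure IsTestFunction (φ : ℝ → ℝ) : Prop where
  measurable : Measurable φ
  even : ∀ s, φ (-s) = φ s
  convexOn : ConvexOn ℝ (Set.Icc (-1) 1) φ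
  nonneg : ∀ s ∈ Set.Icc (-1 : ℝ) 1, 0 ≤ φ s

theorem isTestFunction_pow (k : ℕ) : IsTestFunction fun s => s ^ (2 * k + 2) where
  measurable := by fun_prop
  even s := Even.neg_pow ⟨k + 1, by ring⟩ s
  convexOn := (Even.convexOn_pow ⟨k + 1, by ring⟩).subset (Set.subset_univ _) (convex_Icc _ _)
  nonneg s _ := Even.pow_nonneg ⟨k + 1, by ring⟩ s

theorem IsTestFunction.comp_mul {φ : ℝ → ℝ} (hφ : IsTestFunction φ) {s : ℝ}
    (hs : s ∈ Set.Icc (-1 : ℝ) 1) : IsTestFunction fun t => φ (s * t) where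
  measurable := hφ.measurable.comp (by fun_prop)
  even t := by rw [mul_neg, hφ.even]
  convexOn := by
    refine ⟨convex_Icc _ _, fun t ht u hu a b ha hb hab => ?_⟩
    have := hφ.convexOn.2 (mul_mem_Icc hs ht) (mul_mem_Icc hs hu) ha hb hab
    simp only [smul_eq_mul] at this ⊢
    rwa [show s * (a * t + b * u) = a * (s * t) + b * (s * u) by ring]
  nonneg t ht := hφ.nonneg _ (mul_mem_Icc hs ht)

/-- The perspective of a convex function along `tanhAdd`. -/
theorem convexOn_perspective {φ : ℝ → ℝ} (hφ : ConvexOn ℝ (Set.Icc (-1) 1) φ) {s : ℝ}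
    (hs : s ∈ Set.Icc (-1 : ℝ) 1) :
    ConvexOn ℝ (Set.Icc (-1) 1) fun t => (1 + s * t) / 2 * φ (tanhAdd s t) := by
  refine ⟨convex_Icc _ _, fun t ht u hu a b ha hb hab => ?_⟩
  simp only [smul_eq_mul]
  have hv : a * t + b * u ∈ Set.Icc (-1 : ℝ) 1 := by
    simpa using (convex_Icc (-1 : ℝ) 1) ht hu ha hb hab
  -- The numerator of `tanhAdd s v` is affine in `v`. This identity, valid also where the
  -- denominator vanishes, is what makes the perspective convex.
  have key : ∀ v ∈ Set.Icc (-1 : ℝ) 1, (1 + s * v) * tanhAdd s v = s + v := fun v hv => by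
    have := one_add_tanhAdd_mul hs hv
    linear_combination this
  have hD : 1 + s * (a * t + b * u) = a * (1 + s * t) + b * (1 + s * u) := by
    linear_combination -hab
  have kt := key t ht
  have ku := key u hu
  have kv := key _ hv
  have dt : 0 ≤ 1 + s * t := by linarith [(mul_mem_Icc hs ht).1]
  have du : 0 ≤ 1 + s * u := by linarith [(mul_mem_Icc hs hu).1]
  have dv : 0 ≤ 1 + s * (a * t + b * u) := by linarith [(mul_mem_Icc hs hv).1]
  set D := 1 + s * (a * t + b * u)
  -- If the total weight `D` vanishes, so do both of its parts, and the default values of `tanhAdd`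
  -- do not matter.
  rcases dv.eq_or_lt with h0 | h0
  · have h1 := mul_nonneg ha dt
    have h2 := mul_nonneg hb du
    have h3 : a * (1 + s * t) = 0 := by linarith
    have h4 : b * (1 + s * u) = 0 := by linarith
    rw [← h0]
    apply le_of_eq
    linear_combination (-φ (tanhAdd s t) / 2) * h3 + (-φ (tanhAdd s u) / 2) * h4
  -- Convexity is applied with the reweighted coefficients `a (1 + s t) / D` and `b (1 + s u) / D`,
  -- whose barycentre is `tanhAdd s (a t + b u)`.
  · have hc := hφ.2 (tanhAdd_mem hs ht) (tanhAdd_mem hs hu)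
      (show 0 ≤ a * (1 + s * t) / D by positivity) (show 0 ≤ b * (1 + s * u) / D by positivity)
      (by rw [← add_div, ← hD, div_self h0.ne'])
    simp only [smul_eq_mul] at hc
    have e : a * (1 + s * t) / D * tanhAdd s t + b * (1 + s * u) / D * tanhAdd s u
        = tanhAdd s (a * t + b * u) := by
      field_simp
      rw [kv]
      linear_combination a * kt + b * ku + (s : ℝ) * hab
    rw [e] at hc
    have := mul_le_mul_of_nonneg_left hc h0.le
    have e2 : D * (a * (1 + s * t) / D * φ (tanhAdd s t) + b * (1 + s * u) / D * φ (tanhAdd s u))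
        = a * (1 + s * t) * φ (tanhAdd s t) + b * (1 + s * u) * φ (tanhAdd s u) := by
      field_simp
    rw [e2] at this
    linarith

/-- For a first LLR of mean `s`, this is what the second one sees of `φ` after averaging over the
relative sign. As `φ` is even, the second summand is the perspective at `-s`, so it is convex too.
-/
theorem IsTestFunction.tanhAdd {φ : ℝ → ℝ} (hφ : IsTestFunction φ) {s : ℝ}
    (hs : s ∈ Set.Icc (-1 : ℝ) 1) :
    IsTestFunction fun t => (1 + s * t) / 2 * φ (tanhAdd s t) +
      (1 + s * -t) / 2 * φ (tanhAdd s (-t)) where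
  measurable := by
    have h : Measurable fun t : ℝ => φ (_root_.tanhAdd s t) :=
      hφ.measurable.comp (measurable_tanhAdd.comp (measurable_const.prodMk measurable_id))
    exact (((measurable_const.add (measurable_id.const_mul s)).div_const 2).mul h).add
      (((measurable_const.add (measurable_neg.const_mul s)).div_const 2).mul
        (h.comp measurable_neg))
  even t := by rw [neg_neg, add_comm]
  convexOn := by
    refine (convexOn_perspective hφ.convexOn hs).add ?_
    have h := convexOn_perspective hφ.convexOn (neg_mem_Icc hs)
    refine h.congr fun t _ => ?_
    simp only
    rw [tanhAdd_neg_left, hφ.even]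
    ring_nf
  nonneg t ht := by
    have h1 := (mul_mem_Icc hs ht).1
    have h2 := (mul_mem_Icc hs (neg_mem_Icc ht)).1
    exact add_nonneg (mul_nonneg (by linarith) (hφ.nonneg _ (tanhAdd_mem hs ht)))
      (mul_nonneg (by linarith) (hφ.nonneg _ (tanhAdd_mem hs (neg_mem_Icc ht))))

namespace LDensity

/-- `a` is degraded with respect to `b`. -/
def Degraded (a b : LDensity) : Prop :=
  ∀ φ, IsTestFunction φ →
    ∫⁻ x, ENNReal.ofReal (φ (tanhHalf x)) ∂(a : Measure EReal) ≤
      ∫⁻ x, ENNReal.ofReal (φ (tanhHalf x)) ∂(b : Measure EReal)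

theorem Degraded.refl (a : LDensity) : a.Degraded a := fun _ _ => le_rfl

theorem Degraded.trans {a b c : LDensity} (h : a.Degraded b) (h' : b.Degraded c) :
    a.Degraded c := fun φ hφ => (h φ hφ).trans (h' φ hφ)

/-- An even convex function has its minimum at `0`. Hence the initial messages are the least ones.
-/
theorem degraded_deltaZero (a : LDensity) : deltaZero.Degraded a := by
  intro φ hφ
  have hm : Measurable fun x => ENNReal.ofReal (φ (tanhHalf x)) :=
    (hφ.measurable.comp measurable_tanhHalf).ennreal_ofReal
  change ∫⁻ x, _ ∂(Measure.dirac 0) ≤ _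
  rw [lintegral_dirac' _ hm, tanhHalf_zero]
  calc ENNReal.ofReal (φ 0) = ∫⁻ _, ENNReal.ofReal (φ 0) ∂(a : Measure EReal) := by simp
    _ ≤ _ := lintegral_mono fun x => ENNReal.ofReal_le_ofReal ?_
  have hx := tanhHalf_mem x
  have := hφ.convexOn.2 hx (neg_mem_Icc hx) 
    (show (0 : ℝ) ≤ 1 / 2 by norm_num) (show (0 : ℝ) ≤ 1 / 2 by norm_num) (by norm_num)
  simp only [smul_eq_mul, hφ.even] at this
  rw [show 1 / 2 * tanhHalf x + 1 / 2 * -tanhHalf x = 0 by ring] at this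
  linarith

theorem Degraded.checkConv_right {b b' : LDensity} (h : b.Degraded b') (a : LDensity) :
    (checkConv a b).Degraded (checkConv a b') := by
  intro φ hφ
  have hm : Measurable fun x => ENNReal.ofReal (φ (tanhHalf x)) :=
    (hφ.measurable.comp measurable_tanhHalf).ennreal_ofReal
  rw [lintegral_checkConv _ _ hm, lintegral_checkConv _ _ hm]
  simp only [tanhHalf_boxPlus]
  exact lintegral_mono fun x => h _ (hφ.comp_mul (tanhHalf_mem x))

/-- An even function sees only the relative sign of the two LLRs, so the four sign patterns collapse
to two. For fixed `x` the result is a test function of the second mean, which gives monotonicity of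
`⊛`. -/
theorem IsSymm.lintegral_varConv_even {a b : LDensity} (ha : a.IsSymm) (hb : b.IsSymm)
    {φ : ℝ → ℝ} (hφ : IsTestFunction φ) :
    ∫⁻ z, ENNReal.ofReal (φ (tanhHalf z)) ∂(LDensity.varConv a b : Measure EReal) =
      ∫⁻ x, ∫⁻ y, ENNReal.ofReal
        ((1 + tanhHalf x * tanhHalf y) / 2 * φ (tanhAdd (tanhHalf x) (tanhHalf y)) +
          (1 + tanhHalf x * -tanhHalf y) / 2 * φ (tanhAdd (tanhHalf x) (-tanhHalf y)))
        ∂(b : Measure EReal) ∂(a : Measure EReal) := by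
  rw [ha.lintegral_varConv hb (g := fun s => ENNReal.ofReal (φ s)) hφ.measurable.ennreal_ofReal]
  refine lintegral_congr fun x => lintegral_congr fun y => ?_
  have hs := tanhHalf_mem x
  have ht := tanhHalf_mem y
  rw [signAverage_tanhAdd fun s => ENNReal.ofReal (φ s)]
  set s := tanhHalf x
  set t := tanhHalf y
  have h1 := (mul_mem_Icc hs ht).1
  have h2 := (mul_mem_Icc hs (neg_mem_Icc ht)).1
  have n1 := hφ.nonneg _ (tanhAdd_mem hs ht)
  have n2 := hφ.nonneg _ (tanhAdd_mem hs (neg_mem_Icc ht))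
  have e1 := bitProb_mul_add hs ht
  have e2 := bitProb_mul_add hs (neg_mem_Icc ht)
  rw [neg_neg] at e2
  rw [ENNReal.ofReal_add (mul_nonneg (by linarith) n1) (mul_nonneg (by linarith) n2),
    ENNReal.ofReal_mul (by linarith), ENNReal.ofReal_mul (by linarith), hφ.even, hφ.even,
    ← add_mul, ← add_mul, e1, e2, bitProb, bitProb]

theorem Degraded.varConv_right {b b' : LDensity} (h : b.Degraded b') (hb : b.IsSymm)
    (hb' : b'.IsSymm) {a : LDensity} (ha : a.IsSymm) :
    (varConv a b).Degraded (varConv a b') := by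
  intro φ hφ
  rw [ha.lintegral_varConv_even hb hφ, ha.lintegral_varConv_even hb' hφ]
  exact lintegral_mono fun x => h _ (hφ.tanhAdd (tanhHalf_mem x))

theorem varConv_comm (a b : LDensity) : varConv a b = varConv b a :=
  Std.Commutative.comm a b

theorem checkConv_comm (a b : LDensity) : checkConv a b = checkConv b a :=
  Std.Commutative.comm a b

theorem Degraded.varConv {a a' b b' : LDensity} (h : a.Degraded a') (h' : b.Degraded b')
    (ha : a.IsSymm) (ha' : a'.IsSymm) (hb : b.IsSymm) (hb' : b'.IsSymm) :
    (varConv a b).Degraded (varConv a' b') := by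
  refine (h'.varConv_right hb hb' ha).trans ?_
  rw [varConv_comm a, varConv_comm a']
  exact h.varConv_right ha ha' hb'

theorem Degraded.checkConv {a a' b b' : LDensity} (h : a.Degraded a') (h' : b.Degraded b') :
    (checkConv a b).Degraded (checkConv a' b') := by
  refine (h'.checkConv_right a).trans ?_
  rw [checkConv_comm a, checkConv_comm a']
  exact h.checkConv_right b'

theorem Degraded.bigVarConv {ι : Type*} (s : Finset ι) {c c' : ι → LDensity}
    (h : ∀ i ∈ s, (c i).Degraded (c' i)) (hc : ∀ i ∈ s, (c i).IsSymm)
    (hc' : ∀ i ∈ s, (c' i).IsSymm) : (bigVarConv s c).Degraded (bigVarConv s c') := by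
  classical
  induction s using Finset.induction_on with
  | empty => exact Degraded.refl _
  | insert i s hi ih =>
    simp only [LDensity.bigVarConv, Finset.fold_insert hi]
    have hs : ∀ j ∈ s, (c j).IsSymm := fun j hj => hc j (by simp [hj])
    have hs' : ∀ j ∈ s, (c' j).IsSymm := fun j hj => hc' j (by simp [hj])
    exact (h i (by simp)).varConv (ih (fun j hj => h j (by simp [hj])) hs hs') (hc i (by simp))
      (hc' i (by simp)) (IsSymm.bigVarConv s hs) (IsSymm.bigVarConv s hs')

theorem Degraded.bigCheckConv {ι : Type*} (s : Finset ι) {c c' : ι → LDensity}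
    (h : ∀ i ∈ s, (c i).Degraded (c' i)) : (bigCheckConv s c).Degraded (bigCheckConv s c') := by
  classical
  induction s using Finset.induction_on with
  | empty => exact Degraded.refl _
  | insert i s hi ih =>
    simp only [LDensity.bigCheckConv, Finset.fold_insert hi]
    exact (h i (by simp)).checkConv (ih (fun j hj => h j (by simp [hj])))

theorem Degraded.evenMoment_le {a b : LDensity} (h : a.Degraded b) (k : ℕ) :
    a.evenMoment k ≤ b.evenMoment k := by
  have hn : ∀ x, 0 ≤ tanhHalf x ^ (2 * k + 2) := fun x =>
    (isTestFunction_pow k).nonneg _ (tanhHalf_mem x)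
  have hle := h _ (isTestFunction_pow k)
  rw [← ofReal_integral_eq_lintegral_ofReal (a.integrable_tanhHalf_pow _)
      (Filter.Eventually.of_forall hn),
    ← ofReal_integral_eq_lintegral_ofReal (b.integrable_tanhHalf_pow _)
      (Filter.Eventually.of_forall hn)] at hle
  exact (ENNReal.ofReal_le_ofReal_iff (integral_nonneg hn)).1 hle

/-- Degrading both arguments has a mixed difference of definite sign. -/
theorem Degraded.entropy_varConv_add_le {a a' b b' : LDensity} (h : a.Degraded a')
    (h' : b.Degraded b') (ha : a.IsSymm) (ha' : a'.IsSymm) (hb : b.IsSymm) (hb' : b'.IsSymm) :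
    (LDensity.varConv a' b).entropy + (LDensity.varConv a b').entropy ≤
      (LDensity.varConv a b).entropy + (LDensity.varConv a' b').entropy := by
  have d1 := ha.entropy_varConv_add_checkConv hb
  have d2 := ha.entropy_varConv_add_checkConv hb'
  have d3 := ha'.entropy_varConv_add_checkConv hb
  have d4 := ha'.entropy_varConv_add_checkConv hb'
  -- By `d1` to `d4` the mixed difference for `⊛` is the negative of the one for `⊞`. In the moment
  -- series the latter has, up to sign, the terms coefficient times (a'_k - a_k)(b'_k - b_k).
  have s := (((ha.checkConv hb).hasSum_entropy.add (ha'.checkConv hb').hasSum_entropy).sub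
    (ha.checkConv hb').hasSum_entropy).sub (ha'.checkConv hb).hasSum_entropy
  have := s.nonneg fun k => by
    simp only [evenMoment_checkConv]
    have h1 := mul_nonneg (sub_nonneg.2 (h.evenMoment_le k)) (sub_nonneg.2 (h'.evenMoment_le k))
    have h2 := mul_nonneg (entropyCoeff_nonneg k) h1
    linarith
  linarith

end LDensity

variable {V C : Type*}

/-! ### Density evolution and the potential functional -/

namespace LDensity

theorem varConv_deltaZero (a : LDensity) : varConv a deltaZero = a :=
  Subtype.ext (Measure.conv_dirac_zero _)

theorem bigVarConv_congr {ι : Type*} {s : Finset ι} {c c' : ι → LDensity}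
    (h : ∀ i ∈ s, c i = c' i) : bigVarConv s c = bigVarConv s c' :=
  Finset.fold_congr h

theorem bigCheckConv_congr {ι : Type*} {s : Finset ι} {c c' : ι → LDensity}
    (h : ∀ i ∈ s, c i = c' i) : bigCheckConv s c = bigCheckConv s c' :=
  Finset.fold_congr h

theorem varConv_assoc (a b c : LDensity) :
    varConv (varConv a b) c = varConv a (varConv b c) := Std.Associative.assoc a b c

theorem bigVarConv_eq_erase {ι : Type*} [DecidableEq ι] {s : Finset ι} (c : ι → LDensity) {i : ι}
    (hi : i ∈ s) : bigVarConv s c = varConv (bigVarConv (s.erase i) c) (c i) := by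
  conv_lhs => rw [← Finset.insert_erase hi]
  rw [varConv_comm]
  exact Finset.fold_insert (Finset.notMem_erase i s)

theorem bigCheckConv_eq_erase {ι : Type*} [DecidableEq ι] {s : Finset ι} (c : ι → LDensity)
    {i : ι} (hi : i ∈ s) : bigCheckConv s c = checkConv (c i) (bigCheckConv (s.erase i) c) := by
  conv_lhs => rw [← Finset.insert_erase hi]
  exact Finset.fold_insert (Finset.notMem_erase i s)

theorem bigVarConv_deltaZero {ι : Type*} (s : Finset ι) :
    bigVarConv s (fun _ => deltaZero) = deltaZero := by
  classical
  induction s using Finset.induction_on with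
  | empty => rfl
  | insert i s hi ih =>
    rw [bigVarConv, Finset.fold_insert hi, varConv_comm, varConv_deltaZero]
    exact ih

theorem checkConv_deltaZero (a : LDensity) : checkConv deltaZero a = deltaZero := by
  apply Subtype.ext
  apply Measure.ext_of_lintegral
  intro f hf
  have hm : Measurable fun x => ∫⁻ y, f (boxPlus x y) ∂(a : Measure EReal) :=
    Measurable.lintegral_prod_right' (f := fun p : EReal × EReal => f (boxPlus p.1 p.2))
      (hf.comp measurable_boxPlus)
  have h0 : ∀ y, boxPlus 0 y = 0 := fun y => by simp [boxPlus, twoArtanh]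
  refine (lintegral_checkConv deltaZero a hf).trans ((lintegral_dirac' (0 : EReal) hm).trans ?_)
  simp only [h0, lintegral_const, measure_univ, mul_one]
  exact (lintegral_dirac' (0 : EReal) hf).symm

theorem bigCheckConv_deltaZero {ι : Type*} {s : Finset ι} (hs : s.Nonempty) :
    bigCheckConv s (fun _ => deltaZero) = deltaZero := by
  classical
  obtain ⟨i, hi⟩ := hs
  rw [bigCheckConv_eq_erase _ hi, checkConv_deltaZero]

end LDensity

open LDensity

/-- All messages are symmetric. -/
structure Messages.IsSymm (m : Messages V C) : Prop where
  varToCheck : ∀ i a, (m.varToCheck i a).IsSymm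
  checkToVar : ∀ a i, (m.checkToVar a i).IsSymm

theorem isSymm_initMessages : (initMessages V C).IsSymm :=
  ⟨fun _ _ => isSymm_deltaZero, fun _ _ => isSymm_deltaZero⟩

section

variable [Fintype V] [Fintype C] [DecidableEq V] [DecidableEq C]

@[simp] theorem mem_varNbrs {A : Matrix C V (ZMod 2)} {i : V} {a : C} :
    a ∈ varNbrs A i ↔ A a i ≠ 0 := by simp [varNbrs]

@[simp] theorem mem_checkNbrs {A : Matrix C V (ZMod 2)} {i : V} {a : C} :
    i ∈ checkNbrs A a ↔ A a i ≠ 0 := by simp [checkNbrs]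

/-- The value that density evolution assigns to the message from `i` to `a`. -/
def varUpdate (A : Matrix C V (ZMod 2)) (c : V → LDensity) (m : Messages V C) (i : V) (a : C) :
    LDensity :=
  varConv (c i) (bigVarConv ((varNbrs A i).erase a) fun h => m.checkToVar h i)

/-- The value that density evolution assigns to the message from `a` to `i`. -/
def checkUpdate (A : Matrix C V (ZMod 2)) (m : Messages V C) (a : C) (i : V) : LDensity :=
  bigCheckConv ((checkNbrs A a).erase i) fun j => m.varToCheck j a

/-- Every message is degraded with respect to its update. -/
structure Messages.Improving (A : Matrix C V (ZMod 2)) (c : V → LDensity) (m : Messages V C) :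
    Prop where
  varToCheck : ∀ i a, (m.varToCheck i a).Degraded (varUpdate A c m i a)
  checkToVar : ∀ a i, (m.checkToVar a i).Degraded (checkUpdate A m a i)

variable {A : Matrix C V (ZMod 2)} {c : V → LDensity} {m : Messages V C}

theorem Messages.IsSymm.varUpdate (hm : m.IsSymm) (hc : ∀ i, (c i).IsSymm) (i : V) (a : C) :
    (varUpdate A c m i a).IsSymm :=
  (hc i).varConv (IsSymm.bigVarConv _ fun _ _ => hm.checkToVar _ _)

theorem Messages.IsSymm.checkUpdate (hm : m.IsSymm) (a : C) (i : V) :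
    (checkUpdate A m a i).IsSymm :=
  IsSymm.bigCheckConv _ fun _ _ => hm.varToCheck _ _

theorem passMessage_varToCheck_varToCheck {i : V} {a : C} (h : A a i ≠ 0) (j : V) (b : C) :
    (passMessage A c m (.varToCheck i a h)).varToCheck j b =
      if j = i ∧ b = a then varUpdate A c m i a else m.varToCheck j b := by
  by_cases hj : j = i
  · subst hj
    by_cases hb : b = a
    · subst hb; simp [passMessage, varUpdate]
    · simp [passMessage, hb]
  · simp [passMessage, hj]

theorem passMessage_checkToVar_checkToVar {i : V} {a : C} (h : A a i ≠ 0) (b : C) (j : V) :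
    (passMessage A c m (.checkToVar a i h)).checkToVar b j =
      if b = a ∧ j = i then checkUpdate A m a i else m.checkToVar b j := by
  by_cases hb : b = a
  · subst hb
    by_cases hj : j = i
    · subst hj; simp [passMessage, checkUpdate]
    · simp [passMessage, hj]
  · simp [passMessage, hb]

theorem Messages.IsSymm.passMessage (hm : m.IsSymm) (hc : ∀ i, (c i).IsSymm)
    (e : DirectedEdge A) : (passMessage A c m e).IsSymm := by
  cases e with
  | varToCheck i a h =>
    refine ⟨fun j b => ?_, hm.checkToVar⟩
    rw [passMessage_varToCheck_varToCheck]
    split_ifs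
    · exact hm.varUpdate hc i a
    · exact hm.varToCheck j b
  | checkToVar a i h =>
    refine ⟨hm.varToCheck, fun b j => ?_⟩
    rw [passMessage_checkToVar_checkToVar]
    split_ifs
    · exact hm.checkUpdate a i
    · exact hm.checkToVar b j

/-- The recomputed message moves up in the degradation order, so by monotonicity every update that
reads it moves up as well. Its own update reads only messages of the opposite direction, which are
unchanged, so there equality holds. -/
theorem Messages.Improving.passMessage (hi : m.Improving A c) (hm : m.IsSymm)
    (hc : ∀ i, (c i).IsSymm) (e : DirectedEdge A) : (passMessage A c m e).Improving A c := by
  have hm' := hm.passMessage hc e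
  cases e with
  | varToCheck i a h =>
    have hle : ∀ j b, (m.varToCheck j b).Degraded
        ((_root_.passMessage A c m (.varToCheck i a h)).varToCheck j b) := fun j b => by
      rw [passMessage_varToCheck_varToCheck]
      split_ifs with hjb
      · rw [hjb.1, hjb.2]; exact hi.varToCheck i a
      · exact Degraded.refl _
    refine ⟨fun j b => ?_, fun b j => ?_⟩
    · rw [passMessage_varToCheck_varToCheck]
      split_ifs with hjb
      · rw [hjb.1, hjb.2]; exact Degraded.refl _
      · exact hi.varToCheck j b
    · exact (hi.checkToVar b j).trans (Degraded.bigCheckConv _ fun k _ => hle k b)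
  | checkToVar a i h =>
    have hle : ∀ b j, (m.checkToVar b j).Degraded
        ((_root_.passMessage A c m (.checkToVar a i h)).checkToVar b j) := fun b j => by
      rw [passMessage_checkToVar_checkToVar]
      split_ifs with hjb
      · rw [hjb.1, hjb.2]; exact hi.checkToVar a i
      · exact Degraded.refl _
    refine ⟨fun j b => ?_, fun b j => ?_⟩
    · refine (hi.varToCheck j b).trans ((Degraded.refl _).varConv
        (Degraded.bigVarConv _ (fun k _ => hle k j) (fun k _ => hm.checkToVar k j)
          (fun k _ => hm'.checkToVar k j)) (hc j) (hc j)
          (IsSymm.bigVarConv _ fun k _ => hm.checkToVar k j)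
          (IsSymm.bigVarConv _ fun k _ => hm'.checkToVar k j))
    · rw [passMessage_checkToVar_checkToVar]
      split_ifs with hjb
      · rw [hjb.1, hjb.2]; exact Degraded.refl _
      · exact hi.checkToVar b j

theorem improving_initMessages : (initMessages V C).Improving A c :=
  ⟨fun _ _ => degraded_deltaZero _, fun _ _ => degraded_deltaZero _⟩

/-! ### Monotonicity of the Bethe entropy and its initial value -/

/-- The entropy combination in the potential functional. -/
def betheEntropy (A : Matrix C V (ZMod 2)) (c : V → LDensity) (m : Messages V C) : ℝ :=
  ∑ i, (varConv (c i) (bigVarConv (varNbrs A i) fun a => m.checkToVar a i)).entropy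
    + ∑ a, ∑ i ∈ checkNbrs A a, (m.varToCheck i a).entropy
    - ∑ a, (bigCheckConv (checkNbrs A a) fun i => m.varToCheck i a).entropy
    - ∑ i, ∑ a ∈ varNbrs A i, (varConv (m.varToCheck i a) (m.checkToVar a i)).entropy

theorem gapPotential_eq :
    gapPotential A c m = -(1 / (Fintype.card V : ℝ)) * betheEntropy A c m := rfl

theorem sum_eq_sum_add_sub {ι : Type*} {s : Finset ι} {f g : ι → ℝ} {i : ι} (hi : i ∈ s)
    (h : ∀ j ∈ s, j ≠ i → g j = f j) : ∑ j ∈ s, g j = ∑ j ∈ s, f j + (g i - f i) := by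
  classical
  rw [← Finset.add_sum_erase s g hi, ← Finset.add_sum_erase s f hi,
    Finset.sum_congr rfl fun j hj => h j (Finset.mem_of_mem_erase hj) (Finset.ne_of_mem_erase hj)]
  ring

theorem posterior_eq_varConv_varUpdate {i : V} {a : C} (h : A a i ≠ 0) :
    varConv (c i) (bigVarConv (varNbrs A i) fun a => m.checkToVar a i) =
      varConv (varUpdate A c m i a) (m.checkToVar a i) := by
  rw [bigVarConv_eq_erase _ (mem_varNbrs.2 h), ← varConv_assoc, varUpdate]

theorem bigCheckConv_eq_checkConv_checkUpdate {i : V} {a : C} (h : A a i ≠ 0) :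
    bigCheckConv (checkNbrs A a) (fun i => m.varToCheck i a) =
      checkConv (m.varToCheck i a) (checkUpdate A m a i) := by
  rw [bigCheckConv_eq_erase _ (mem_checkNbrs.2 h), checkUpdate]

/-- Let x and y be the two messages on the edge (i,a), P and B their updates. When x becomes x',
duality turns H(x) - H(x⊞B) into H(x⊛B) - H(B), and the change is H(x'⊛B) - H(x⊛B) - H(x'⊛y) +
H(x⊛y). When y becomes y', the change is H(P⊛y') - H(P⊛y) - H(x⊛y') + H(x⊛y). Both are mixed
differences over comparable pairs, since y is degraded with respect to B and x with respect to P. -/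
theorem betheEntropy_le_passMessage (hi : m.Improving A c) (hm : m.IsSymm)
    (hc : ∀ i, (c i).IsSymm) (e : DirectedEdge A) :
    betheEntropy A c m ≤ betheEntropy A c (passMessage A c m e) := by
  have hm' := hm.passMessage hc e
  cases e with
  | varToCheck i a h =>
    set m' := passMessage A c m (.varToCheck i a h) with hdef
    have hx' : m'.varToCheck i a = varUpdate A c m i a := by
      rw [hdef, passMessage_varToCheck_varToCheck]; simp
    have hne : ∀ j b, ¬(j = i ∧ b = a) → m'.varToCheck j b = m.varToCheck j b := fun j b hjb => by
      rw [hdef, passMessage_varToCheck_varToCheck, if_neg hjb]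
    have hct : m'.checkToVar = m.checkToVar := rfl
    have hB : checkUpdate A m' a i = checkUpdate A m a i :=
      bigCheckConv_congr fun j hj => hne j a fun h => Finset.ne_of_mem_erase hj h.1
    have e2 : ∑ b, ∑ j ∈ checkNbrs A b, (m'.varToCheck j b).entropy
        = ∑ b, ∑ j ∈ checkNbrs A b, (m.varToCheck j b).entropy
          + ((m'.varToCheck i a).entropy - (m.varToCheck i a).entropy) := by
      rw [sum_eq_sum_add_sub (Finset.mem_univ a) (fun b _ hb => Finset.sum_congr rfl fun j _ => by
          rw [hne j b fun h => hb h.2]),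
        sum_eq_sum_add_sub (s := checkNbrs A a) (mem_checkNbrs.2 h) (fun j _ hj => by
          rw [hne j a fun h => hj h.1])]
      ring
    have e3 := sum_eq_sum_add_sub (Finset.mem_univ a)
      (g := fun b => (bigCheckConv (checkNbrs A b) fun i => m'.varToCheck i b).entropy)
      (f := fun b => (bigCheckConv (checkNbrs A b) fun i => m.varToCheck i b).entropy)
      (fun b _ hb => congrArg _ (bigCheckConv_congr fun j _ => hne j b fun h => hb h.2))
    have e4 : ∑ j, ∑ b ∈ varNbrs A j, (varConv (m'.varToCheck j b) (m'.checkToVar b j)).entropy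
        = ∑ j, ∑ b ∈ varNbrs A j, (varConv (m.varToCheck j b) (m.checkToVar b j)).entropy
          + ((varConv (m'.varToCheck i a) (m.checkToVar a i)).entropy
            - (varConv (m.varToCheck i a) (m.checkToVar a i)).entropy) := by
      rw [hct]
      rw [sum_eq_sum_add_sub (Finset.mem_univ i) (fun j _ hj => Finset.sum_congr rfl fun b _ => by
          rw [hne j b fun h => hj h.1]),
        sum_eq_sum_add_sub (s := varNbrs A i) (mem_varNbrs.2 h) (fun b _ hb => by
          rw [hne i b fun h => hb h.2])]
      ring
    simp only [bigCheckConv_eq_checkConv_checkUpdate h, hB] at e3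
    rw [betheEntropy, betheEntropy, e2, e3, e4, hct]
    have d1 := (hm.varToCheck i a).entropy_varConv_add_checkConv (hm.checkUpdate (A := A) a i)
    have d2 := (hm'.varToCheck i a).entropy_varConv_add_checkConv (hm.checkUpdate (A := A) a i)
    have key := Degraded.entropy_varConv_add_le (hx' ▸ hi.varToCheck i a) (hi.checkToVar a i)
      (hm.varToCheck i a) (hm'.varToCheck i a) (hm.checkToVar a i) (hm.checkUpdate a i)
    linarith
  | checkToVar a i h =>
    set m' := passMessage A c m (.checkToVar a i h) with hdef
    have hy' : m'.checkToVar a i = checkUpdate A m a i := by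
      rw [hdef, passMessage_checkToVar_checkToVar]; simp
    have hne : ∀ b j, ¬(b = a ∧ j = i) → m'.checkToVar b j = m.checkToVar b j := fun b j hjb => by
      rw [hdef, passMessage_checkToVar_checkToVar, if_neg hjb]
    have hct : m'.varToCheck = m.varToCheck := rfl
    have hP : varUpdate A c m' i a = varUpdate A c m i a :=
      congrArg _ (bigVarConv_congr fun b hb => hne b i fun h => Finset.ne_of_mem_erase hb h.1)
    have e1 := sum_eq_sum_add_sub (Finset.mem_univ i)
      (g := fun i => (varConv (c i) (bigVarConv (varNbrs A i) fun a => m'.checkToVar a i)).entropy)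
      (f := fun i => (varConv (c i) (bigVarConv (varNbrs A i) fun a => m.checkToVar a i)).entropy)
      (fun j _ hj => congrArg _ (congrArg _ (bigVarConv_congr fun b _ => hne b j fun h => hj h.2)))
    have e4 : ∑ j, ∑ b ∈ varNbrs A j, (varConv (m'.varToCheck j b) (m'.checkToVar b j)).entropy
        = ∑ j, ∑ b ∈ varNbrs A j, (varConv (m.varToCheck j b) (m.checkToVar b j)).entropy
          + ((varConv (m.varToCheck i a) (m'.checkToVar a i)).entropy
            - (varConv (m.varToCheck i a) (m.checkToVar a i)).entropy) := by
      rw [hct]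
      rw [sum_eq_sum_add_sub (Finset.mem_univ i) (fun j _ hj => Finset.sum_congr rfl fun b _ => by
          rw [hne b j fun h => hj h.2]),
        sum_eq_sum_add_sub (s := varNbrs A i) (mem_varNbrs.2 h) (fun b _ hb => by
          rw [hne b i fun h => hb h.1])]
      ring
    simp only [posterior_eq_varConv_varUpdate h, hP] at e1
    rw [betheEntropy, betheEntropy, e1, e4, hct]
    have key := Degraded.entropy_varConv_add_le (hi.varToCheck i a) (hy' ▸ hi.checkToVar a i)
      (hm.varToCheck i a) (hm.varUpdate hc i a) (hm.checkToVar a i) (hm'.checkToVar a i)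
    linarith

theorem messagesAt_isSymm_and_improving (hc : ∀ i, (c i).IsSymm) (S : List (DirectedEdge A)) :
    (S.foldl (passMessage A c) (initMessages V C)).IsSymm ∧
      (S.foldl (passMessage A c) (initMessages V C)).Improving A c := by
  induction S using List.reverseRecOn with
  | nil => exact ⟨isSymm_initMessages, improving_initMessages⟩
  | append_singleton S e ih =>
    rw [List.foldl_concat]
    exact ⟨ih.1.passMessage hc e, ih.2.passMessage ih.1 hc e⟩

theorem antitone_gapU (hc : ∀ i, (c i).IsSymm) (S : List (DirectedEdge A)) :
    Antitone (gapU A S c) := by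
  refine antitone_nat_of_succ_le fun t => ?_
  have h := messagesAt_isSymm_and_improving hc (S.take t)
  rw [gapU, gapU, gapPotential_eq, gapPotential_eq]
  refine mul_le_mul_of_nonpos_left ?_ (neg_nonpos.2 (by positivity))
  rcases lt_or_ge t S.length with ht | ht
  · have : messagesAt A c S (t + 1) = passMessage A c (messagesAt A c S t) S[t] := by
      rw [messagesAt, List.take_succ_eq_append_getElem ht, List.foldl_concat, messagesAt]
    rw [this]
    exact betheEntropy_le_passMessage h.2 h.1 hc _
  · rw [messagesAt, messagesAt, List.take_of_length_le ht, List.take_of_length_le (by omega)]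

/-- Every initial message has entropy 1, so the two sums over edges cancel and each check
contributes 1/N to the potential. Nonemptiness is essential: an empty `⊞` is `Δ_∞`, of entropy 0. -/
theorem gapU_zero [Nonempty V] (hA : ∀ a, (checkNbrs A a).Nonempty) (S : List (DirectedEdge A)) :
    gapU A S c 0 = 1 - (1 - (Fintype.card C : ℝ) / (Fintype.card V : ℝ))
      - (1 / (Fintype.card V : ℝ)) * ∑ i, (c i).entropy := by
  have hV : (Fintype.card V : ℝ) ≠ 0 := by simp
  have h0 : messagesAt A c S 0 = initMessages V C := rfl
  have hswap : ∑ i : V, ∑ a ∈ varNbrs A i, (1 : ℝ) = ∑ a, ∑ i ∈ checkNbrs A a, (1 : ℝ) :=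
    Finset.sum_comm' (by simp)
  have hch : ∀ a, bigCheckConv (checkNbrs A a) (fun _ => deltaZero) = deltaZero := fun a =>
    bigCheckConv_deltaZero (hA a)
  rw [gapU, gapPotential_eq, h0]
  simp only [betheEntropy, initMessages, bigVarConv_deltaZero, varConv_deltaZero, hch,
    entropy_deltaZero, hswap]
  rw [Finset.sum_const (1 : ℝ) (s := (Finset.univ : Finset C)), Finset.card_univ, nsmul_eq_mul]
  field_simp
  ring

theorem checkNbrs_nonempty_of_linearIndependent (hA : LinearIndependent (ZMod 2) A.row) (a : C) :
    (checkNbrs A a).Nonempty := by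
  by_contra h
  refine hA.ne_zero a (funext fun i => ?_)
  by_contra hi
  exact h ⟨i, mem_checkNbrs.2 hi⟩

theorem codeRate_of_linearIndependent [Nonempty V] (hA : LinearIndependent (ZMod 2) A.row) :
    codeRate A = 1 - (Fintype.card C : ℝ) / (Fintype.card V : ℝ) := by
  have hV : (Fintype.card V : ℝ) ≠ 0 := by simp
  have h1 := A.mulVecLin.finrank_range_add_finrank_ker
  have h2 : Module.finrank (ZMod 2) (LinearMap.range A.mulVecLin) = Fintype.card C :=
    hA.rank_matrix
  rw [h2, Module.finrank_fintype_fun_eq_card] at h1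
  have h3 : (Fintype.card C : ℝ) + Module.finrank (ZMod 2) (binaryCode A) = Fintype.card V := by
    exact_mod_cast h1
  rw [codeRate, eq_sub_iff_add_eq, ← add_div, add_comm, h3, div_self hV]

end

/-! ### Cycle-free factor graphs -/

/-- A descending chain, read backwards, gives arbitrarily long walks without backtracking. In a
forest a walk with no two consecutive equal edges is a path, hence shorter than the number of
vertices. -/
theorem SimpleGraph.IsAcyclic.wellFounded_dart {W : Type*} [Finite W] {G : SimpleGraph W}
    (hG : G.IsAcyclic) :
    WellFounded fun d' d : G.Dart => d'.snd = d.fst ∧ d'.fst ≠ d.snd := by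
  have := Fintype.ofFinite W
  rw [wellFounded_iff_isEmpty_descending_chain]
  refine ⟨fun ⟨f, hf⟩ => ?_⟩
  have key : ∀ n, ∃ p : G.Walk (f n).fst (f 0).snd, p.length = n + 1 ∧
      ∃ l, p.edges = (f n).edge :: l ∧ List.IsChain (· ≠ ·) p.edges := by
    intro n
    induction n with
    | zero => exact ⟨SimpleGraph.Walk.cons (f 0).adj .nil, by simp, [], by simp [SimpleGraph.Dart.edge]⟩
    | succ n ih =>
      obtain ⟨p, hp, l, hl, hc⟩ := ih
      have h := hf n
      have hadj : G.Adj (f (n + 1)).fst (f n).fst := h.1 ▸ (f (n + 1)).adj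
      have he : s((f (n + 1)).fst, (f n).fst) = (f (n + 1)).edge := by
        rw [← h.1]; rfl
      refine ⟨.cons hadj p, by simp [hp], p.edges, by simp [he], ?_⟩
      rw [SimpleGraph.Walk.edges_cons, hl, List.isChain_cons_cons, ← hl]
      refine ⟨fun heq => ?_, hc⟩
      have heq' : s((f (n + 1)).fst, (f n).fst) = s((f n).fst, (f n).snd) := heq
      rw [Sym2.eq_iff] at heq'
      rcases heq' with ⟨h1, h2⟩ | ⟨h1, _⟩
      · exact (f n).adj.ne h2
      · exact h.2 h1
  obtain ⟨p, hp, l, hl, hc⟩ := key (Fintype.card W)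
  have := ((hG.isPath_iff_isChain p).2 hc).length_lt
  omega

namespace DirectedEdge

/-- The value of density evolution along the second edge depends on the message along the
first one. -/
def Precedes {A : Matrix C V (ZMod 2)} : DirectedEdge A → DirectedEdge A → Prop
  | .checkToVar b i _, .varToCheck j a _ => i = j ∧ b ≠ a
  | .varToCheck j b _, .checkToVar a i _ => b = a ∧ j ≠ i
  | _, _ => False

/-- A directed edge as a dart of the factor graph. -/
def toDart {A : Matrix C V (ZMod 2)} : DirectedEdge A → (factorGraph A).Dart
  | .varToCheck i a h => ⟨(Sum.inl i, Sum.inr a), h⟩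
  | .checkToVar a i h => ⟨(Sum.inr a, Sum.inl i), h⟩

theorem toDart_injective {A : Matrix C V (ZMod 2)} :
    Function.Injective (toDart (A := A)) := by
  rintro (⟨i, a, h⟩ | ⟨a, i, h⟩) (⟨j, b, h'⟩ | ⟨b, j, h'⟩) he <;>
    simpa [toDart] using congrArg SimpleGraph.Dart.toProd he

theorem wellFounded_precedes [Finite V] [Finite C] {A : Matrix C V (ZMod 2)}
    (hA : (factorGraph A).IsAcyclic) : WellFounded (Precedes (A := A)) := by
  refine Subrelation.wf ?_ (InvImage.wf toDart hA.wellFounded_dart)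
  rintro (⟨i, a, h⟩ | ⟨a, i, h⟩) (⟨j, b, h'⟩ | ⟨b, j, h'⟩) he
  · exact he.elim
  · exact ⟨congrArg Sum.inr he.1, fun h => he.2 (Sum.inl_injective h)⟩
  · exact ⟨congrArg Sum.inl he.1, fun h => he.2 (Sum.inr_injective h)⟩
  · exact he.elim

instance [Finite V] [Finite C] {A : Matrix C V (ZMod 2)} : Finite (DirectedEdge A) := by
  have := Fintype.ofFinite V
  have := Fintype.ofFinite C
  classical
  exact Finite.of_injective toDart toDart_injective

end DirectedEdge

/-- In a cycle-free factor graph with an edge, all neighbours of some check except at most one are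
leaves. -/
theorem exists_leaf_check [Finite V] [Finite C] {A : Matrix C V (ZMod 2)}
    (hA : (factorGraph A).IsAcyclic) (h0 : A ≠ 0) :
    ∃ a i, A a i ≠ 0 ∧ ∀ j ≠ i, A a j ≠ 0 → ∀ b ≠ a, A b j = 0 := by
  have hwf := (DirectedEdge.wellFounded_precedes hA).transGen
  obtain ⟨b, j, hbj⟩ : ∃ b j, A b j ≠ 0 := by
    by_contra! h
    exact h0 (Matrix.ext h)
  -- A minimal check-to-variable edge a → i is taken. A second check b at another neighbour j of a
  -- would put b → j two steps below it, via j → a; hence the transitive closure.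
  let s : Set (DirectedEdge A) := {e | ∃ a i h, e = .checkToVar a i h}
  have hs : s.Nonempty := ⟨.checkToVar b j hbj, b, j, hbj, rfl⟩
  obtain ⟨a, i, h, he⟩ := hwf.min_mem s hs
  refine ⟨a, i, h, fun j hj hja b hb => ?_⟩
  by_contra hbj
  refine hwf.not_lt_min s (x := .checkToVar b j hbj) ⟨b, j, hbj, rfl⟩ ?_
  rw [he]
  have h1 : (DirectedEdge.checkToVar b j hbj).Precedes (.varToCheck j a hja) := ⟨rfl, hb⟩
  have h2 : (DirectedEdge.varToCheck j a hja).Precedes (.checkToVar a i h) := ⟨rfl, hj⟩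
  exact .tail (.single h1) h2

/-! ### Finite termination of density evolution -/

section

variable [Fintype V] [Fintype C] [DecidableEq V] [DecidableEq C]
  {A : Matrix C V (ZMod 2)} {c : V → LDensity} {m : Messages V C}

/-- The message along an edge is left unchanged by density evolution. -/
def Settled (A : Matrix C V (ZMod 2)) (c : V → LDensity) (m : Messages V C) :
    DirectedEdge A → Prop
  | .varToCheck i a _ => m.varToCheck i a = varUpdate A c m i a
  | .checkToVar a i _ => m.checkToVar a i = checkUpdate A m a i

theorem settled_passMessage_self (e : DirectedEdge A) : Settled A c (passMessage A c m e) e := by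
  cases e with
  | varToCheck i a h =>
    rw [Settled, passMessage_varToCheck_varToCheck, if_pos ⟨rfl, rfl⟩]
    rfl
  | checkToVar a i h =>
    rw [Settled, passMessage_checkToVar_checkToVar, if_pos ⟨rfl, rfl⟩]
    rfl

/-- An update reads only the messages on the preceding edges, so recomputing any other message
cannot disturb it. -/
theorem Settled.passMessage {e e' : DirectedEdge A} (h : Settled A c m e') (hne : e' ≠ e)
    (hp : ¬ e.Precedes e') : Settled A c (passMessage A c m e) e' := by
  cases e with
  | varToCheck i a hia =>
    cases e' with
    | varToCheck j b hjb =>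
      rw [Settled, passMessage_varToCheck_varToCheck, if_neg]
      · exact h
      · rintro ⟨rfl, rfl⟩; exact hne rfl
    | checkToVar b j hjb =>
      rw [Settled] at h
      refine h.trans (LDensity.bigCheckConv_congr fun k hk => ?_)
      rw [passMessage_varToCheck_varToCheck, if_neg]
      rintro ⟨rfl, rfl⟩
      exact hp ⟨rfl, Finset.ne_of_mem_erase hk⟩
  | checkToVar a i hia =>
    cases e' with
    | varToCheck j b hjb =>
      rw [Settled] at h
      refine h.trans (congrArg _ (LDensity.bigVarConv_congr fun k hk => ?_))
      rw [passMessage_checkToVar_checkToVar, if_neg]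
      rintro ⟨rfl, rfl⟩
      exact hp ⟨rfl, (Finset.ne_of_mem_erase hk)⟩
    | checkToVar b j hjb =>
      rw [Settled, passMessage_checkToVar_checkToVar, if_neg]
      · exact h
      · rintro ⟨rfl, rfl⟩; exact hne rfl

/-- On a cycle-free factor graph, finitely many messages lead to a fixed point of density
evolution. -/
theorem exists_settled (hA : (factorGraph A).IsAcyclic) (m : Messages V C) :
    ∃ T : List (DirectedEdge A), ∀ e, Settled A c (T.foldl (passMessage A c) m) e := by
  have hwf := DirectedEdge.wellFounded_precedes hA
  -- A maximal set that is closed under predecessors and settled by a single schedule must be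
  -- everything: passing a minimal outside edge settles it, and closedness ensures that this edge
  -- precedes nothing in the set.
  let P : Set (Set (DirectedEdge A)) := {s |
    (∀ e ∈ s, ∀ e' : DirectedEdge A, e'.Precedes e → e' ∈ s) ∧
    ∃ T : List (DirectedEdge A), ∀ e ∈ s, Settled A c (T.foldl (passMessage A c) m) e}
  obtain ⟨s, hs⟩ := (Set.toFinite P).exists_maximal ⟨∅, by simp [P]⟩
  obtain ⟨hdown, T, hT⟩ := hs.prop
  by_cases hu : s = Set.univ
  · exact ⟨T, fun e => hT e (hu ▸ Set.mem_univ e)⟩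
  exfalso
  have hne : sᶜ.Nonempty := Set.nonempty_compl.2 hu
  set e := hwf.min sᶜ hne with he
  have hes : e ∉ s := hwf.min_mem sᶜ hne
  have hpre : ∀ e' : DirectedEdge A, e'.Precedes e → e' ∈ s := fun e' h' => by
    by_contra hn
    exact hwf.not_lt_min sᶜ hn h'
  have hmem : insert e s ∈ P := by
    refine ⟨?_, T ++ [e], ?_⟩
    · rintro e₁ (rfl | h₁) e₂ h₂
      · exact Or.inr (hpre e₂ h₂)
      · exact Or.inr (hdown e₁ h₁ e₂ h₂)
    · intro e₁ h₁
      rw [List.foldl_concat]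
      rcases h₁ with rfl | h₁
      · exact settled_passMessage_self _
      · exact (hT e₁ h₁).passMessage (fun h => hes (h ▸ h₁)) fun h => hes (hdown e₁ h₁ e h)
  exact hes (hs.le_of_ge hmem (Set.subset_insert e s) (Set.mem_insert e s))

end

/-! ### The partition function of a code -/

section

variable [Fintype V] [DecidableEq V]

/-- The weight of a word in the partition function. -/
def wordWeight (u : V → ℝ) (x : V → ZMod 2) : ℝ := ∏ v, if x v = 0 then 1 else u v

open Classical in
/-- The partition function `∑ₓ ∏_{x v ≠ 0} u v` of the code. -/
def partitionFunction (A : Matrix C V (ZMod 2)) (u : V → ℝ) : ℝ :=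
  ∑ x : V → ZMod 2, if A.mulVec x = 0 then wordWeight u x else 0

theorem wordWeight_update (u : V → ℝ) (i : V) (t : ℝ) (x : V → ZMod 2) :
    wordWeight (Function.update u i t) x =
      (if x i = 0 then 1 else t) * ∏ v ∈ Finset.univ.erase i, if x v = 0 then 1 else u v := by
  rw [wordWeight, ← Finset.mul_prod_erase _ _ (Finset.mem_univ i), Function.update_self]
  congr 1
  refine Finset.prod_congr rfl fun v hv => ?_
  rw [Function.update_of_ne (Finset.ne_of_mem_erase hv)]

/-- Each weight contains `u i` to the power 0 or 1, so the partition function is affine in every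
coordinate. -/
theorem partitionFunction_update (A : Matrix C V (ZMod 2)) (u : V → ℝ) (i : V) (t : ℝ) :
    partitionFunction A (Function.update u i t) =
      partitionFunction A (Function.update u i 0) +
        t * (partitionFunction A (Function.update u i 1) -
          partitionFunction A (Function.update u i 0)) := by
  simp only [partitionFunction, ← Finset.sum_sub_distrib, Finset.mul_sum, ← Finset.sum_add_distrib]
  refine Finset.sum_congr rfl fun x _ => ?_
  split_ifs
  · simp only [wordWeight_update]
    split_ifs <;> ring
  · simp

/-- No check sees the bit `j`, so flipping it permutes the codewords and both values of the bit
contribute equally. -/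
theorem partitionFunction_update_one_of_col_eq_zero {A : Matrix C V (ZMod 2)} {j : V}
    (hj : ∀ a, A a j = 0) (u : V → ℝ) :
    partitionFunction A (Function.update u j 1) =
      2 * partitionFunction A (Function.update u j 0) := by
  have hA : ∀ x, A.mulVec (x + Pi.single j 1) = A.mulVec x := fun x => by
    have h0 : A.col j = 0 := funext hj
    rw [Matrix.mulVec_add, Matrix.mulVec_single_one, h0, add_zero]
  classical
  have h2 : partitionFunction A (Function.update u j 0) = ∑ x : V → ZMod 2,
      if A.mulVec x = 0 then wordWeight (Function.update u j 0) (x + Pi.single j 1) else 0 := by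
    rw [partitionFunction, ← Equiv.sum_comp (Equiv.addRight (Pi.single j (1 : ZMod 2)))]
    simp only [Equiv.coe_addRight, hA]
  rw [two_mul]
  nth_rewrite 2 [h2]
  simp only [partitionFunction, ← Finset.sum_add_distrib]
  refine Finset.sum_congr rfl fun x _ => ?_
  split_ifs
  · simp only [wordWeight_update]
    have he : ∏ v ∈ Finset.univ.erase j,
        (if (x + Pi.single j (1 : ZMod 2) : V → ZMod 2) v = 0 then 1 else u v) =
          ∏ v ∈ Finset.univ.erase j, (if x v = 0 then 1 else u v) := by
      refine Finset.prod_congr rfl fun v hv => ?_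
      simp [Finset.ne_of_mem_erase hv]
    rw [he, ← add_mul]
    congr 1
    simp only [Pi.add_apply, Pi.single_eq_same]
    have : ∀ z : ZMod 2, z = 0 ∨ z = 1 := by decide
    rcases this (x j) with h | h
    · simp [h]
    · simp [h, show (1 + 1 : ZMod 2) = 0 by decide]
  · simp

theorem partitionFunction_of_col_eq_zero {A : Matrix C V (ZMod 2)} {j : V}
    (hj : ∀ a, A a j = 0) (u : V → ℝ) :
    partitionFunction A u = partitionFunction A (Function.update u j 0) * (1 + u j) := by
  have h := partitionFunction_update A u j (u j)
  rw [Function.update_eq_self, partitionFunction_update_one_of_col_eq_zero hj] at h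
  rw [h]; ring

theorem partitionFunction_of_cols_eq_zero {A : Matrix C V (ZMod 2)} (J : Finset V)
    (hJ : ∀ j ∈ J, ∀ a, A a j = 0) (u : V → ℝ) :
    partitionFunction A u =
      partitionFunction A (fun v => if v ∈ J then 0 else u v) * ∏ j ∈ J, (1 + u j) := by
  induction J using Finset.induction_on with
  | empty => simp
  | insert j J hj ih =>
    rw [ih fun k hk => hJ k (Finset.mem_insert_of_mem hk),
      partitionFunction_of_col_eq_zero (hJ j (Finset.mem_insert_self j J)),
      Finset.prod_insert hj]
    have : Function.update (fun v => if v ∈ J then 0 else u v) j 0 =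
        fun v => if v ∈ insert j J then 0 else u v := by
      funext v
      by_cases hv : v = j <;> simp [hv]
    rw [this, if_neg hj]
    ring

theorem one_le_partitionFunction (A : Matrix C V (ZMod 2)) {u : V → ℝ} (hu : ∀ v, 0 ≤ u v) :
    1 ≤ partitionFunction A u := by
  have hn : ∀ x : V → ZMod 2, 0 ≤ wordWeight u x := fun x =>
    Finset.prod_nonneg fun v _ => by split_ifs <;> simp [hu]
  rw [partitionFunction]
  refine le_trans ?_ (Finset.single_le_sum (fun x _ => ?_) (Finset.mem_univ (0 : V → ZMod 2)))
  · simp [wordWeight]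
  · split_ifs
    · exact hn x
    · exact le_rfl

theorem partitionFunction_zero (A : Matrix C V (ZMod 2)) : partitionFunction A 0 = 1 := by
  rw [partitionFunction, Finset.sum_eq_single 0]
  · simp [wordWeight]
  · intro x _ hx
    obtain ⟨v, hv⟩ := Function.ne_iff.1 hx
    split_ifs
    · exact Finset.prod_eq_zero (Finset.mem_univ v) (by simp at hv; simp [hv])
    · rfl
  · simp

/-- The nontrivial character of `ZMod 2`. -/
def signChar (z : ZMod 2) : ℝ := if z = 0 then 1 else -1

theorem signChar_add (y z : ZMod 2) : signChar (y + z) = signChar y * signChar z := by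
  have : ∀ z : ZMod 2, z = 0 ∨ z = 1 := by decide
  rcases this y with rfl | rfl <;> rcases this z with rfl | rfl <;>
    simp [signChar, show (1 + 1 : ZMod 2) = 0 by decide]

theorem signChar_sum {ι : Type*} (s : Finset ι) (f : ι → ZMod 2) :
    signChar (∑ i ∈ s, f i) = ∏ i ∈ s, signChar (f i) := by
  classical
  induction s using Finset.induction_on with
  | empty => simp [signChar]
  | insert i s hi ih => rw [Finset.sum_insert hi, Finset.prod_insert hi, signChar_add, ih]

variable [DecidableEq C]

/-- A parity check, as an average over the two characters. -/
theorem partitionFunction_eq_average (A : Matrix C V (ZMod 2)) (a : C) (u : V → ℝ) :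
    partitionFunction A u = (partitionFunction (A.updateRow a 0) u +
      partitionFunction (A.updateRow a 0) fun v => if A a v = 0 then u v else -u v) / 2 := by
  have hA : ∀ x, A.mulVec x = 0 ↔ (A.updateRow a 0).mulVec x = 0 ∧ ∑ v, A a v * x v = 0 := by
    intro x
    rw [funext_iff, funext_iff]
    refine ⟨fun h => ⟨fun b => ?_, h a⟩, fun h b => ?_⟩
    · by_cases hb : b = a
      · simp [Matrix.mulVec, hb]
      · rw [← h b]; simp [Matrix.mulVec, hb]
    · by_cases hb : b = a
      · rw [hb]; exact h.2
      · rw [← h.1 b]; simp [Matrix.mulVec, hb]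
  classical
  -- The sign of the check at `x` is absorbed by negating `u` on the neighbours of `a`; for this the
  -- weights have to be arbitrary reals.
  have hw : ∀ x, wordWeight (fun v => if A a v = 0 then u v else -u v) x =
      signChar (∑ v, A a v * x v) * wordWeight u x := by
    intro x
    rw [signChar_sum, wordWeight, wordWeight, ← Finset.prod_mul_distrib]
    refine Finset.prod_congr rfl fun v _ => ?_
    by_cases h1 : x v = 0 <;> by_cases h2 : A a v = 0 <;> simp [h1, h2, signChar]
  simp only [partitionFunction, ← Finset.sum_add_distrib, Finset.sum_div, hw]
  refine Finset.sum_congr rfl fun x _ => ?_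
  rw [if_congr (hA x) rfl rfl]
  by_cases h1 : (A.updateRow a 0).mulVec x = 0 <;> by_cases h2 : ∑ v, A a v * x v = 0 <;>
    simp [h1, h2, signChar]

/-- Elimination of a check all of whose neighbours but `i` are leaves. -/
theorem partitionFunction_eliminate {A : Matrix C V (ZMod 2)} {a : C} {i : V} (hi : A a i ≠ 0)
    {J : Finset V} (hJ : ∀ j, j ∈ J ↔ A a j ≠ 0 ∧ j ≠ i)
    (hleaf : ∀ j ∈ J, ∀ b ≠ a, A b j = 0) (u : V → ℝ) {y : ℝ}
    (hy : (1 + y) * ∏ j ∈ J, (1 - u j) = (1 - y) * ∏ j ∈ J, (1 + u j)) :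
    partitionFunction A u * (1 + y) =
      partitionFunction (A.updateRow a 0)
        (Function.update (fun v => if v ∈ J then 0 else u v) i (u i * y)) *
          ∏ j ∈ J, (1 + u j) := by
  have hiJ : i ∉ J := fun h => ((hJ i).1 h).2 rfl
  have hcol : ∀ j ∈ J, ∀ b, A.updateRow a 0 b j = 0 := fun j hj b => by
    by_cases hb : b = a
    · simp [hb]
    · rw [Matrix.updateRow_ne hb]; exact hleaf j hj b hb
  set u₀ : V → ℝ := fun v => if v ∈ J then 0 else u v with hu₀
  have e1 := partitionFunction_of_cols_eq_zero J hcol u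
  have e2 := partitionFunction_of_cols_eq_zero J hcol fun v => if A a v = 0 then u v else -u v
  have h1 : Function.update u₀ i (u i) = u₀ := by
    rw [show u i = u₀ i by simp [hu₀, hiJ], Function.update_eq_self]
  have h2 : (fun v => if v ∈ J then 0 else if A a v = 0 then u v else -u v) =
      Function.update u₀ i (-u i) := by
    funext v
    by_cases hv : v = i
    · subst hv; simp [hiJ, hi]
    · by_cases hvJ : v ∈ J
      · simp [hv, hu₀, hvJ]
      · have : A a v = 0 := by
          by_contra h
          exact hvJ ((hJ v).2 ⟨h, hv⟩)
        simp [hv, hu₀, hvJ, this]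
  have h3 : ∏ j ∈ J, (1 + if A a j = 0 then u j else -u j) = ∏ j ∈ J, (1 - u j) :=
    Finset.prod_congr rfl fun j hj => by rw [if_neg ((hJ j).1 hj).1, sub_eq_add_neg]
  rw [← hu₀, ← h1, partitionFunction_update] at e1
  rw [h2, h3, partitionFunction_update] at e2
  rw [partitionFunction_eq_average A a, e1, e2, partitionFunction_update _ _ _ (u i * y)]
  set α := partitionFunction (A.updateRow a 0) (Function.update u₀ i 0)
  set β := partitionFunction (A.updateRow a 0) (Function.update u₀ i 1) - α
  -- With P± = ∏ (1 ± u_j) the two characters give Z = ((α + u_i β) P₊ + (α - u_i β) P₋) / 2, and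
  -- `hy` replaces (1 + y) P₋ by (1 - y) P₊.
  linear_combination (α - u i * β) / 2 * hy

end

/-! ### Check combination of several LLRs -/

instance : Std.Commutative boxPlus := ⟨boxPlus_comm⟩

instance : Std.Associative boxPlus := ⟨boxPlus_assoc⟩

/-- The check-node combination of a family of LLRs. -/
def bigBoxPlus (J : Finset V) (l : V → EReal) : EReal := J.fold boxPlus ⊤ l

theorem bigBoxPlus_insert [DecidableEq V] {J : Finset V} {j : V} (hj : j ∉ J) (l : V → EReal) :
    bigBoxPlus (insert j J) l = boxPlus (l j) (bigBoxPlus J l) := Finset.fold_insert hj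

theorem boxPlus_ne_bot {x y : EReal} (hx : x ≠ ⊥) (hy : y ≠ ⊥) : boxPlus x y ≠ ⊥ := by
  intro h
  have h1 := tanhHalf_boxPlus x y
  rw [h, tanhHalf_bot] at h1
  have h2 := (eq_zero_of_one_add_mul_eq_zero (tanhHalf_mem x) (tanhHalf_mem y)
    (by linarith)).1
  rcases mul_eq_zero.1 h2 with h3 | h3
  · exact hx (tanhHalf_eq_neg_one_iff.1 (by linarith))
  · exact hy (tanhHalf_eq_neg_one_iff.1 (by linarith))

theorem bigBoxPlus_ne_bot {J : Finset V} {l : V → EReal} (hl : ∀ j ∈ J, l j ≠ ⊥) :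
    bigBoxPlus J l ≠ ⊥ := by
  classical
  induction J using Finset.induction_on with
  | empty => simp [bigBoxPlus]
  | insert j J hj ih =>
    rw [bigBoxPlus_insert hj]
    exact boxPlus_ne_bot (hl j (by simp)) (ih fun k hk => hl k (by simp [hk]))

theorem tanhHalf_bigBoxPlus (J : Finset V) (l : V → EReal) :
    tanhHalf (bigBoxPlus J l) = ∏ j ∈ J, tanhHalf (l j) := by
  classical
  induction J using Finset.induction_on with
  | empty => simp [bigBoxPlus]
  | insert j J hj ih => rw [bigBoxPlus_insert hj, tanhHalf_boxPlus, ih, Finset.prod_insert hj]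

/-- The product rule for tanh(L/2), cross-multiplied: exactly the relation that
`partitionFunction_eliminate` asks of `y`. -/
theorem expNeg_bigBoxPlus {J : Finset V} {l : V → EReal} (hl : ∀ j ∈ J, l j ≠ ⊥) :
    (1 + expNeg (bigBoxPlus J l)) * ∏ j ∈ J, (1 - expNeg (l j)) =
      (1 - expNeg (bigBoxPlus J l)) * ∏ j ∈ J, (1 + expNeg (l j)) := by
  have hp : ∀ x, 1 + expNeg x ≠ 0 := fun x => by have := expNeg_nonneg x; positivity
  have h := tanhHalf_bigBoxPlus J l
  rw [tanhHalf_eq (bigBoxPlus_ne_bot hl), Finset.prod_congr rfl fun j hj => tanhHalf_eq (hl j hj),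
    Finset.prod_div_distrib, div_eq_div_iff (hp _) (Finset.prod_ne_zero_iff.2 fun j _ => hp _)] at h
  linarith

theorem _root_.Measurable.boxPlus {Ω : Type*} [MeasurableSpace Ω] {f g : Ω → EReal}
    (hf : Measurable f) (hg : Measurable g) : Measurable fun x => boxPlus (f x) (g x) := by
  have h := measurable_boxPlus.comp (hf.prodMk hg)
  rw [Function.comp_def] at h
  exact h

theorem measurable_bigBoxPlus (J : Finset V) : Measurable (bigBoxPlus J) := by
  classical
  induction J using Finset.induction_on with
  | empty => exact measurable_const
  | insert j J hj ih =>
    have h : bigBoxPlus (insert j J) = fun l => boxPlus (l j) (bigBoxPlus J l) := by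
      funext l
      exact bigBoxPlus_insert hj l
    rw [h]
    exact (measurable_pi_apply j).boxPlus ih

/-! ### Integration over independent LLRs -/

section

variable [Fintype V] [DecidableEq V]

/-- The joint law of independent LLRs. -/
abbrev llrLaw (c : V → LDensity) : Measure (V → EReal) := Measure.pi fun v => (c v : Measure EReal)

/-- A coordinate on which the remaining integrand does not depend can be integrated separately. -/
theorem lintegral_llrLaw_separate (c : V → LDensity) (j : V)
    {H : (V → EReal) → EReal → ENNReal} (hH : Measurable (Function.uncurry H))
    (hj : ∀ l t s, H (Function.update l j t) s = H l s) :
    ∫⁻ l, H l (l j) ∂llrLaw c = ∫⁻ l, ∫⁻ t, H l t ∂(c j : Measure EReal) ∂llrLaw c := by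
  have m1 : Measurable fun l : V → EReal => H l (l j) :=
    hH.comp (measurable_id.prodMk (measurable_pi_apply j))
  have m2 : Measurable fun l : V → EReal => ∫⁻ t, H l t ∂(c j : Measure EReal) :=
    Measurable.lintegral_prod_right' hH
  refine lintegral_eq_of_lmarginal_eq {j} m1 m2 ?_
  rw [lmarginal_singleton, lmarginal_singleton]
  funext l
  simp [hj]

/-- The law of a coordinate on which the integrand does not depend is irrelevant. -/
theorem lintegral_llrLaw_update (c : V → LDensity) (i : V) (d : LDensity)
    {g : (V → EReal) → ENNReal} (hg : Measurable g)
    (hi : ∀ l t, g (Function.update l i t) = g l) :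
    ∫⁻ l, g l ∂llrLaw (Function.update c i d) = ∫⁻ l, g l ∂llrLaw c := by
  -- The marginal over all coordinates but `i` is already the full integral, and it does not involve
  -- the law at `i`.
  have key : ∀ e : V → LDensity, ∫⁻ l, g l ∂llrLaw e =
      lmarginal (fun v => (e v : Measure EReal)) (Finset.univ.erase i) g 0 := by
    intro e
    rw [llrLaw, lintegral_eq_lmarginal_univ (0 : V → EReal),
      lmarginal_erase _ hg (Finset.mem_univ i)]
    have : ∀ t, lmarginal (fun v => (e v : Measure EReal)) (Finset.univ.erase i) g
        (Function.update 0 i t) =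
          lmarginal (fun v => (e v : Measure EReal)) (Finset.univ.erase i) g 0 := fun t => by
      rw [lmarginal_update_of_notMem hg (Finset.notMem_erase i _)]
      congr 1
      funext l
      exact hi l t
    simp [this]
  rw [key, key, lmarginal, lmarginal]
  congr 2
  funext v
  rw [Function.update_of_ne (Finset.ne_of_mem_erase v.2)]

/-- The check-node combination of independent LLRs is distributed like the `⊞`-convolution. -/
theorem lintegral_bigBoxPlus (c : V → LDensity) (J : Finset V)
    {K : (V → EReal) → EReal → ENNReal} (hK : Measurable (Function.uncurry K))
    (hJ : ∀ j ∈ J, ∀ l t s, K (Function.update l j t) s = K l s) :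
    ∫⁻ l, K l (bigBoxPlus J l) ∂llrLaw c =
      ∫⁻ l, ∫⁻ z, K l z ∂(LDensity.bigCheckConv J c : Measure EReal) ∂llrLaw c := by
  induction J using Finset.induction_on generalizing K with
  | empty =>
    refine lintegral_congr fun l => ?_
    have : Measurable (K l) := hK.comp (measurable_const.prodMk measurable_id)
    exact (lintegral_dirac' (⊤ : EReal) this).symm
  | insert j J hj ih =>
    have hbp : Measurable fun q : (V → EReal) × EReal => boxPlus (q.1 j) q.2 :=
      ((measurable_pi_apply j).comp measurable_fst).boxPlus measurable_snd
    have h1 := ih (K := fun l z => K l (boxPlus (l j) z))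
      (hK.comp (measurable_fst.prodMk hbp)) (fun k hk l t s => by
        have hkj : j ≠ k := fun h => hj (h ▸ hk)
        rw [hJ k (Finset.mem_insert_of_mem hk), Function.update_of_ne hkj])
    have hm : Measurable (Function.uncurry fun (l : V → EReal) (t : EReal) =>
        ∫⁻ z, K l (boxPlus t z) ∂(LDensity.bigCheckConv J c : Measure EReal)) := by
      refine Measurable.lintegral_prod_right' (f := fun q : ((V → EReal) × EReal) × EReal =>
        K q.1.1 (boxPlus q.1.2 q.2)) ?_
      have : Measurable fun q : ((V → EReal) × EReal) × EReal => boxPlus q.1.2 q.2 :=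
        (measurable_snd.comp measurable_fst).boxPlus measurable_snd
      exact hK.comp ((measurable_fst.comp measurable_fst).prodMk this)
    have h2 := lintegral_llrLaw_separate c j hm fun l t s => by
      simp only [hJ j (Finset.mem_insert_self j J)]
    simp only [bigBoxPlus_insert hj]
    rw [h1, h2]
    refine lintegral_congr fun l => ?_
    have hfold : LDensity.bigCheckConv (insert j J) c =
        LDensity.checkConv (c j) (LDensity.bigCheckConv J c) := Finset.fold_insert hj
    rw [hfold]
    exact (LDensity.lintegral_checkConv (c j) _
      (hK.comp (measurable_const.prodMk measurable_id))).symm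

/-- Absorbing the combination of the LLRs in `J` into the LLR of `i`. -/
theorem lintegral_update_add_bigBoxPlus (c : V → LDensity) (i : V) {J : Finset V}
    {F : (V → EReal) → ENNReal} (hF : Measurable F)
    (hJ : ∀ j ∈ J, ∀ l t, F (Function.update l j t) = F l) (hiJ : i ∉ J) :
    ∫⁻ l, F (Function.update l i (l i + bigBoxPlus J l)) ∂llrLaw c =
      ∫⁻ l, F l ∂llrLaw (Function.update c i
        (LDensity.varConv (c i) (LDensity.bigCheckConv J c))) := by
  have hupd : Measurable fun q : (V → EReal) × EReal => Function.update q.1 i q.2 :=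
    measurable_update'
  have m1 : Measurable (Function.uncurry fun (l : V → EReal) z =>
      F (Function.update l i (l i + z))) :=
    hF.comp (hupd.comp (measurable_fst.prodMk
      (((measurable_pi_apply i).comp measurable_fst).add measurable_snd)))
  -- With coordinate `i` overwritten, the integrand ignores `J` except through the combined LLR,
  -- which may be replaced by an independent variable. Then `l i` is integrated separately, and the
  -- sum of the two has the law `⊛`.
  have h1 := lintegral_bigBoxPlus c J m1 fun j hj l t s => by
    have hij : i ≠ j := fun h => hiJ (h ▸ hj)
    rw [Function.update_of_ne hij, Function.update_comm hij.symm, hJ j hj]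
  have m2 : Measurable (Function.uncurry fun (l : V → EReal) t =>
      ∫⁻ z, F (Function.update l i (t + z)) ∂(LDensity.bigCheckConv J c : Measure EReal)) := by
    refine Measurable.lintegral_prod_right' (f := fun q : ((V → EReal) × EReal) × EReal =>
      F (Function.update q.1.1 i (q.1.2 + q.2))) ?_
    exact hF.comp (hupd.comp ((measurable_fst.comp measurable_fst).prodMk
      ((measurable_snd.comp measurable_fst).add measurable_snd)))
  have h2 := lintegral_llrLaw_separate c i m2 fun l t s => by simp
  have m3 : Measurable (Function.uncurry fun (l : V → EReal) w => F (Function.update l i w)) :=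
    hF.comp hupd
  have h3 := lintegral_llrLaw_separate (Function.update c i
    (LDensity.varConv (c i) (LDensity.bigCheckConv J c))) i m3 fun l t s => by simp
  simp only [Function.update_eq_self, Function.update_self] at h3
  rw [h1, h2, h3, lintegral_llrLaw_update]
  · refine lintegral_congr fun l => ?_
    exact (LDensity.lintegral_varConv _ _ (f := fun w => F (Function.update l i w))
      (hF.comp (hupd.comp (measurable_const.prodMk measurable_id)))).symm
  · exact Measurable.lintegral_prod_right' m3
  · intro l t
    simp

theorem lintegral_llrLaw_eval (c : V → LDensity) (j : V) {f : EReal → ENNReal}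
    (hf : Measurable f) : ∫⁻ l, f (l j) ∂llrLaw c = ∫⁻ t, f t ∂(c j : Measure EReal) := by
  have := lintegral_llrLaw_separate c j (H := fun _ t => f t) (hf.comp measurable_snd)
    fun _ _ _ => rfl
  simpa using this

theorem ae_ne_bot_llrLaw {c : V → LDensity} (hc : ∀ v, (c v).IsSymm) :
    ∀ᵐ l ∂llrLaw c, ∀ v, l v ≠ ⊥ := by
  rw [ae_all_iff]
  intro v
  exact (Measure.quasiMeasurePreserving_eval (fun v => (c v : Measure EReal)) v).ae
    (hc v).ae_ne_bot

/-! ### The entropy of a code -/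

/-- The logarithm of the partition function at given LLRs. -/
def logPartition (A : Matrix C V (ZMod 2)) (l : V → EReal) : ℝ :=
  Real.logb 2 (partitionFunction A fun v => expNeg (l v))

theorem measurable_partitionFunction (A : Matrix C V (ZMod 2)) :
    Measurable (partitionFunction A) := by
  unfold partitionFunction wordWeight
  refine Finset.measurable_sum _ fun x _ => ?_
  split_ifs
  · refine Finset.measurable_prod _ fun v _ => ?_
    split_ifs
    · exact measurable_const
    · exact measurable_pi_apply v
  · exact measurable_const

theorem measurable_logPartition (A : Matrix C V (ZMod 2)) : Measurable (logPartition A) := by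
  refine Measurable.div_const (Real.measurable_log.comp
    ((measurable_partitionFunction A).comp ?_)) _
  exact measurable_pi_lambda _ fun v => measurable_expNeg.comp (measurable_pi_apply v)

theorem logPartition_nonneg (A : Matrix C V (ZMod 2)) (l : V → EReal) : 0 ≤ logPartition A l :=
  Real.logb_nonneg (by norm_num) (one_le_partitionFunction A fun v => expNeg_nonneg (l v))

/-- The entropy of a uniformly distributed codeword given independent LLRs. -/
def codeEntropy (A : Matrix C V (ZMod 2)) (c : V → LDensity) : ENNReal :=
  ∫⁻ l, ENNReal.ofReal (logPartition A l) ∂llrLaw c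

namespace LDensity

/-- The entropy as an extended nonnegative real. -/
def lentropy (c : LDensity) : ENNReal :=
  ∫⁻ x, ENNReal.ofReal (Real.logb 2 (1 + expNeg x)) ∂(c : Measure EReal)

theorem IsSymm.lentropy_eq {c : LDensity} (hc : c.IsSymm) :
    c.lentropy = ENNReal.ofReal c.entropy := by
  rw [lentropy, entropy_eq, ofReal_integral_eq_lintegral_ofReal hc.integrable_surprisal
    (Filter.Eventually.of_forall logb_one_add_expNeg_nonneg)]

theorem entropy_nonneg (c : LDensity) : 0 ≤ c.entropy :=
  integral_nonneg logb_one_add_expNeg_nonneg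

end LDensity

theorem logPartition_of_cols_eq_zero {A : Matrix C V (ZMod 2)} {J : Finset V}
    (hJ : ∀ j ∈ J, ∀ a, A a j = 0) (l : V → EReal) :
    logPartition A l = logPartition A (fun v => if v ∈ J then ⊤ else l v) +
      ∑ j ∈ J, Real.logb 2 (1 + expNeg (l j)) := by
  have hp : ∀ x, 1 + expNeg x ≠ 0 := fun x => by have := expNeg_nonneg x; positivity
  have h1 := one_le_partitionFunction A fun v => expNeg_nonneg (if v ∈ J then ⊤ else l v)
  rw [logPartition, partitionFunction_of_cols_eq_zero J hJ, logPartition,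
    ← Real.logb_prod _ _ fun j _ => hp _, ← Real.logb_mul (by positivity)
      (Finset.prod_ne_zero_iff.2 fun j _ => hp _)]
  congr 3
  funext v
  split_ifs <;> simp

theorem codeEntropy_of_cols_eq_zero {A : Matrix C V (ZMod 2)} {J : Finset V}
    (hJ : ∀ j ∈ J, ∀ a, A a j = 0) (c : V → LDensity) :
    codeEntropy A c =
      ∫⁻ l, ENNReal.ofReal (logPartition A fun v => if v ∈ J then ⊤ else l v) ∂llrLaw c +
        ∑ j ∈ J, (c j).lentropy := by
  have hm : ∀ j, Measurable fun l : V → EReal =>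
      ENNReal.ofReal (Real.logb 2 (1 + expNeg (l j))) := fun j =>
    measurable_logb_one_add_expNeg.ennreal_ofReal.comp (measurable_pi_apply j)
  have h : ∀ l, ENNReal.ofReal (logPartition A l) =
      ENNReal.ofReal (logPartition A fun v => if v ∈ J then ⊤ else l v) +
        ∑ j ∈ J, ENNReal.ofReal (Real.logb 2 (1 + expNeg (l j))) := fun l => by
    rw [logPartition_of_cols_eq_zero hJ, ENNReal.ofReal_add (logPartition_nonneg A _)
      (Finset.sum_nonneg fun j _ => logb_one_add_expNeg_nonneg _),
      ENNReal.ofReal_sum_of_nonneg fun j _ => logb_one_add_expNeg_nonneg _]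
  rw [codeEntropy, lintegral_congr h, lintegral_add_right _
    (Finset.measurable_sum _ fun j _ => hm j), lintegral_finsetSum _ fun j _ => hm j]
  congr 1
  refine Finset.sum_congr rfl fun j _ => ?_
  exact lintegral_llrLaw_eval c j measurable_logb_one_add_expNeg.ennreal_ofReal

theorem codeEntropy_zero (c : V → LDensity) :
    codeEntropy (0 : Matrix C V (ZMod 2)) c = ∑ v, (c v).lentropy := by
  rw [codeEntropy_of_cols_eq_zero (J := Finset.univ) (by simp)]
  have : logPartition (0 : Matrix C V (ZMod 2)) (fun _ => ⊤) = 0 := by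
    have h0 : (fun _ : V => (0 : ℝ)) = 0 := rfl
    simp [logPartition, h0, partitionFunction_zero]
  simp [this]

/-- The integrated logarithm of `partitionFunction_eliminate`. Without the check `a` the leaves in
`J` are free bits, which accounts for the factor `∏ (1 + u j)`. The additive form avoids subtraction
in `ENNReal` while finiteness is still unknown. -/
theorem codeEntropy_eliminate [DecidableEq C] {A : Matrix C V (ZMod 2)} {a : C} {i : V}
    (hi : A a i ≠ 0) {J : Finset V} (hJ : ∀ j, j ∈ J ↔ A a j ≠ 0 ∧ j ≠ i)
    (hleaf : ∀ j ∈ J, ∀ b ≠ a, A b j = 0) {c : V → LDensity} (hc : ∀ v, (c v).IsSymm) :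
    codeEntropy A c + (LDensity.bigCheckConv J c).lentropy =
      codeEntropy (A.updateRow a 0) (Function.update c i
        (LDensity.varConv (c i) (LDensity.bigCheckConv J c))) := by
  have hiJ : i ∉ J := fun h => ((hJ i).1 h).2 rfl
  have hcol : ∀ j ∈ J, ∀ b, A.updateRow a 0 b j = 0 := fun j hj b => by
    by_cases hb : b = a
    · simp [hb]
    · rw [Matrix.updateRow_ne hb]; exact hleaf j hj b hb
  have hp : ∀ x, 1 + expNeg x ≠ 0 := fun x => by have := expNeg_nonneg x; positivity
  -- Setting the leaves to `⊤` gives them weight 0 and makes `Φ` independent of `J`, as the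
  -- absorption step requires.
  set Φ : (V → EReal) → ℝ := fun l =>
    logPartition (A.updateRow a 0) fun v => if v ∈ J then ⊤ else l v with hΦ
  have hΦm : Measurable Φ := by
    refine (measurable_logPartition _).comp (measurable_pi_lambda _ fun v => ?_)
    split_ifs
    · exact measurable_const
    · exact measurable_pi_apply v
  have hΦJ : ∀ j ∈ J, ∀ l t, Φ (Function.update l j t) = Φ l := fun j hj l t => by
    simp only [hΦ]
    congr 1
    funext v
    by_cases hv : v = j
    · subst hv; simp [hj]
    · simp [hv]
  have hpt : ∀ l : V → EReal, (∀ v, l v ≠ ⊥) →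
      logPartition A l + Real.logb 2 (1 + expNeg (bigBoxPlus J l)) =
        Φ (Function.update l i (l i + bigBoxPlus J l)) +
          ∑ j ∈ J, Real.logb 2 (1 + expNeg (l j)) := by
    intro l hl
    have h1 := one_le_partitionFunction A fun v => expNeg_nonneg (l v)
    have h2 := one_le_partitionFunction (A.updateRow a 0) fun v =>
      expNeg_nonneg (if v ∈ J then ⊤ else Function.update l i (l i + bigBoxPlus J l) v)
    have h3 := partitionFunction_eliminate hi hJ hleaf (fun v => expNeg (l v))
      (expNeg_bigBoxPlus (J := J) fun j _ => hl j)
    simp only [hΦ, logPartition]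
    rw [← Real.logb_prod _ _ fun j _ => hp _, ← Real.logb_mul (by positivity) (hp _),
      ← Real.logb_mul (by positivity) (Finset.prod_ne_zero_iff.2 fun j _ => hp _), h3]
    congr 3
    funext v
    by_cases hv : v = i
    · subst hv; simp [hiJ, expNeg_add]
    · by_cases hvJ : v ∈ J <;> simp [hv, hvJ]
  have hm : ∀ j, Measurable fun l : V → EReal =>
      ENNReal.ofReal (Real.logb 2 (1 + expNeg (l j))) := fun j =>
    measurable_logb_one_add_expNeg.ennreal_ofReal.comp (measurable_pi_apply j)
  have hmb : Measurable fun l : V → EReal =>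
      ENNReal.ofReal (Real.logb 2 (1 + expNeg (bigBoxPlus J l))) :=
    measurable_logb_one_add_expNeg.ennreal_ofReal.comp (measurable_bigBoxPlus J)
  have e1 : ∫⁻ l, (ENNReal.ofReal (logPartition A l) +
      ENNReal.ofReal (Real.logb 2 (1 + expNeg (bigBoxPlus J l)))) ∂llrLaw c =
      ∫⁻ l, (ENNReal.ofReal (Φ (Function.update l i (l i + bigBoxPlus J l))) +
        ∑ j ∈ J, ENNReal.ofReal (Real.logb 2 (1 + expNeg (l j)))) ∂llrLaw c := by
    refine lintegral_congr_ae ?_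
    filter_upwards [ae_ne_bot_llrLaw hc] with l hl
    rw [← ENNReal.ofReal_add (logPartition_nonneg _ _) (logb_one_add_expNeg_nonneg _), hpt l hl,
      ENNReal.ofReal_add (logPartition_nonneg _ _)
        (Finset.sum_nonneg fun j _ => logb_one_add_expNeg_nonneg _),
      ENNReal.ofReal_sum_of_nonneg fun j _ => logb_one_add_expNeg_nonneg _]
  rw [lintegral_add_right _ hmb, lintegral_add_right _ (Finset.measurable_sum _ fun j _ => hm j),
    lintegral_finsetSum _ fun j _ => hm j,
    lintegral_update_add_bigBoxPlus c i (F := fun l => ENNReal.ofReal (Φ l)) hΦm.ennreal_ofReal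
      (fun j hj l t => by rw [hΦJ j hj]) hiJ] at e1
  have e2 := lintegral_bigBoxPlus c J
    (K := fun _ z => ENNReal.ofReal (Real.logb 2 (1 + expNeg z)))
    (measurable_logb_one_add_expNeg.ennreal_ofReal.comp measurable_snd) fun _ _ _ _ _ => rfl
  rw [lintegral_const, measure_univ, mul_one] at e2
  rw [e2] at e1
  rw [codeEntropy_of_cols_eq_zero hcol]
  refine e1.trans ?_
  congr 1
  refine Finset.sum_congr rfl fun j hj => ?_
  have hji : j ≠ i := fun h => hiJ (h ▸ hj)
  rw [Function.update_of_ne hji]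
  exact lintegral_llrLaw_eval c j measurable_logb_one_add_expNeg.ennreal_ofReal

end

/-! ### The Bethe formula at a fixed point -/

section

variable [Fintype V] [Fintype C] [DecidableEq V] [DecidableEq C]
  {A : Matrix C V (ZMod 2)} {c : V → LDensity} {m : Messages V C}

open LDensity

theorem varNbrs_updateRow (a : C) (v : V) :
    varNbrs (A.updateRow a 0) v = (varNbrs A v).erase a := by
  ext b
  by_cases hb : b = a <;> simp [hb]

theorem checkNbrs_updateRow_self (a : C) : checkNbrs (A.updateRow a 0) a = ∅ := by
  ext v; simp

theorem checkNbrs_updateRow_of_ne {a b : C} (hb : b ≠ a) :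
    checkNbrs (A.updateRow a 0) b = checkNbrs A b := by
  ext v; simp [hb]

theorem factorGraph_updateRow_le (a : C) : factorGraph (A.updateRow a 0) ≤ factorGraph A := by
  have : ∀ b v, A.updateRow a 0 b v ≠ 0 → A b v ≠ 0 := fun b v h => by
    by_cases hb : b = a
    · simp [hb] at h
    · rwa [Matrix.updateRow_ne hb] at h
  rintro (i | b) (j | d) h
  · exact h
  · exact this _ _ h
  · exact this _ _ h
  · exact h

/-- At a fixed point the posterior at a neighbour v of `a` is the convolution of the two messages on
(v,a), so it cancels against the term of that edge. In the reduced graph the posterior at j ≠ i is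
the old message j → a, which cancels against its own entropy term, while the posterior at `i` is
unchanged. What remains is the duality rule for the two messages on (i,a). -/
theorem betheEntropy_eliminate (hm : m.IsSymm) (hfix : ∀ e, Settled A c m e)
    {a : C} {i : V} (hi : A a i ≠ 0) :
    betheEntropy A c m + (m.checkToVar a i).entropy =
      betheEntropy (A.updateRow a 0) (Function.update c i (varConv (c i) (m.checkToVar a i))) m := by
  set A' := A.updateRow a 0
  set c' := Function.update c i (varConv (c i) (m.checkToVar a i))
  have hvar : ∀ v b, A b v ≠ 0 → m.varToCheck v b = varUpdate A c m v b := fun v b h =>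
    hfix (.varToCheck v b h)
  have hy : m.checkToVar a i = checkUpdate A m a i := hfix (.checkToVar a i hi)
  set e : V → ℝ := fun v =>
    (varConv (c' v) (bigVarConv ((varNbrs A v).erase a) fun b => m.checkToVar b v)).entropy with he
  have hei : e i = (varConv (m.varToCheck i a) (m.checkToVar a i)).entropy := by
    simp only [he, c', Function.update_self]
    rw [hvar i a hi, varUpdate, varConv_assoc, varConv_assoc, varConv_comm (m.checkToVar a i)]
  have hej : ∀ j ∈ (checkNbrs A a).erase i, e j = (m.varToCheck j a).entropy := fun j hj => by
    have h1 := Finset.ne_of_mem_erase hj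
    have h2 := mem_checkNbrs.1 (Finset.mem_of_mem_erase hj)
    simp only [he, c', Function.update_of_ne h1]
    rw [hvar j a h2, varUpdate]
  have hD : ∀ v, (varConv (c v) (bigVarConv (varNbrs A v) fun b => m.checkToVar b v)).entropy -
      ∑ b ∈ varNbrs A v, (varConv (m.varToCheck v b) (m.checkToVar b v)).entropy =
      (varConv (c' v) (bigVarConv (varNbrs A' v) fun b => m.checkToVar b v)).entropy -
      ∑ b ∈ varNbrs A' v, (varConv (m.varToCheck v b) (m.checkToVar b v)).entropy -
      if v ∈ checkNbrs A a then e v else 0 := by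
    intro v
    rw [varNbrs_updateRow]
    by_cases hv : A a v = 0
    · have h1 : v ∉ checkNbrs A a := by simp [hv]
      have h2 : a ∉ varNbrs A v := by simp [hv]
      have h3 : v ≠ i := fun h => hi (h ▸ hv)
      rw [if_neg h1, Finset.erase_eq_of_notMem h2, sub_zero]
      simp only [c', Function.update_of_ne h3]
    · rw [if_pos (mem_checkNbrs.2 hv), ← Finset.add_sum_erase _ _ (mem_varNbrs.2 hv),
        posterior_eq_varConv_varUpdate hv, ← hvar v a hv]
      simp only [he]
      ring
  have hDsum := Finset.sum_congr (s₁ := Finset.univ) rfl fun v _ => hD v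
  simp only [Finset.sum_sub_distrib] at hDsum
  rw [Finset.sum_ite_mem, Finset.univ_inter, ← Finset.add_sum_erase _ _ (mem_checkNbrs.2 hi), hei,
    Finset.sum_congr rfl hej] at hDsum
  have hT2 := sum_eq_sum_add_sub (Finset.mem_univ a)
    (g := fun b => ∑ v ∈ checkNbrs A b, (m.varToCheck v b).entropy)
    (f := fun b => ∑ v ∈ checkNbrs A' b, (m.varToCheck v b).entropy)
    (fun b _ hb => by rw [checkNbrs_updateRow_of_ne hb])
  have hT3 := sum_eq_sum_add_sub (Finset.mem_univ a)
    (g := fun b => (bigCheckConv (checkNbrs A b) fun v => m.varToCheck v b).entropy)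
    (f := fun b => (bigCheckConv (checkNbrs A' b) fun v => m.varToCheck v b).entropy)
    (fun b _ hb => by simp only [A', checkNbrs_updateRow_of_ne hb])
  rw [checkNbrs_updateRow_self, Finset.sum_empty, sub_zero,
    ← Finset.add_sum_erase _ _ (mem_checkNbrs.2 hi)] at hT2
  have h0 : (bigCheckConv (∅ : Finset V) fun v => m.varToCheck v a).entropy = 0 :=
    entropy_deltaTop
  simp only [A', checkNbrs_updateRow_self] at hT3
  rw [h0, sub_zero, bigCheckConv_eq_checkConv_checkUpdate hi, ← hy] at hT3
  have hdual := (hm.varToCheck i a).entropy_varConv_add_checkConv (hm.checkToVar a i)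
  rw [betheEntropy, betheEntropy, hT2, hT3]
  linarith

/-- At `i` the message from `a` has merely moved from the convolution into the channel density. Any
other variable that still has an edge is not adjacent to `a`, by the leaf condition. -/
theorem settled_eliminate (hfix : ∀ e, Settled A c m e) {a : C} {i : V} (hi : A a i ≠ 0)
    (hleaf : ∀ j ≠ i, A a j ≠ 0 → ∀ b ≠ a, A b j = 0) (e : DirectedEdge (A.updateRow a 0)) :
    Settled (A.updateRow a 0) (Function.update c i (varConv (c i) (m.checkToVar a i))) m e := by
  have hne : ∀ {b v}, A.updateRow a 0 b v ≠ 0 → b ≠ a ∧ A b v ≠ 0 := fun {b v} h => by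
    by_cases hb : b = a
    · simp [hb] at h
    · rw [Matrix.updateRow_ne hb] at h; exact ⟨hb, h⟩
  cases e with
  | checkToVar b v h =>
    obtain ⟨hb, h'⟩ := hne h
    rw [Settled, checkUpdate, checkNbrs_updateRow_of_ne hb]
    exact hfix (.checkToVar b v h')
  | varToCheck v b h =>
    obtain ⟨hb, h'⟩ := hne h
    have hold : m.varToCheck v b = varUpdate A c m v b := hfix (.varToCheck v b h')
    rw [Settled, hold, varUpdate, varUpdate, varNbrs_updateRow]
    by_cases hv : v = i
    · subst hv
      have hmem : a ∈ (varNbrs A v).erase b := by simp [hi, hb.symm]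
      rw [Function.update_self, bigVarConv_eq_erase _ hmem, Finset.erase_right_comm, varConv_assoc,
        varConv_comm (m.checkToVar a v)]
    · rw [Function.update_of_ne hv, Finset.erase_eq_of_notMem (a := a)]
      intro hmem
      exact h' (hleaf v hv (mem_varNbrs.1 hmem) b hb)

theorem betheEntropy_zero : betheEntropy (0 : Matrix C V (ZMod 2)) c m = ∑ v, (c v).entropy := by
  have h1 : ∀ v, varNbrs (0 : Matrix C V (ZMod 2)) v = ∅ := fun v => by ext; simp
  have h2 : ∀ a, checkNbrs (0 : Matrix C V (ZMod 2)) a = ∅ := fun v => by ext; simp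
  have h3 : ∀ f : C → LDensity, bigVarConv ∅ f = deltaZero := fun _ => rfl
  have h4 : ∀ f : V → LDensity, bigCheckConv ∅ f = deltaTop := fun _ => rfl
  simp [betheEntropy, h1, h2, h3, h4, varConv_deltaZero, entropy_deltaTop]

/-- At a fixed point of density evolution on a cycle-free factor graph, the Bethe formula computes
the entropy of the code. -/
theorem codeEntropy_eq_betheEntropy (hA : (factorGraph A).IsAcyclic) (hc : ∀ v, (c v).IsSymm)
    (hm : m.IsSymm) (hfix : ∀ e, Settled A c m e) :
    codeEntropy A c ≠ ⊤ ∧ (codeEntropy A c).toReal = betheEntropy A c m := by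
  classical
  induction hn : (Finset.univ.filter fun a => A a ≠ 0).card using Nat.strong_induction_on
    generalizing A c with
  | _ n ih =>
    by_cases h0 : A = 0
    · subst h0
      have h1 : ∑ v, (c v).lentropy = ENNReal.ofReal (∑ v, (c v).entropy) := by
        rw [ENNReal.ofReal_sum_of_nonneg fun v _ => (c v).entropy_nonneg]
        exact Finset.sum_congr rfl fun v _ => (hc v).lentropy_eq
      rw [codeEntropy_zero, h1, betheEntropy_zero]
      exact ⟨ENNReal.ofReal_ne_top,
        ENNReal.toReal_ofReal (Finset.sum_nonneg fun v _ => (c v).entropy_nonneg)⟩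
    · obtain ⟨a, i, hi, hleaf⟩ := exists_leaf_check hA h0
      have hJ : ∀ j, j ∈ (checkNbrs A a).erase i ↔ A a j ≠ 0 ∧ j ≠ i := fun j => by
        simp [and_comm]
      -- The other neighbours of `a` are leaves, so their messages to `a` are just their channel
      -- densities.
      have hy : m.checkToVar a i = bigCheckConv ((checkNbrs A a).erase i) c := by
        have h1 : m.checkToVar a i = checkUpdate A m a i := hfix (.checkToVar a i hi)
        rw [h1, checkUpdate]
        refine bigCheckConv_congr fun j hj => ?_
        obtain ⟨h2, h3⟩ := (hJ j).1 hj
        have h4 : m.varToCheck j a = varUpdate A c m j a := hfix (.varToCheck j a h2)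
        have h5 : (varNbrs A j).erase a = ∅ := by
          ext b
          simp only [Finset.mem_erase, mem_varNbrs, Finset.notMem_empty, iff_false, not_and, not_not]
          exact hleaf j h3 h2 b
        rw [h4, varUpdate, h5]
        exact varConv_deltaZero _
      have hel := codeEntropy_eliminate hi hJ
        (fun j hj b hb => hleaf j ((hJ j).1 hj).2 ((hJ j).1 hj).1 b hb) hc
      rw [← hy] at hel
      have hlt : (Finset.univ.filter fun b => A.updateRow a 0 b ≠ 0).card < n := by
        rw [← hn]
        refine Finset.card_lt_card ⟨fun b hb => ?_, fun hsub => ?_⟩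
        · by_cases hba : b = a
          · simp [hba] at hb
          · simpa [Matrix.updateRow_ne hba] using hb
        · have ha : a ∈ Finset.univ.filter fun b => A b ≠ 0 := by
            simp only [Finset.mem_filter, Finset.mem_univ, true_and]
            exact fun h => hi (congrFun h i)
          simpa using hsub ha
      have hc' : ∀ v, (Function.update c i (varConv (c i) (m.checkToVar a i)) v).IsSymm := fun v => by
        by_cases hv : v = i
        · subst hv; simpa using (hc v).varConv (hm.checkToVar a v)
        · simpa [hv] using hc v
      obtain ⟨f1, f2⟩ := ih _ hlt (hA.anti (factorGraph_updateRow_le a)) hc'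
        (settled_eliminate hfix hi hleaf) rfl
      have hb := betheEntropy_eliminate hm hfix hi
      rw [← hel] at f1 f2
      -- Finiteness is inherited from the reduced code, whose entropy dominates.
      obtain ⟨g1, g2⟩ := ENNReal.add_ne_top.1 f1
      refine ⟨g1, ?_⟩
      rw [ENNReal.toReal_add g1 g2, (hm.checkToVar a i).lentropy_eq,
        ENNReal.toReal_ofReal (entropy_nonneg _)] at f2
      linarith

end

/-! ### Log-likelihood ratios of symmetric channels -/

namespace BMSChannel

variable {Y : Type*} [MeasurableSpace Y] (W : BMSChannel Y)

/-- The reference measure with respect to which the posterior probabilities are densities. -/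
def refMeasure : Measure Y := W.law 0 + W.law 1

instance : IsFiniteMeasure W.refMeasure := by unfold refMeasure; infer_instance

theorem law_ac_refMeasure (b : ZMod 2) : W.law b ≪ W.refMeasure := by
  have : ∀ b : ZMod 2, b = 0 ∨ b = 1 := by decide
  rcases this b with rfl | rfl
  · exact Measure.AbsolutelyContinuous.rfl.add_right _
  · rw [refMeasure, add_comm]; exact Measure.AbsolutelyContinuous.rfl.add_right _

theorem measurable_bitPosterior (b : ZMod 2) : Measurable (W.bitPosterior b) :=
  Measure.measurable_rnDeriv _ _

theorem withDensity_bitPosterior (b : ZMod 2) :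
    W.refMeasure.withDensity (W.bitPosterior b) = W.law b :=
  Measure.withDensity_rnDeriv_eq _ _ (W.law_ac_refMeasure b)

theorem lintegral_law (b : ZMod 2) {f : Y → ENNReal} (hf : Measurable f) :
    ∫⁻ y, f y ∂W.law b = ∫⁻ y, W.bitPosterior b y * f y ∂W.refMeasure := by
  rw [← withDensity_bitPosterior,
    lintegral_withDensity_eq_lintegral_mul _ (W.measurable_bitPosterior b) hf]
  rfl

theorem bitPosterior_add : ∀ᵐ y ∂W.refMeasure, W.bitPosterior 0 y + W.bitPosterior 1 y = 1 := by
  have h1 := Measure.rnDeriv_add' (W.law 0) (W.law 1) W.refMeasure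
  have h2 := Measure.rnDeriv_self W.refMeasure
  filter_upwards [h1, h2] with y h1 h2
  exact h1.symm.trans h2

theorem bitPosterior_ne_top (b : ZMod 2) : ∀ᵐ y ∂W.refMeasure, W.bitPosterior b y ≠ ⊤ := by
  filter_upwards [Measure.rnDeriv_lt_top (W.law b) W.refMeasure] with y hy using hy.ne

theorem bitPosterior_ne_zero (b : ZMod 2) : ∀ᵐ y ∂W.law b, W.bitPosterior b y ≠ 0 := by
  filter_upwards [Measure.rnDeriv_pos (W.law_ac_refMeasure b)] with y hy using hy.ne'

/-- The symmetry of the channel, in terms of posterior probabilities. -/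
theorem exists_flip : ∃ π : Y → Y, Measurable π ∧ W.law 1 = (W.law 0).map π ∧
    W.refMeasure.map π = W.refMeasure ∧
    ∀ᵐ y ∂W.refMeasure, W.bitPosterior 0 (π y) = W.bitPosterior 1 y ∧
      W.bitPosterior 1 (π y) = W.bitPosterior 0 y := by
  obtain ⟨π, hπ, hinv, h1⟩ := W.symmetric
  have h0 : W.law 0 = (W.law 1).map π := by
    rw [h1, Measure.map_map hπ hπ, hinv.comp_self, Measure.map_id]
  have href : W.refMeasure.map π = W.refMeasure := by
    rw [refMeasure, Measure.map_add _ _ hπ, ← h1, ← h0, add_comm]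
  let e : Y ≃ᵐ Y := ⟨hinv.toPerm π, hπ, hπ⟩
  have he : MeasurableEmbedding π := e.measurableEmbedding
  have r0 := he.rnDeriv_map (W.law 1) W.refMeasure
  have r1 := he.rnDeriv_map (W.law 0) W.refMeasure
  rw [← h0, href] at r0
  rw [← h1, href] at r1
  refine ⟨π, hπ, h1, href, ?_⟩
  filter_upwards [r0, r1] with y h0 h1 using ⟨h0, h1⟩

theorem expNeg_llr {y : Y} (h : W.bitPosterior 0 y ≠ 0) (h' : W.bitPosterior 0 y ≠ ⊤) :
    expNeg (W.llr y) = (W.bitPosterior 1 y / W.bitPosterior 0 y).toReal := by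
  rw [expNeg, llr, ← ENNReal.log_inv, ENNReal.exp_log, ENNReal.inv_div (Or.inr h') (Or.inr h)]

theorem expNeg_neg_llr (y : Y) :
    expNeg (-W.llr y) = (W.bitPosterior 0 y / W.bitPosterior 1 y).toReal := by
  rw [expNeg, neg_neg, llr, ENNReal.exp_log]

theorem bitProb_tanhHalf_llr {y : Y} (h : W.bitPosterior 0 y + W.bitPosterior 1 y = 1) :
    bitProb (tanhHalf (W.llr y)) = W.bitPosterior 0 y ∧
      bitProb (-tanhHalf (W.llr y)) = W.bitPosterior 1 y := by
  have ht0 : W.bitPosterior 0 y ≠ ⊤ := fun h' => by simp [h'] at h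
  have ht1 : W.bitPosterior 1 y ≠ ⊤ := fun h' => by simp [h'] at h
  have h0 : bitProb (tanhHalf (W.llr y)) = W.bitPosterior 0 y := by
    by_cases hz : W.bitPosterior 0 y = 0
    · have : W.llr y = ⊥ := by simp [llr, hz]
      simp [this, hz, bitProb]
    · have hL : W.llr y ≠ ⊥ := by simp [llr, ENNReal.div_eq_zero_iff, hz, ht1]
      have hr : (W.bitPosterior 0 y).toReal + (W.bitPosterior 1 y).toReal = 1 := by
        rw [← ENNReal.toReal_add ht0 ht1, h, ENNReal.toReal_one]
      have hp : 0 < (W.bitPosterior 0 y).toReal := ENNReal.toReal_pos hz ht0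
      rw [bitProb, one_add_tanhHalf hL, W.expNeg_llr hz ht0, ENNReal.toReal_div]
      have : 2 / (1 + (W.bitPosterior 1 y).toReal / (W.bitPosterior 0 y).toReal) / 2 =
          (W.bitPosterior 0 y).toReal := by
        have : 1 + (W.bitPosterior 1 y).toReal / (W.bitPosterior 0 y).toReal =
          1 / (W.bitPosterior 0 y).toReal := by
          rw [eq_div_iff hp.ne', add_mul, one_mul, div_mul_cancel₀ _ hp.ne', hr]
        rw [this]
        field_simp
      rw [this, ENNReal.ofReal_toReal ht0]
  refine ⟨h0, ?_⟩
  have h1 := bitProb_add_neg (tanhHalf_mem (W.llr y))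
  rw [h0, ← h] at h1
  exact (ENNReal.add_right_inj ht0).1 h1

theorem lintegral_lDensity {f : EReal → ENNReal} (hf : Measurable f) :
    ∫⁻ x, f x ∂(W.lDensity : Measure EReal) = ∫⁻ y, f (W.llr y) ∂W.law 0 :=
  lintegral_map hf W.measurable_llr

theorem llr_flip {y y' : Y} (h : W.bitPosterior 0 y + W.bitPosterior 1 y = 1)
    (h0 : W.bitPosterior 0 y' = W.bitPosterior 1 y)
    (h1 : W.bitPosterior 1 y' = W.bitPosterior 0 y) : W.llr y' = -W.llr y := by
  have ht1 : W.bitPosterior 1 y ≠ ⊤ := fun h' => by simp [h'] at h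
  have hz : W.bitPosterior 1 y ≠ 0 ∨ W.bitPosterior 0 y ≠ 0 := by
    by_contra! hz
    simp [hz.1, hz.2] at h
  rw [llr, llr, h0, h1, ← ENNReal.log_inv, ENNReal.inv_div (Or.inl ht1) hz]

theorem lintegral_refMeasure_flip {π : Y → Y} (hπ : Measurable π)
    (href : W.refMeasure.map π = W.refMeasure) {f : Y → ENNReal} (hf : Measurable f) :
    ∫⁻ y, f (π y) ∂W.refMeasure = ∫⁻ y, f y ∂W.refMeasure := by
  conv_rhs => rw [← href, lintegral_map hf hπ]

/-- The `L`-density of a symmetric channel is symmetric. -/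
theorem isSymm_lDensity : W.lDensity.IsSymm := by
  intro g hg
  obtain ⟨π, hπ, -, href, hflip⟩ := W.exists_flip
  have hθ : Measurable fun y => tanhHalf (W.llr y) := measurable_tanhHalf.comp W.measurable_llr
  have m0 := W.measurable_bitPosterior 0
  have m1 := W.measurable_bitPosterior 1
  have mP := measurable_bitProb
  have mg1 : Measurable fun y => g (tanhHalf (W.llr y)) := hg.comp hθ
  have mg2 : Measurable fun y => g (-tanhHalf (W.llr y)) := hg.comp hθ.neg
  have mt := measurable_tanhHalf
  have k1 : Measurable fun y => W.bitPosterior 0 y * W.bitPosterior 1 y * g (tanhHalf (W.llr y)) :=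
    (m0.mul m1).mul mg1
  have k2 : Measurable fun y =>
      W.bitPosterior 0 y * W.bitPosterior 1 y * g (-tanhHalf (W.llr y)) := (m0.mul m1).mul mg2
  rw [W.lintegral_lDensity (f := fun x => g (tanhHalf x)) (hg.comp mt),
    W.lintegral_lDensity (by fun_prop), W.lintegral_law 0 mg1, W.lintegral_law 0 (by fun_prop)]
  have hneg : ∀ᵐ y ∂W.refMeasure, tanhHalf (W.llr (π y)) = -tanhHalf (W.llr y) := by
    filter_upwards [W.bitPosterior_add, hflip] with y h1 h2
    rw [W.llr_flip h1 h2.1 h2.2]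
    by_cases hb : W.llr y = ⊥
    · simp [hb]
    by_cases ht : W.llr y = ⊤
    · simp [ht]
    lift W.llr y to ℝ using ⟨ht, hb⟩ with r
    have hr := Real.exp_pos r
    rw [← EReal.coe_neg, tanhHalf_coe, tanhHalf_coe, neg_neg, Real.exp_neg]
    field_simp
    ring
  have e1 : ∫⁻ y, W.bitPosterior 0 y * (bitProb (tanhHalf (W.llr y)) * g (tanhHalf (W.llr y)) +
      bitProb (-tanhHalf (W.llr y)) * g (-tanhHalf (W.llr y))) ∂W.refMeasure =
      ∫⁻ y, (W.bitPosterior 0 y * W.bitPosterior 0 y * g (tanhHalf (W.llr y)) +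
        W.bitPosterior 0 y * W.bitPosterior 1 y * g (-tanhHalf (W.llr y))) ∂W.refMeasure := by
    refine lintegral_congr_ae ?_
    filter_upwards [W.bitPosterior_add] with y h
    rw [(W.bitProb_tanhHalf_llr h).1, (W.bitProb_tanhHalf_llr h).2]
    ring
  -- The flip preserves the product of the two posteriors and negates the LLR. Afterwards p₀p₀ +
  -- p₀p₁ = p₀ restores the original density.
  have e2 : ∫⁻ y, W.bitPosterior 0 y * W.bitPosterior 1 y * g (-tanhHalf (W.llr y))
      ∂W.refMeasure =
      ∫⁻ y, W.bitPosterior 0 y * W.bitPosterior 1 y * g (tanhHalf (W.llr y)) ∂W.refMeasure := by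
    rw [← W.lintegral_refMeasure_flip hπ href k1]
    refine lintegral_congr_ae ?_
    filter_upwards [hneg, hflip] with y h1 h2
    rw [h1, h2.1, h2.2, mul_comm (W.bitPosterior 1 y)]
  rw [e1, lintegral_add_right _ k2, e2,
    ← lintegral_add_right _ k1]
  refine lintegral_congr_ae ?_
  filter_upwards [W.bitPosterior_add] with y h
  rw [← add_mul, ← mul_add, h, mul_one]

end BMSChannel

/-- The log-likelihood ratio of the sent against the other bit. -/
def flipLLR (b : ZMod 2) (x : EReal) : EReal := if b = 0 then x else -x

theorem measurable_flipLLR (b : ZMod 2) : Measurable (flipLLR b) := by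
  unfold flipLLR
  split_ifs
  · exact measurable_id
  · exact measurable_neg

namespace BMSChannel

variable {Y : Type*} [MeasurableSpace Y] (W : BMSChannel Y)

/-- Measured in favour of the bit actually sent, the LLR has the same law for both inputs. This
makes the entropy integral independent of the transmitted codeword. -/
theorem map_flipLLR (b : ZMod 2) :
    (W.law b).map (fun y => flipLLR b (W.llr y)) = (W.lDensity : Measure EReal) := by
  have hb : ∀ b : ZMod 2, b = 0 ∨ b = 1 := by decide
  rcases hb b with rfl | rfl
  · rfl
  · obtain ⟨π, hπ, h1, -, hflip⟩ := W.exists_flip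
    have hm : Measurable fun y => flipLLR 1 (W.llr y) :=
      (measurable_flipLLR 1).comp W.measurable_llr
    rw [h1, Measure.map_map hm hπ]
    refine Measure.map_congr ?_
    filter_upwards [(W.law_ac_refMeasure 0).ae_le W.bitPosterior_add,
      (W.law_ac_refMeasure 0).ae_le hflip] with y h2 h3
    simp [flipLLR, W.llr_flip h2 h3.1 h3.2]

theorem expNeg_flipLLR (b : ZMod 2) {y : Y} (h : W.bitPosterior b y ≠ 0)
    (h' : W.bitPosterior b y ≠ ⊤) :
    expNeg (flipLLR b (W.llr y)) = (W.bitPosterior (b + 1) y / W.bitPosterior b y).toReal := by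
  have hb : ∀ b : ZMod 2, b = 0 ∨ b = 1 := by decide
  rcases hb b with rfl | rfl
  · rw [flipLLR, if_pos rfl, W.expNeg_llr h h', zero_add]
  · rw [flipLLR, if_neg one_ne_zero, W.expNeg_neg_llr, show (1 + 1 : ZMod 2) = 0 by decide]

end BMSChannel

/-! ### Densities on finite products -/

section

variable [Fintype V] [DecidableEq V]

theorem lmarginal_prod {X : V → Type*} [∀ v, MeasurableSpace (X v)] (ν : ∀ v, Measure (X v))
    [∀ v, SigmaFinite (ν v)] {g : ∀ v, X v → ENNReal} (hg : ∀ v, Measurable (g v)) (s : Finset V)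
    (y : ∀ v, X v) :
    lmarginal ν s (fun y => ∏ v, g v (y v)) y =
      ∏ v, if v ∈ s then ∫⁻ t, g v t ∂ν v else g v (y v) := by
  have hm : Measurable fun y : ∀ v, X v => ∏ v, g v (y v) :=
    Finset.measurable_prod _ fun v _ => (hg v).comp (measurable_pi_apply v)
  induction s using Finset.induction_on generalizing y with
  | empty => simp
  | insert i s hi ih =>
    rw [lmarginal_insert _ hm hi]
    have h1 : ∀ t, (∏ v, if v ∈ s then ∫⁻ t, g v t ∂ν v else g v (Function.update y i t v)) =
        g i t * ∏ v ∈ Finset.univ.erase i, if v ∈ s then ∫⁻ t, g v t ∂ν v else g v (y v) := by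
      intro t
      rw [← Finset.mul_prod_erase _ _ (Finset.mem_univ i), if_neg hi, Function.update_self]
      congr 1
      refine Finset.prod_congr rfl fun v hv => ?_
      rw [Function.update_of_ne (Finset.ne_of_mem_erase hv)]
    simp only [ih, h1]
    rw [lintegral_mul_const _ (hg i), ← Finset.mul_prod_erase _ _ (Finset.mem_univ i),
      if_pos (Finset.mem_insert_self i s)]
    congr 1
    refine Finset.prod_congr rfl fun v hv => ?_
    simp [Finset.ne_of_mem_erase hv]

theorem lintegral_pi_prod {X : V → Type*} [∀ v, MeasurableSpace (X v)] (ν : ∀ v, Measure (X v))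
    [∀ v, SigmaFinite (ν v)] {g : ∀ v, X v → ENNReal} (hg : ∀ v, Measurable (g v)) :
    ∫⁻ y, ∏ v, g v (y v) ∂Measure.pi ν = ∏ v, ∫⁻ t, g v t ∂ν v := by
  by_cases h : Nonempty (∀ v, X v)
  · obtain ⟨y⟩ := h
    rw [lintegral_eq_lmarginal_univ y, lmarginal_prod ν hg]
    simp
  · have : IsEmpty (∀ v, X v) := not_nonempty_iff.1 h
    obtain ⟨v, hv⟩ := isEmpty_pi.1 this
    rw [lintegral_of_isEmpty, Finset.prod_eq_zero (Finset.mem_univ v) (lintegral_of_isEmpty _ _)]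

theorem pi_withDensity {X : V → Type*} [∀ v, MeasurableSpace (X v)] (μ ν : ∀ v, Measure (X v))
    [∀ v, SigmaFinite (μ v)] [∀ v, SigmaFinite (ν v)] {f : ∀ v, X v → ENNReal}
    (hf : ∀ v, Measurable (f v)) (h : ∀ v, (ν v).withDensity (f v) = μ v) :
    (Measure.pi ν).withDensity (fun y => ∏ v, f v (y v)) = Measure.pi μ := by
  refine (Measure.pi_eq fun s hs => ?_).symm
  have hms : MeasurableSet (Set.univ.pi s) := MeasurableSet.univ_pi hs
  rw [withDensity_apply _ hms, ← lintegral_indicator hms]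
  have h1 : ∀ y, (Set.univ.pi s).indicator (fun y => ∏ v, f v (y v)) y =
      ∏ v, (s v).indicator (f v) (y v) := by
    intro y
    by_cases hy : y ∈ Set.univ.pi s
    · rw [Set.indicator_of_mem hy]
      exact Finset.prod_congr rfl fun v _ => (Set.indicator_of_mem (hy v trivial) _).symm
    · rw [Set.indicator_of_notMem hy]
      simp only [Set.mem_univ_pi, not_forall] at hy
      obtain ⟨v, hv⟩ := hy
      exact (Finset.prod_eq_zero (Finset.mem_univ v) (Set.indicator_of_notMem hv _)).symm
  simp only [h1]
  rw [lintegral_pi_prod ν fun v => (hf v).indicator (hs v)]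
  refine Finset.prod_congr rfl fun v _ => ?_
  rw [lintegral_indicator (hs v), ← withDensity_apply _ (hs v), h v]

/-! ### The posterior of a uniformly distributed codeword -/

open Classical in
/-- The finite set of codewords. -/
def codewords (A : Matrix C V (ZMod 2)) : Finset (V → ZMod 2) :=
  Finset.univ.filter fun x => A.mulVec x = 0

theorem mem_codewords {A : Matrix C V (ZMod 2)} {x : V → ZMod 2} :
    x ∈ codewords A ↔ A.mulVec x = 0 := by simp [codewords]

theorem coe_binaryCode (A : Matrix C V (ZMod 2)) :
    (binaryCode A : Set (V → ZMod 2)) = codewords A := by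
  ext x
  simp [binaryCode, codewords]

theorem codewords_card_ne_zero (A : Matrix C V (ZMod 2)) :
    ((codewords A).card : ENNReal) ≠ 0 := by
  have : (0 : V → ZMod 2) ∈ codewords A := by simp [mem_codewords]
  simpa using Finset.ne_empty_of_mem this

open Classical in
theorem codewordLaw_singleton (A : Matrix C V (ZMod 2)) (x : V → ZMod 2) :
    codewordLaw A {x} = if x ∈ codewords A then ((codewords A).card : ENNReal)⁻¹ else 0 := by
  rw [codewordLaw, uniformOn, cond_apply (MeasurableSet.of_discrete), coe_binaryCode,
    Measure.count_apply_finset]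
  split_ifs with h
  · rw [Set.inter_eq_right.2 (by simpa using h), Measure.count_singleton, mul_one]
  · have : (codewords A : Set (V → ZMod 2)) ∩ {x} = ∅ := by
      ext z
      simp only [Set.mem_inter_iff, Finset.mem_coe, Set.mem_singleton_iff, Set.mem_empty_iff_false,
        iff_false, not_and]
      rintro hz rfl
      exact h hz
    rw [this, measure_empty, mul_zero]

variable {Y : Type*} [MeasurableSpace Y] (A : Matrix C V (ZMod 2)) (W : V → BMSChannel Y)

/-- The likelihood of the output `y` given the input word `x`. -/
def likelihood (x : V → ZMod 2) (y : V → Y) : ENNReal := ∏ v, (W v).bitPosterior (x v) (y v)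

/-- The reference measure on output words. -/
abbrev outputRef : Measure (V → Y) := Measure.pi fun v => (W v).refMeasure

/-- The law of the output. -/
abbrev outputLaw : Measure (V → Y) := (codewordLaw A).bind (channelKernel W)

theorem measurable_likelihood (x : V → ZMod 2) : Measurable (likelihood W x) :=
  Finset.measurable_prod _ fun v _ =>
    ((W v).measurable_bitPosterior (x v)).comp (measurable_pi_apply v)

theorem channelKernel_apply (x : V → ZMod 2) :
    channelKernel W x = Measure.pi fun v => (W v).law (x v) := rfl

theorem withDensity_likelihood (x : V → ZMod 2) :
    (outputRef W).withDensity (likelihood W x) = channelKernel W x :=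
  pi_withDensity _ _ (fun v => (W v).measurable_bitPosterior (x v))
    fun v => (W v).withDensity_bitPosterior (x v)

/-- The density of the output law. -/
def outputDensity (y : V → Y) : ENNReal :=
  ((codewords A).card : ENNReal)⁻¹ * ∑ x ∈ codewords A, likelihood W x y

theorem measurable_outputDensity : Measurable (outputDensity A W) :=
  (Finset.measurable_sum _ fun x _ => measurable_likelihood W x).const_mul _

theorem outputLaw_eq : outputLaw A W = (outputRef W).withDensity (outputDensity A W) := by
  ext s hs
  have hm : Measurable fun y => ∑ x ∈ codewords A, likelihood W x y :=
    Finset.measurable_sum _ fun x _ => measurable_likelihood W x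
  rw [Measure.bind_apply hs (channelKernel W).measurable.aemeasurable, lintegral_fintype,
    withDensity_apply _ hs]
  simp only [outputDensity, codewordLaw_singleton, mul_ite, mul_zero]
  rw [Finset.sum_ite_mem, Finset.univ_inter, lintegral_const_mul _ hm,
    lintegral_finsetSum _ fun x _ => measurable_likelihood W x, Finset.mul_sum]
  refine Finset.sum_congr rfl fun x _ => ?_
  rw [← withDensity_likelihood, withDensity_apply _ hs, mul_comm]

theorem ae_likelihood_ne_top : ∀ᵐ y ∂outputRef W, ∀ x, likelihood W x y ≠ ⊤ := by
  have h : ∀ᵐ y ∂outputRef W, ∀ v b, (W v).bitPosterior b (y v) ≠ ⊤ := by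
    rw [ae_all_iff]
    intro v
    have := Filter.eventually_all.2 fun b => (W v).bitPosterior_ne_top b
    exact (Measure.quasiMeasurePreserving_eval (fun v => (W v).refMeasure) v).ae this
  filter_upwards [h] with y hy x
  exact ENNReal.prod_ne_top fun v _ => hy v _

/-- This identifies the Radon–Nikodym derivative entering the posterior. The quotient is harmless:
the output density is a.e. finite and vanishes only where the likelihoods of all codewords do. -/
theorem withDensity_div_outputDensity {x : V → ZMod 2} (hx : x ∈ codewords A) :
    (outputLaw A W).withDensity (fun y => likelihood W x y / outputDensity A W y) =
      channelKernel W x := by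
  have hd : Measurable fun y => likelihood W x y / outputDensity A W y :=
    (measurable_likelihood W x).div (measurable_outputDensity A W)
  rw [outputLaw_eq, ← withDensity_mul _ (measurable_outputDensity A W) hd,
    ← withDensity_likelihood]
  refine withDensity_congr_ae ?_
  filter_upwards [ae_likelihood_ne_top W] with y hy
  have hN := codewords_card_ne_zero A
  rw [Pi.mul_apply]
  refine ENNReal.mul_div_cancel' (fun h0 => ?_) fun htop => ?_
  · rw [outputDensity, mul_eq_zero, Finset.sum_eq_zero_iff] at h0
    rcases h0 with h0 | h0
    · simp at h0
    · exact h0 x hx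
  · refine absurd htop (ENNReal.mul_ne_top (ENNReal.inv_ne_top.2 hN) ?_)
    exact (ENNReal.sum_lt_top.2 fun x _ => (hy x).lt_top).ne

theorem channelKernel_ac {x : V → ZMod 2} (hx : x ∈ codewords A) :
    channelKernel W x ≪ outputLaw A W := by
  rw [← withDensity_div_outputDensity A W hx]
  exact withDensity_absolutelyContinuous _ _

theorem rnDeriv_channelKernel {x : V → ZMod 2} (hx : x ∈ codewords A) :
    (channelKernel W x).rnDeriv (outputLaw A W) =ᵐ[outputLaw A W]
      fun y => likelihood W x y / outputDensity A W y := by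
  conv_lhs => rw [← withDensity_div_outputDensity A W hx]
  exact Measure.rnDeriv_withDensity _
    ((measurable_likelihood W x).div (measurable_outputDensity A W))

/-- The posterior probability of the sent codeword, in terms of the partition function. -/
theorem ae_posterior_eq {x : V → ZMod 2} (hx : x ∈ codewords A) :
    ∀ᵐ y ∂channelKernel W x, (((codewords A).card : ENNReal)⁻¹ *
      (channelKernel W x).rnDeriv (outputLaw A W) y).toReal =
        (partitionFunction A fun v => expNeg (flipLLR (x v) ((W v).llr (y v))))⁻¹ := by
  have h1 : ∀ᵐ y ∂channelKernel W x, ∀ v, (W v).bitPosterior (x v) (y v) ≠ 0 ∧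
      ∀ b, (W v).bitPosterior b (y v) ≠ ⊤ := by
    rw [ae_all_iff]
    intro v
    have h2 := ((W v).law_ac_refMeasure (x v)).ae_le
      (Filter.eventually_all.2 fun b => (W v).bitPosterior_ne_top b)
    exact (Measure.quasiMeasurePreserving_eval (fun v => (W v).law (x v)) v).ae
      (((W v).bitPosterior_ne_zero (x v)).and h2)
  filter_upwards [h1, (channelKernel_ac A W hx).ae_le (rnDeriv_channelKernel A W hx)] with y hy hd
  have hN := codewords_card_ne_zero A
  have hNt : ((codewords A).card : ENNReal) ≠ ⊤ := ENNReal.natCast_ne_top _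
  have hpos : ∀ v, 0 < ((W v).bitPosterior (x v) (y v)).toReal := fun v =>
    ENNReal.toReal_pos (hy v).1 ((hy v).2 _)
  have hl : ∀ z, likelihood W z y ≠ ⊤ := fun z => ENNReal.prod_ne_top fun v _ => (hy v).2 _
  have hz : ∀ z : V → ZMod 2, (likelihood W z y).toReal =
      ∏ v, ((W v).bitPosterior (z v) (y v)).toReal := fun z => ENNReal.toReal_prod _ _
  have hxx : x + x = 0 := funext fun v => CharTwo.add_self_eq_zero (x v)
  have hxpos : 0 < (likelihood W x y).toReal := by
    rw [hz]; exact Finset.prod_pos fun v _ => hpos v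
  have hS : (∑ z ∈ codewords A, likelihood W z y).toReal = (likelihood W x y).toReal *
      partitionFunction A fun v => expNeg (flipLLR (x v) ((W v).llr (y v))) := by
    rw [ENNReal.toReal_sum fun z _ => hl z, partitionFunction, ← Finset.sum_filter, Finset.mul_sum]
    -- By linearity, translation by `x` permutes the codewords, and the likelihood ratio of `z`
    -- against `x` is the weight of the difference word `z + x`.
    refine Finset.sum_nbij' (fun z => z + x) (fun z => z + x) ?_ ?_ ?_ ?_ ?_
    · intro z hz
      rw [mem_codewords] at hz hx
      simp [Matrix.mulVec_add, hz, hx]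
    · intro z hz
      rw [mem_codewords] at hx ⊢
      simp at hz
      simp [Matrix.mulVec_add, hz, hx]
    · intro z _
      rw [add_assoc, hxx, add_zero]
    · intro z _
      rw [add_assoc, hxx, add_zero]
    · intro z _
      rw [hz, hz, wordWeight, ← Finset.prod_mul_distrib]
      refine Finset.prod_congr rfl fun v _ => ?_
      have hb : ∀ b d : ZMod 2, (b + d = 0 ∧ b = d) ∨ (b + d ≠ 0 ∧ b = d + 1) := by decide
      rw [Pi.add_apply]
      rcases hb (z v) (x v) with ⟨h1, h2⟩ | ⟨h1, h2⟩
      · rw [if_pos h1, h2, mul_one]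
      · rw [if_neg h1, (W v).expNeg_flipLLR (x v) (hy v).1 ((hy v).2 _), h2, ENNReal.toReal_div,
          mul_div_cancel₀ _ (hpos v).ne']
  rw [hd, outputDensity, ENNReal.toReal_mul, ENNReal.toReal_div, ENNReal.toReal_mul, hS]
  have hNr : (((codewords A).card : ENNReal)⁻¹).toReal ≠ 0 :=
    (ENNReal.toReal_pos (ENNReal.inv_ne_zero.2 hNt) (ENNReal.inv_ne_top.2 hN)).ne'
  have hZ := one_le_partitionFunction A
    fun v => expNeg_nonneg (flipLLR (x v) ((W v).llr (y v)))
  field_simp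

theorem map_flipLLR_channelKernel (x : V → ZMod 2) :
    (channelKernel W x).map (fun y v => flipLLR (x v) ((W v).llr (y v))) =
      llrLaw fun v => (W v).lDensity := by
  have hm : ∀ v, Measurable fun y => flipLLR (x v) ((W v).llr y) := fun v =>
    (measurable_flipLLR _).comp (W v).measurable_llr
  have : ∀ v, SigmaFinite (((W v).law (x v)).map fun y => flipLLR (x v) ((W v).llr y)) := fun v => by
    rw [(W v).map_flipLLR]; infer_instance
  rw [channelKernel_apply, Measure.pi_map_pi fun v => (hm v).aemeasurable]
  simp only [(W _).map_flipLLR]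

/-- The expected log-partition function, in nats. -/
def lintegralLogPartition (c : V → LDensity) : ENNReal :=
  ∫⁻ l, ENNReal.ofReal (Real.log (partitionFunction A fun v => expNeg (l v))) ∂llrLaw c

theorem measurable_log_partitionFunction :
    Measurable fun l : V → EReal => Real.log (partitionFunction A fun v => expNeg (l v)) :=
  Real.measurable_log.comp ((measurable_partitionFunction A).comp
    (measurable_pi_lambda _ fun v => measurable_expNeg.comp (measurable_pi_apply v)))

theorem lintegral_neg_log_posterior {x : V → ZMod 2} (hx : x ∈ codewords A) :
    ∫⁻ y, ENNReal.ofReal (-Real.log (((codewords A).card : ENNReal)⁻¹ *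
      (channelKernel W x).rnDeriv (outputLaw A W) y).toReal) ∂channelKernel W x =
        lintegralLogPartition A fun v => (W v).lDensity := by
  have hm : Measurable fun (y : V → Y) v => flipLLR (x v) ((W v).llr (y v)) :=
    measurable_pi_lambda _ fun v =>
      (measurable_flipLLR _).comp ((W v).measurable_llr.comp (measurable_pi_apply v))
  rw [lintegralLogPartition, ← map_flipLLR_channelKernel W x,
    lintegral_map (measurable_log_partitionFunction A).ennreal_ofReal hm]
  refine lintegral_congr_ae ?_
  filter_upwards [ae_posterior_eq A W hx] with y hy
  rw [hy, Real.log_inv, neg_neg]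

/-- The posterior of `x` times the output law is the output law given `x`, divided by the number of
codewords. So -p log p becomes an average over `x` of the expected -log p given `x`, and that
expectation does not depend on `x`. -/
theorem lintegral_posterior_entropy :
    ∫⁻ y, ENNReal.ofReal (∑ x : V → ZMod 2,
      Real.negMulLog (((posterior (channelKernel W) (codewordLaw A)) y).real {x})) ∂outputLaw A W =
        lintegralLogPartition A fun v => (W v).lDensity := by
  classical
  have hN := codewords_card_ne_zero A
  have hNt : ((codewords A).card : ENNReal) ≠ ⊤ := ENNReal.natCast_ne_top _
  set D : (V → ZMod 2) → (V → Y) → ENNReal := fun x =>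
    (channelKernel W x).rnDeriv (outputLaw A W) with hD
  have hDm : ∀ x, Measurable (D x) := fun x => Measure.measurable_rnDeriv _ _
  have hDt : ∀ᵐ y ∂outputLaw A W, ∀ x, D x y ≠ ⊤ := by
    rw [ae_all_iff]
    intro x
    filter_upwards [Measure.rnDeriv_lt_top (channelKernel W x) (outputLaw A W)] with y hy
    exact hy.ne
  have hm : ∀ x, Measurable fun y => ENNReal.ofReal
      (-Real.log (((codewords A).card : ENNReal)⁻¹ * D x y).toReal) := fun x =>
    (Real.measurable_log.comp ((hDm x).const_mul _).ennreal_toReal).neg.ennreal_ofReal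
  have h1 : ∫⁻ y, ENNReal.ofReal (∑ x : V → ZMod 2,
      Real.negMulLog (((posterior (channelKernel W) (codewordLaw A)) y).real {x}))
        ∂outputLaw A W =
      ∫⁻ y, ∑ x ∈ codewords A, ((codewords A).card : ENNReal)⁻¹ * (D x y * ENNReal.ofReal
        (-Real.log (((codewords A).card : ENNReal)⁻¹ * D x y).toReal)) ∂outputLaw A W := by
    refine lintegral_congr_ae ?_
    filter_upwards [posterior_eq_withDensity_of_countable (channelKernel W) (codewordLaw A), hDt]
      with y hy ht
    have hp : ∀ x, posterior (channelKernel W) (codewordLaw A) y {x} =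
        D x y * codewordLaw A {x} := fun x => by
      rw [hy, withDensity_apply _ (measurableSet_singleton x), lintegral_singleton]
    rw [ENNReal.ofReal_sum_of_nonneg fun x _ =>
      Real.negMulLog_nonneg measureReal_nonneg measureReal_le_one,
      ← Finset.sum_subset (Finset.subset_univ (codewords A))]
    · refine Finset.sum_congr rfl fun x hx => ?_
      have hr : ((posterior (channelKernel W) (codewordLaw A)) y).real {x} =
          (((codewords A).card : ENNReal)⁻¹ * D x y).toReal := by
        rw [Measure.real, hp, codewordLaw_singleton, if_pos hx, mul_comm]
      rw [hr, Real.negMulLog, neg_mul, ← mul_neg, ENNReal.ofReal_mul ENNReal.toReal_nonneg,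
        ENNReal.ofReal_toReal (ENNReal.mul_ne_top (ENNReal.inv_ne_top.2 hN) (ht x)), mul_assoc]
    · intro x _ hx
      rw [Measure.real, hp, codewordLaw_singleton, if_neg hx]
      simp
  have hk : ∀ x, Measurable fun y => ((codewords A).card : ENNReal)⁻¹ * (D x y *
      ENNReal.ofReal (-Real.log (((codewords A).card : ENNReal)⁻¹ * D x y).toReal)) :=
    fun x => ((hDm x).mul (hm x)).const_mul _
  rw [h1, lintegral_finsetSum _ fun x _ => hk x]
  have h2 : ∀ x ∈ codewords A, ∫⁻ y, ((codewords A).card : ENNReal)⁻¹ * (D x y * ENNReal.ofReal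
      (-Real.log (((codewords A).card : ENNReal)⁻¹ * D x y).toReal)) ∂outputLaw A W =
      ((codewords A).card : ENNReal)⁻¹ * lintegralLogPartition A fun v => (W v).lDensity := by
    intro x hx
    have hc := lintegral_const_mul (μ := outputLaw A W) ((codewords A).card : ENNReal)⁻¹
      ((hDm x).mul (hm x))
    refine hc.trans ?_
    rw [← lintegral_neg_log_posterior A W hx]
    congr 1
    exact lintegral_rnDeriv_mul (channelKernel_ac A W hx) (hm x).aemeasurable
  rw [Finset.sum_congr rfl h2, Finset.sum_const, nsmul_eq_mul, ← mul_assoc,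
    ENNReal.mul_inv_cancel hN hNt, one_mul]

/-- The conditional entropy of the codeword in terms of the `L`-densities of the channels. -/
theorem condEntropy_eq_codeEntropy :
    condEntropy A W = (codeEntropy A fun v => (W v).lDensity).toReal := by
  have hn : ∀ l : V → EReal, 0 ≤ Real.log (partitionFunction A fun v => expNeg (l v)) := fun l =>
    Real.log_nonneg (one_le_partitionFunction A fun v => expNeg_nonneg (l v))
  -- Passing to Bochner integrals lets the factor `Real.log 2` be pulled out without any
  -- integrability.
  have e1 : (codeEntropy A fun v => (W v).lDensity).toReal =
      (lintegralLogPartition A fun v => (W v).lDensity).toReal / Real.log 2 := by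
    rw [codeEntropy, lintegralLogPartition, ← integral_eq_lintegral_of_nonneg_ae
        (Filter.Eventually.of_forall fun l => logPartition_nonneg A l)
        (measurable_logPartition A).aestronglyMeasurable,
      ← integral_eq_lintegral_of_nonneg_ae (Filter.Eventually.of_forall hn)
        (measurable_log_partitionFunction A).aestronglyMeasurable, ← integral_div]
    rfl
  have hmeas : Measurable fun y => ∑ x : V → ZMod 2,
      Real.negMulLog (((posterior (channelKernel W) (codewordLaw A)) y).real {x}) := by
    refine Finset.measurable_sum _ fun x _ => Real.continuous_negMulLog.measurable.comp ?_
    exact ((posterior (channelKernel W) (codewordLaw A)).measurable_coe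
      (measurableSet_singleton x)).ennreal_toReal
  rw [e1, condEntropy, integral_eq_lintegral_of_nonneg_ae
    (Filter.Eventually.of_forall fun y => Finset.sum_nonneg fun x _ =>
      Real.negMulLog_nonneg measureReal_nonneg measureReal_le_one) hmeas.aestronglyMeasurable,
    lintegral_posterior_entropy]

end

end

/-! ### Assembly of the theorem -/

/-- Every schedule can be continued until the potential reaches `-H(X|Y) / N`. -/
theorem exists_append_gapU_eq {V C Y : Type*} [Fintype V] [DecidableEq V]
    [Fintype C] [DecidableEq C] [MeasurableSpace Y]
    {A : Matrix C V (ZMod 2)} (hA : (factorGraph A).IsAcyclic) (W : V → BMSChannel Y)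
    (S : List (DirectedEdge A)) :
    ∃ T : List (DirectedEdge A),
      gapU A (S ++ T) (fun v => (W v).lDensity) (S ++ T).length =
        -(1 / (Fintype.card V : ℝ)) * condEntropy A W := by
  have hc : ∀ v, (W v).lDensity.IsSymm := fun v => (W v).isSymm_lDensity
  obtain ⟨T, hT⟩ := exists_settled (c := fun v => (W v).lDensity) hA
    (S.foldl (passMessage A fun v => (W v).lDensity) (initMessages V C))
  refine ⟨T, ?_⟩
  rw [← List.foldl_append] at hT
  rw [gapU, messagesAt, List.take_length, gapPotential_eq, condEntropy_eq_codeEntropy,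
    (codeEntropy_eq_betheEntropy hA hc (messagesAt_isSymm_and_improving hc (S ++ T)).1 hT).2]

theorem mainTheorem1 {V C Y : Type*} [Fintype V] [Nonempty V] [DecidableEq V]
    [Fintype C] [DecidableEq C] [MeasurableSpace Y]
    (A : Matrix C V (ZMod 2)) (hA : (factorGraph A).IsAcyclic)
    (W : V → BMSChannel Y) (c : V → LDensity) (hc : ∀ i, c i = (W i).lDensity)
    (S : List (DirectedEdge A)) :
    Antitone (gapU A S c) ∧
    (LinearIndependent (ZMod 2) A.row →
      gapU A S c 0 =
        1 - codeRate A - (1 / (Fintype.card V : ℝ)) * ∑ i, (c i).entropy) ∧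
    ((∀ a, (checkNbrs A a).Nonempty) →
      gapU A S c 0 =
        1 - (1 - (Fintype.card C : ℝ) / (Fintype.card V : ℝ))
          - (1 / (Fintype.card V : ℝ)) * ∑ i, (c i).entropy) ∧
    (∀ t : ℕ, -(1 / (Fintype.card V : ℝ)) * condEntropy A W ≤ gapU A S c t) ∧
    (∃ T : List (DirectedEdge A),
      gapU A (S ++ T) c (S ++ T).length = -(1 / (Fintype.card V : ℝ)) * condEntropy A W) := by
  obtain rfl : c = fun v => (W v).lDensity := funext hc
  have hs : ∀ v, (W v).lDensity.IsSymm := fun v => (W v).isSymm_lDensity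
  refine ⟨antitone_gapU hs S, fun hli => ?_, fun hne => gapU_zero hne S, fun t => ?_,
    exists_append_gapU_eq hA W S⟩
  · rw [codeRate_of_linearIndependent hli]
    exact gapU_zero (checkNbrs_nonempty_of_linearIndependent hli) S
  -- The truncated schedule is the one continued: `S.take t ++ T` has the same potential as `S`
  -- after `t` messages (also when `t` exceeds the length of `S`) and ends at the bound.
  · obtain ⟨T, hT⟩ := exists_append_gapU_eq hA W (S.take t)
    rw [← hT]
    refine (antitone_gapU hs (S.take t ++ T)
      (show (S.take t).length ≤ (S.take t ++ T).length by simp)).trans_eq ?_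
    simp [gapU, messagesAt]
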